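/- **Model.** Let $\mathcal X\subset\mathbb R^d$ be a Borel set with $0<|\mathcal X|<\infty$ and uniform distribution $\lambda_{\mathcal X}$, let $V$ be a finite-dimensional real inner product space with standard Gaussian measure $\mathcal N_V$, and let $L^p=L^p(\mathcal X,\lambda_{\mathcal X};V)$. Let $\mathbb H$ be a real Hilbert space with orthonormal basis $(e_i)_{i\ge1}$, $\Theta\subset\mathbb H$ a linear subspace containing all $e_i$, and $E_D=\mathrm{span}\{e_1,\dots,e_D\}$ with orthogonal projection $P_{E_D}$. Let $\mathcal G:\Theta\to L^2$ be measurable, $\mathcal G_\theta=\mathcal G(\theta)$, given by a version for which $(\theta,x)\mapsto\mathcal G_\theta(x)$ is jointly measurable. Fix $\theta_0\in\Theta$. Under $P$, the observations $(X_i,Y_i)_{i\ge1}$ are i.i.d. with $Y_i=\mathcal G_{\theta_0}(X_i)+\varepsilon_i$, where $X_i\sim\lambda_{\mathcal X}$ and $\varepsilon_i\sim\mathcal N_V$ are independent; $\mathcal D_N=(X_i,Y_i)_{i\le N}$. Let $\psi_1,\dots,\psi_k\in\mathbb H$ be linearly independent and $\Psi\theta=(\langle\theta,\psi_i\rangle_{\mathbb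 H})_{i\le k}$. Let $D=D(N)\to\infty$, let $\langle\cdot,\cdot\rangle_{\mathcal H_N}$ be an inner product on $E_D$, and let the prior $\Pi_N$ be the centered Gaussian measure on $(E_D,\langle\cdot,\cdot\rangle_{\mathcal H_N})$ with identity covariance, $\theta_N\sim\Pi_N$. With $\ell_N(\theta)=-\frac12\sum_{i\le N}\|Y_i-\mathcal G_\theta(X_i)\|_V^2$, the posterior is $\Pi_N(d\theta\mid\mathcal D_N)\propto e^{\ell_N(\theta)}\,\Pi_N(d\theta)$; laws, means and covariance matrices "given $\mathcal D_N$" are taken with respect to it. Limits are for $N\to\infty$, with $N\ge1$, and $o_P$, $O_P$, $\xrightarrow{P}$ refer to $P$. **Hypothesis 1 (posterior contraction).** Let $\mathcal R=\{x\in\mathbb H:\|x\|_{\mathcal R}<\infty\}$ be a normed space with $\theta_0\in\mathcal R$, and let $\delta_N^{\mathcal G}=N^{-r_1}$, $\delta_N^{\mathbb H}=N^{-r_2}$ with $r_1,r_2\in(0,1/2)$, $s_N=N(\delta^{\mathcal G}_N)^2$. Put $\Theta_{N,M}=\{\theta\in E_D:\|\mathcal G_\theta-\mathcal G_{\theta_0}\|_{L^2}\le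 M\delta_N^{\mathcal G},\ \|\theta\|_{\mathcal R}\le M\}$. For all $M>0$ there is $M'>0$ such that $\|\theta-\theta_0\|_{\mathbb H}\le M'\delta_N^{\mathbb H}$ for all $N$ and all $\theta\in\Theta_{N,M}$. There are $M_0>0$ and $0<a<b<c$ such that for all Borel sets $B_N\subset E_D$ with $\Pi_N(B_N)\ge1-e^{-cs_N}$ for all large $N$, the sets $\mathcal B_N=B_N\cap\Theta_{N,M_0}$ satisfy $$\Pi_N(\mathcal B_N\mid\mathcal D_N)=1-O_P(e^{-bs_N}),\qquad P\Big(\int_{\mathcal B_N}e^{\ell_N-\ell_N(\theta_0)}\,d\Pi_N>e^{-as_N}\Big)\to1 .$$ **Hypothesis 2 (linearization).** There is a bounded linear operator $\mathbb I:\mathbb H\to L^2$ with $\|\mathcal G(\theta_0+\varepsilon h)-\mathcal G(\theta_0)-\varepsilon\,\mathbb I h\|_{L^2}=o(\varepsilon)$ as $\varepsilon\to0$, for every $h\in\Theta$. Put $R_\theta=\mathcal G_\theta-\mathcal G_{\theta_0}-\mathbb I[\theta-\theta_0]$. **Hypothesis 3 (entropy).** There are a metric $d_\Theta$ on $\Theta$,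 positive sequences $\delta_N^\Theta,\sigma_N,g_N,r_N$ and functions $J_N$ on $[0,\infty)$ such that for every $M>0$ there is a constant $C_M>0$ with, for all $N$, all $\theta,\theta'\in\Theta_{N,M}$ and all $t\ge0$: $d_\Theta(\theta,\theta_0)\le C_M\delta_N^\Theta$; $\|R_\theta\|_{L^2}\le C_M\sigma_N$; $\|\mathcal G_\theta-\mathcal G_{\theta'}\|_{L^\infty}\le C_Mg_N\,d_\Theta(\theta,\theta')$; $\|R_\theta-R_{\theta'}\|_{L^\infty}\le C_Mr_N\,d_\Theta(\theta,\theta')$; and $\int_0^t\sqrt{\log 2N(\Theta_{N,M},d_\Theta;\varepsilon)}\,d\varepsilon\le C_MJ_N(t)$, where $N(\cdot,d_\Theta;\varepsilon)$ is the $\varepsilon$-covering number. **Hypothesis 4 (invertibility).** The operator $\mathcal I_D=P_{E_D}\mathbb I^*\mathbb I|_{E_D}:E_D\to E_D$ is invertible for every $D$. **Notation.** Let $[\mathcal I_D]_{ij}=\langle\mathcal I_De_i,e_j\rangle_{\mathbb H}$ and $(\mathcal J_D)_{ij}=\langle\psi_i,e_j\rangle_{\mathbb H}$. For large $D$ let $i_D=(\mathcal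 J_D[\mathcal I_D]^{-1}\mathcal J_D^\top)^{-1}$, with positive semidefinite square root $i_D^{1/2}$. Let $\bar\psi_D^j=\mathcal I_D^{-1}P_{E_D}\psi_j$, $\bar{\boldsymbol\psi}_D=(\bar\psi_D^j)_{j\le k}$, $\boldsymbol h_N=N^{-1/2}i_D^{1/2}\bar{\boldsymbol\psi}_D\in E_D^k$, and for $\lambda\in\mathbb R^k$ let $\lambda^\top\boldsymbol h_N\in E_D$ be the corresponding linear combination. Norms of $k$-tuples are maxima of the norms of the components. Let $$\Psi_N=\Psi\theta_0+\Big(\frac1N\sum_{i=1}^N\langle\varepsilon_i,\mathbb I\bar\psi_D^j(X_i)\rangle_V\Big)_{j\le k},\qquad Z_N=\sqrt N\,i_D^{1/2}(\Psi\theta_N-\Psi_N).$$ **Lemma.** Grant Hypotheses 1–4, and assume: 1. $\sup_{\theta\in\Theta_{N,M}}\|\mathcal G(\theta+\lambda^\top\boldsymbol h_N)-\mathcal G(\theta)\|_{L^2}=o(\delta_N^{\mathcal G})$ for all $\lambda\in\mathbb R^k$ and $M>0$; 2. $\|\bar{\boldsymbol\psi}_D\|_{\mathcal R}=o(\sqrt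 N)$; 3. $\sqrt N\,r_NJ_N(\sigma_N/r_N)\to0$; 4. $\sqrt{\log N}\,r_N^3\delta_N^\Theta J_N(\sigma_N/r_N)^2/\sigma_N^2\to0$; 5. $\sqrt N\,g_N^2\delta_N^\Theta J_N(\delta_N^\Theta)\to0$; 6. $g_NJ_N(\delta_N^\Theta)\to0$; 7. $N(\sigma_N^2+\sigma_N\delta_N^{\mathbb H})\to0$; 8. $\sqrt N\,\|\theta_0-P_{E_D}\theta_0\|_{\mathbb H}\to0$; 9. $\sqrt N\,\delta_N^{\mathbb H}\,\|\psi_j-P_{E_D}\psi_j\|_{\mathbb H}\to0$ for all $j\le k$; 10. $\delta_N^{\mathcal G}\,\|\bar{\boldsymbol\psi}_D\|_{\mathcal H_N}\to0$; 11. $N e^{-(b-a)s_N}\,\mathbb E\|\theta_N\|_{\mathbb H}^4\to0$, where $\theta_N\sim\Pi_N$. Then $$d_{\mathrm{BL}}\big(\mathcal L(Z_N\mid\mathcal D_N),\,\mathcal N(0,I_k)\big)\xrightarrow{P}0,$$ where $d_{\mathrm{BL}}$ is the bounded Lipschitz metric. Moreover $Z_N$ has finite second posterior moments, and $$\mathbb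 E[Z_N\mid\mathcal D_N]\xrightarrow{P}0,\qquad \mathbb V[Z_N\mid\mathcal D_N]\xrightarrow{P}I_k .$$ -/

import Mathlib

open MeasureTheory ProbabilityTheory Filter Topology
open scoped ENNReal NNReal RealInnerProductSpace MatrixOrder Matrix.Norms.L2Operator

noncomputable section

namespace RenormBvM

/-! ### General notions -/

/-- The uniform distribution on a set `S` of `ℝ^d`, as a measure on the subtype. -/
def uniformMeasure {d : ℕ} (S : Set (EuclideanSpace ℝ (Fin d))) : Measure S :=
  (volume S)⁻¹ • (volume : Measure (EuclideanSpace ℝ (Fin d))).comap (Subtype.val : S → _)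

/-- `n` is the extended norm of a normed space `{x ∈ H : n x < ∞}` contained in `H`. -/
structure IsExtendedNorm {H : Type*} [AddCommGroup H] [Module ℝ H] (n : H → ℝ≥0∞) : Prop where
  add_le : ∀ x y, n (x + y) ≤ n x + n y
  smul : ∀ (c : ℝ) (x : H), n (c • x) = ‖c‖ₑ * n x
  eq_zero : ∀ x, n x = 0 → x = 0

/-- The bounded Lipschitz distance of two probability measures. -/
def blDist {E : Type*} [PseudoEMetricSpace E] [MeasurableSpace E] (μ ν : Measure E) : ℝ :=
  sSup {t | ∃ f : E → ℝ, LipschitzWith 1 f ∧ (∀ x, |f x| ≤ 1) ∧ t = |∫ x, f x ∂μ - ∫ x, f x ∂ν|}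

/-- `X_N = O_P(ρ_N)` under `P`. -/
def IsBigOInProb {Ω : Type*} [MeasurableSpace Ω] (P : Measure Ω) (X : ℕ → Ω → ℝ) (ρ : ℕ → ℝ) :
    Prop :=
  ∀ η : ℝ≥0∞, 0 < η → ∃ K : ℝ, ∀ᶠ N in atTop, P {ω | K * ρ N < |X N ω|} ≤ η

/-- `√(log 2n)` for a covering number `n ∈ ℕ ∪ {∞}`. -/
def sqrtLogTwo : ℕ∞ → ℝ≥0∞
  | ⊤ => ∞
  | (n : ℕ) => ENNReal.ofReal (Real.sqrt (Real.log (2 * n)))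

/-- The span of the first `D` vectors of an orthonormal basis. -/
def spanFirst {H : Type*} [NormedAddCommGroup H] [InnerProductSpace ℝ H]
    (e : HilbertBasis ℕ ℝ H) (D : ℕ) : Submodule ℝ H :=
  Submodule.span ℝ (Set.range fun i : Fin D => e i)

instance {H : Type*} [NormedAddCommGroup H] [InnerProductSpace ℝ H]
    (e : HilbertBasis ℕ ℝ H) (D : ℕ) : FiniteDimensional ℝ (spanFirst e D) :=
  FiniteDimensional.span_of_finite ℝ (Set.finite_range _)

/-! ### The regression model, the functional and the prior -/

variable {d k : ℕ} {H V : Type*}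
  [NormedAddCommGroup H] [InnerProductSpace ℝ H] [CompleteSpace H]
  [MeasurableSpace H] [BorelSpace H]
  [NormedAddCommGroup V] [InnerProductSpace ℝ V] [FiniteDimensional ℝ V]
  [MeasurableSpace V] [BorelSpace V]

/-- The random design regression model `Y = G_θ(X) + ε` with a Gaussian sieve prior.
The regression map is given by a jointly measurable version `(θ, x) ↦ G_θ(x)`. -/
structure Model (d k : ℕ) (H V : Type*)
    [NormedAddCommGroup H] [InnerProductSpace ℝ H] [CompleteSpace H]
    [MeasurableSpace H] [BorelSpace H]
    [NormedAddCommGroup V] [InnerProductSpace ℝ V] [FiniteDimensional ℝ V]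
    [MeasurableSpace V] [BorelSpace V] where
  /-- the design domain -/
  𝒳 : Set (EuclideanSpace ℝ (Fin d))
  measurableSet_domain : MeasurableSet 𝒳
  volume_pos : 0 < volume 𝒳
  volume_lt_top : volume 𝒳 < ∞
  /-- the parameter space -/
  Θ : Submodule ℝ H
  /-- the orthonormal basis of `H` -/
  e : HilbertBasis ℕ ℝ H
  basis_mem : ∀ i, e i ∈ Θ
  /-- the forward map -/
  G : Θ → 𝒳 → V
  measurable_G : Measurable fun p : Θ × 𝒳 => G p.1 p.2
  memLp_G : ∀ θ, MemLp (G θ) 2 (uniformMeasure 𝒳)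
  /-- the ground truth -/
  θ₀ : Θ
  /-- the representers of the linear functionals -/
  ψ : Fin k → H
  linearIndependent_ψ : LinearIndependent ℝ ψ
  /-- the dimension of the approximation space for sample size `N` -/
  D : ℕ → ℕ
  tendsto_D : Tendsto D atTop atTop
  /-- the inner product `⟨·,·⟩_{H_N}` on the approximation space -/
  ip : ∀ N, InnerProductSpace.Core ℝ (spanFirst e (D N))
  /-- the prior -/
  prior : ∀ N, Measure (spanFirst e (D N))
  /-- the prior is the centered Gaussian measure on `(E_D, ⟨·,·⟩_{H_N})` with identity
  covariance: `⟨θ, h⟩_{H_N}` has law `N(0, ⟨h, h⟩_{H_N})` for every `h`. -/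
  prior_map : ∀ N h, (prior N).map (fun θ => (ip N).inner θ h) =
    gaussianReal 0 ((ip N).inner h h).toNNReal

namespace Model

variable (M : Model d k H V)

/-- The approximation space `E_D`. -/
abbrev E (D : ℕ) : Submodule ℝ H := spanFirst M.e D

/-- The law `λ_𝒳` of the design points. -/
abbrev lam : Measure M.𝒳 := uniformMeasure M.𝒳

lemma E_le (D : ℕ) : M.E D ≤ M.Θ :=
  Submodule.span_le.2 (by rintro _ ⟨i, rfl⟩; exact M.basis_mem i)

/-- The inclusion `E_D → Θ`. -/
def toΘ {D : ℕ} (θ : M.E D) : M.Θ := Submodule.inclusion (M.E_le D) θ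

/-- The norm of `L²(𝒳; V)`. -/
def L2norm (f : M.𝒳 → V) : ℝ≥0∞ := eLpNorm f 2 M.lam

/-- The (essential) supremum norm of `L^∞(𝒳; V)`. -/
def LinftyNorm (f : M.𝒳 → V) : ℝ≥0∞ := eLpNorm f ∞ M.lam

/-- The law of one observation `(X, Y)` under the ground truth. -/
def obsLaw : Measure (M.𝒳 × V) :=
  (M.lam.prod (stdGaussian V)).map fun p => (p.1, M.G M.θ₀ p.1 + p.2)

/-- The law of the infinite sequence of observations under the ground truth. -/
def P : Measure (ℕ → M.𝒳 × V) := Measure.infinitePi fun _ => M.obsLaw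

/-- The log-likelihood `ℓ_N`; the first `N` observations are `ω 0, …, ω (N - 1)`. -/
def logLik (N : ℕ) (ω : ℕ → M.𝒳 × V) (θ : M.Θ) : ℝ :=
  -(1 / 2) * ∑ i ∈ Finset.range N, ‖(ω i).2 - M.G θ (ω i).1‖ ^ 2

/-- The posterior, with density proportional to `exp ℓ_N` with respect to the prior. -/
def posterior (N : ℕ) (ω : ℕ → M.𝒳 × V) : Measure (M.E (M.D N)) :=
  (M.prior N).tilted fun θ => M.logLik N ω (M.toΘ θ)

/-- The functional `Ψ`. -/
def Psi (θ : H) : EuclideanSpace ℝ (Fin k) := WithLp.toLp 2 fun i => ⟪θ, M.ψ i⟫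

/-- The norm of `⟨·,·⟩_{H_N}`. -/
def ipNorm (N : ℕ) (h : M.E (M.D N)) : ℝ := Real.sqrt ((M.ip N).inner h h)

/-! ### Contraction -/

/-- `δ = N^{-ρ}`. -/
def rate (ρ : ℝ) (N : ℕ) : ℝ := (N : ℝ) ^ (-ρ)

/-- `s_N = N δ_N²` for `δ_N = N^{-ρ}`. -/
def speed (ρ : ℝ) (N : ℕ) : ℝ := N * rate ρ N ^ 2

/-- The set `Θ_{N,m}`. -/
def localSet (nR : H → ℝ≥0∞) (r₁ : ℝ) (N : ℕ) (m : ℝ) : Set (M.E (M.D N)) :=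
  {θ | M.L2norm (M.G (M.toΘ θ) - M.G M.θ₀) ≤ ENNReal.ofReal (m * rate r₁ N) ∧
    nR θ ≤ ENNReal.ofReal m}

/-- The posterior contraction hypothesis with the normed space `{x : nR x < ∞}`, the rates
`N^{-r₁}` (forward) and `N^{-r₂}` (in `H`), and the constants `M₀`, `a < b < c`. -/
structure PosteriorContraction (nR : H → ℝ≥0∞) (r₁ r₂ M₀ a b c : ℝ) : Prop where
  norm : IsExtendedNorm nR
  truth_mem : nR M.θ₀ < ∞
  r₁_mem : r₁ ∈ Set.Ioo (0 : ℝ) (1 / 2)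
  r₂_mem : r₂ ∈ Set.Ioo (0 : ℝ) (1 / 2)
  stability : ∀ m : ℝ, 0 < m → ∃ m' : ℝ, 0 < m' ∧ ∀ N : ℕ, 1 ≤ N →
    ∀ θ ∈ M.localSet nR r₁ N m, ‖(θ : H) - M.θ₀‖ ≤ m' * rate r₂ N
  M₀_pos : 0 < M₀
  a_pos : 0 < a
  a_lt_b : a < b
  b_lt_c : b < c
  contraction : ∀ B : (N : ℕ) → Set (M.E (M.D N)), (∀ N, MeasurableSet (B N)) →
    (∀ᶠ N in atTop, 1 - Real.exp (-c * speed r₁ N) ≤ (M.prior N).real (B N)) →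
    IsBigOInProb M.P
        (fun N ω => 1 - (M.posterior N ω).real (B N ∩ M.localSet nR r₁ N M₀))
        (fun N => Real.exp (-b * speed r₁ N)) ∧
      Tendsto (fun N => M.P {ω | Real.exp (-a * speed r₁ N) <
        ∫ θ in B N ∩ M.localSet nR r₁ N M₀,
          Real.exp (M.logLik N ω (M.toΘ θ) - M.logLik N ω M.θ₀) ∂(M.prior N)}) atTop (𝓝 1)

/-! ### Linearization and entropy -/

/-- `A` is the linearization of the forward map at the ground truth, along `Θ`. -/
def IsLinearization (A : H →L[ℝ] Lp V 2 M.lam) : Prop :=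
  ∀ h : M.Θ, (fun t : ℝ => (M.L2norm fun x =>
      M.G (M.θ₀ + t • h) x - M.G M.θ₀ x - t • A (h : H) x).toReal) =o[𝓝 0] fun t : ℝ => t

/-- The linearization error `R_θ = G_θ - G_{θ₀} - A[θ - θ₀]`. -/
def linErr (A : H →L[ℝ] Lp V 2 M.lam) (θ : M.Θ) (x : M.𝒳) : V :=
  M.G θ x - M.G M.θ₀ x - A ((θ : H) - M.θ₀) x

/-- The covering number of a subset of `Θ` with respect to the metric `dΘ`. -/
def covNum (dΘ : MetricSpace M.Θ) (ε : ℝ≥0) (S : Set M.Θ) : ℕ∞ :=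
  @Metric.externalCoveringNumber M.Θ dΘ.toPseudoMetricSpace.toPseudoEMetricSpace ε S

/-- The bounds on diameter, linearization error, Lipschitz constants and entropy of `Θ_{N,m}`
in terms of a metric `dΘ` on `Θ`, up to constants that depend on `m` only. -/
structure EntropyBounds (nR : H → ℝ≥0∞) (r₁ : ℝ) (A : H →L[ℝ] Lp V 2 M.lam)
    (dΘ : MetricSpace M.Θ) (δΘ σ g r : ℕ → ℝ) (J : ℕ → ℝ → ℝ) : Prop where
  pos : ∀ N, 1 ≤ N → 0 < δΘ N ∧ 0 < σ N ∧ 0 < g N ∧ 0 < r N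
  bounds : ∀ m : ℝ, 0 < m → ∃ C : ℝ, 0 < C ∧ ∀ N : ℕ, 1 ≤ N →
    (∀ θ ∈ M.localSet nR r₁ N m, dΘ.dist (M.toΘ θ) M.θ₀ ≤ C * δΘ N) ∧
    (∀ θ ∈ M.localSet nR r₁ N m,
      M.L2norm (M.linErr A (M.toΘ θ)) ≤ ENNReal.ofReal (C * σ N)) ∧
    (∀ θ ∈ M.localSet nR r₁ N m, ∀ θ' ∈ M.localSet nR r₁ N m,
      M.LinftyNorm (M.G (M.toΘ θ) - M.G (M.toΘ θ')) ≤
        ENNReal.ofReal (C * g N * dΘ.dist (M.toΘ θ) (M.toΘ θ'))) ∧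
    (∀ θ ∈ M.localSet nR r₁ N m, ∀ θ' ∈ M.localSet nR r₁ N m,
      M.LinftyNorm (M.linErr A (M.toΘ θ) - M.linErr A (M.toΘ θ')) ≤
        ENNReal.ofReal (C * r N * dΘ.dist (M.toΘ θ) (M.toΘ θ'))) ∧
    (∀ t : ℝ, 0 ≤ t →
      ∫⁻ ε in Set.Ioc 0 t, sqrtLogTwo (M.covNum dΘ ε.toNNReal (M.toΘ '' M.localSet nR r₁ N m)) ≤
        ENNReal.ofReal (C * J N t))

/-! ### Information -/

/-- The orthogonal projection of `H` onto `E_D`. -/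
def proj (D : ℕ) : H →L[ℝ] M.E D := (M.E D).orthogonalProjectionOnto

/-- The information operator `A* A`. -/
def info (A : H →L[ℝ] Lp V 2 M.lam) : H →L[ℝ] H := (ContinuousLinearMap.adjoint A).comp A

/-- The information operator `P_{E_D} A* A` on `E_D`. -/
def infoD (A : H →L[ℝ] Lp V 2 M.lam) (D : ℕ) : M.E D →L[ℝ] M.E D :=
  ((M.proj D).comp (M.info A)).comp (M.E D).subtypeL

/-- The basis vector `e_i` as an element of `E_D`. -/
def basisE (D : ℕ) (i : Fin D) : M.E D := ⟨M.e i, Submodule.subset_span ⟨i, rfl⟩⟩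

/-- The information matrix. -/
def infoMatrix (A : H →L[ℝ] Lp V 2 M.lam) (D : ℕ) : Matrix (Fin D) (Fin D) ℝ :=
  Matrix.of fun i j => ⟪(M.infoD A D (M.basisE D i) : H), M.e j⟫

/-- The Jacobian of `Ψ` in the coordinates of `E_D`. -/
def jacobian (D : ℕ) : Matrix (Fin k) (Fin D) ℝ := Matrix.of fun i j => ⟪M.ψ i, M.e j⟫

/-- The matrix `i_D = (𝒥_D [ℐ_D]⁻¹ 𝒥_Dᵀ)⁻¹`. -/
def effInfo (A : H →L[ℝ] Lp V 2 M.lam) (D : ℕ) : Matrix (Fin k) (Fin k) ℝ :=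
  (M.jacobian D * (M.infoMatrix A D)⁻¹ * (M.jacobian D).transpose)⁻¹

/-- The positive semidefinite square root `i_D^{1/2}`. -/
def sqrtEffInfo (A : H →L[ℝ] Lp V 2 M.lam) (D : ℕ) : Matrix (Fin k) (Fin k) ℝ :=
  CFC.sqrt (M.effInfo A D)

/-- The vectors `ψ̄_D^j = ℐ_D⁻¹ P_{E_D} ψ_j`. -/
def psiBar (A : H →L[ℝ] Lp V 2 M.lam) (D : ℕ) (j : Fin k) : M.E D :=
  (M.infoD A D).inverse (M.proj D (M.ψ j))

/-- The perturbation `λᵀ h_N`, where `h_N = N^{-1/2} i_D^{1/2} ψ̄_D`. -/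
def shift (A : H →L[ℝ] Lp V 2 M.lam) (N : ℕ) (v : EuclideanSpace ℝ (Fin k)) : M.E (M.D N) :=
  ∑ i, v i • ((Real.sqrt N)⁻¹ • ∑ j, M.sqrtEffInfo A (M.D N) i j • M.psiBar A (M.D N) j)

/-- The centering statistic `Ψ_N`, where `ε_i = Y_i - G_{θ₀}(X_i)`. -/
def center (A : H →L[ℝ] Lp V 2 M.lam) (N : ℕ) (ω : ℕ → M.𝒳 × V) : EuclideanSpace ℝ (Fin k) :=
  M.Psi M.θ₀ + WithLp.toLp 2 fun j => (N : ℝ)⁻¹ * ∑ i ∈ Finset.range N,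
    ⟪(ω i).2 - M.G M.θ₀ (ω i).1, A (M.psiBar A (M.D N) j : H) (ω i).1⟫

/-- The random vector `Z_N = √N i_D^{1/2} (Ψθ - Ψ_N)` on the approximation space. -/
def Z (A : H →L[ℝ] Lp V 2 M.lam) (N : ℕ) (ω : ℕ → M.𝒳 × V) (θ : M.E (M.D N)) :
    EuclideanSpace ℝ (Fin k) :=
  Real.sqrt N • Matrix.toEuclideanLin (M.sqrtEffInfo A (M.D N)) (M.Psi θ - M.center A N ω)

/-- The posterior covariance matrix of `Z_N`. -/
def covZ (A : H →L[ℝ] Lp V 2 M.lam) (N : ℕ) (ω : ℕ → M.𝒳 × V) : Matrix (Fin k) (Fin k) ℝ :=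
  Matrix.of fun i j =>
    covariance (fun θ => M.Z A N ω θ i) (fun θ => M.Z A N ω θ j) (M.posterior N ω)

end Model

end RenormBvM

end

/-!
The proof computes the limit of the Laplace transform of the posterior law of `Z_N`, restricted to
parameter sets that carry almost all of the posterior mass.

*Expansion.* Along the perturbations `θ ↦ θ + λᵀ h_N` the log-likelihood changes by
`-⟨λ, Z_N(θ)⟩ - ‖λ‖² / 2`, up to an error that is uniformly small in probability over the local sets
(`exists_expansion`). Indeed `ψ̄_D^j` is chosen such that `⟨𝕀 u, 𝕀 ψ̄_D^j⟩ = ⟨u, ψ_j⟩` on `E_D`, and the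
factor `i_D^{1/2}` normalizes the perturbations to `N ‖𝕀 λᵀ h_N‖² = ‖λ‖²` (`norm_A_dir_sqrtMap`). The
deterministic part of the error is a bound in `L²` (`exists_deterministic_bound`). The random part
consists of a multiplier process of the linearization errors and an empirical process of squared
distances (`exists_bound_mulProc`, `exists_bound_empProc`), both controlled by chaining
(`exists_chaining_bound`). These bounds concern differences within a local set, while the truth need
not belong to `E_D`; it is therefore replaced by a parameter of the local set, and the two regression
functions are uniformly close (`tendsto_LinftyNorm_sub_truth`).

*Laplace transforms.* By this expansion, `∫ e^{-⟨λ, Z_N⟩} dΠ(· | 𝒟_N)` over a set is close to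
`e^{‖λ‖² / 2}` times the integral of the likelihood at `θ + λᵀ h_N`, normalized by the evidence. The
Cameron–Martin formula (`prior_map_add`) removes the shift, and the density that it produces is close
to one on the sets `truncSet`, where the functionals `⟨·, ψ̄_D^j⟩_{H_N}` are not much larger than
`√s_N` standard deviations. As these sets and their translates have posterior probability tending to
one, the Laplace transforms converge to `e^{‖λ‖² / 2}` in probability (`laplace_bounds`,
`tendsto_laplace`). Convergence in probability is treated as convergence along a filter on `ℕ × Ω`
(`inProb`), and the implication from Laplace transforms to weak convergence is proved for all filters
(`tendsto_stdGaussian_of_lintegral_exp`), so that no subsequences are extracted. Exponential moments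
give uniform integrability, hence convergence of the truncated first and second moments
(`tendsto_blDist_map`, `tendsto_integral_comp`).

*Tails.* Off the truncated sets the posterior mass is `O_P(e^{-b s_N})`. The second moment of `Z_N`
there is balanced against the sixth posterior moment of `θ` (`tendsto_lintegral_norm_Z_sq_compl`),
which is at most the sixth prior moment divided by the evidence, up to a factor bounded in
probability; for Gaussian measures the sixth moment is controlled by the fourth
(`integral_norm_pow_six_le`).
-/

noncomputable section

namespace RenormBvM

/-! ### Weak convergence from moment generating functions -/

section MGF

variable {E : Type*} [NormedAddCommGroup E] [MeasurableSpace E] [BorelSpace E]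

/-- The moment generating functions of all one-dimensional projections determine a finite
measure, provided that they are finite everywhere. -/
lemma measure_ext_of_lintegral_exp [NormedSpace ℝ E] [CompleteSpace E] [SecondCountableTopology E]
    {μ ν : Measure E} [IsFiniteMeasure μ] [IsFiniteMeasure ν]
    (hfin : ∀ L : StrongDual ℝ E, ∫⁻ x, ENNReal.ofReal (Real.exp (L x)) ∂μ ≠ ∞)
    (h : ∀ L : StrongDual ℝ E, ∫⁻ x, ENNReal.ofReal (Real.exp (L x)) ∂μ =
      ∫⁻ x, ENNReal.ofReal (Real.exp (L x)) ∂ν) : μ = ν := by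
  have hfin' : ∀ L : StrongDual ℝ E, ∫⁻ x, ENNReal.ofReal (Real.exp (L x)) ∂ν ≠ ∞ :=
    fun L => h L ▸ hfin L
  have hmeas : ∀ (L : StrongDual ℝ E) (ρ : Measure E),
      AEStronglyMeasurable (fun x => Real.exp (L x)) ρ := fun L ρ =>
    (Real.continuous_exp.comp L.continuous).aestronglyMeasurable
  have hint : ∀ (ρ : Measure E) (_ : ∀ L : StrongDual ℝ E,
      ∫⁻ x, ENNReal.ofReal (Real.exp (L x)) ∂ρ ≠ ∞) (L : StrongDual ℝ E),
      Integrable (fun x => Real.exp (L x)) ρ := by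
    intro ρ hρ L
    refine ⟨hmeas L ρ, ?_⟩
    rw [hasFiniteIntegral_iff_ofReal (ae_of_all _ fun x => (Real.exp_pos _).le)]
    exact (hρ L).lt_top
  refine Measure.ext_of_charFunDual ?_
  funext L
  have key : ∀ (ρ : Measure E) (_ : ∀ L : StrongDual ℝ E,
      ∫⁻ x, ENNReal.ofReal (Real.exp (L x)) ∂ρ ≠ ∞), integrableExpSet (fun x => L x) ρ = Set.univ := by
    intro ρ hρ
    ext t
    simp only [integrableExpSet, Set.mem_ofPred_eq, Set.mem_univ, iff_true]
    simpa using hint ρ hρ (t • L)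
  have hmgf : mgf (fun x => L x) μ = mgf (fun x => L x) ν := by
    funext t
    have e : ∀ ρ : Measure E, mgf (fun x => L x) ρ t =
        (∫⁻ x, ENNReal.ofReal (Real.exp ((t • L) x)) ∂ρ).toReal := by
      intro ρ
      rw [mgf, integral_eq_lintegral_of_nonneg_ae (ae_of_all _ fun x => (Real.exp_pos _).le)]
      · simp
      · simpa using hmeas (t • L) ρ
    rw [e, e, h]
  have h0 : μ = 0 ↔ ν = 0 := by
    have := h 0
    simp only [zero_apply, Real.exp_zero, ENNReal.ofReal_one, lintegral_one]
      at this
    rw [← Measure.measure_univ_eq_zero, this, Measure.measure_univ_eq_zero]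
  have := eqOn_complexMGF_of_mgf' hmgf h0 (x := Complex.I) (by simp [key μ hfin])
  simpa [complexMGF, charFunDual_apply, mul_comm] using this

/-- Uniform integrability: a bound on the second moment of `f` turns weak convergence into
convergence of the integrals of `f`. -/
lemma tendsto_integral_of_lintegral_sq_le {ι : Type*} {l : Filter ι} {μ : ι → ProbabilityMeasure E}
    {ν : ProbabilityMeasure E} (hμ : Tendsto μ l (𝓝 ν)) {f : E → ℝ} (hf : Continuous f) {K : ℝ≥0}
    (hK : ∀ᶠ i in l, ∫⁻ x, ENNReal.ofReal (f x ^ 2) ∂(μ i : Measure E) ≤ K)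
    (hKν : ∫⁻ x, ENNReal.ofReal (f x ^ 2) ∂(ν : Measure E) ≤ K) :
    Tendsto (fun i => ∫ x, f x ∂(μ i : Measure E)) l (𝓝 (∫ x, f x ∂(ν : Measure E))) := by
  -- truncation at level `R` costs at most `f ^ 2 / R`
  have htr : ∀ (R : ℝ), 0 < R → ∀ (ρ : Measure E) [IsProbabilityMeasure ρ],
      ∫⁻ x, ENNReal.ofReal (f x ^ 2) ∂ρ ≤ K →
      |∫ x, f x ∂ρ - ∫ x, max (-R) (min (f x) R) ∂ρ| ≤ K / R := by
    intro R hR ρ _ hρ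
    have hsq : Integrable (fun x => f x ^ 2) ρ := by
      refine ⟨(hf.pow 2).aestronglyMeasurable, ?_⟩
      rw [hasFiniteIntegral_iff_ofReal (ae_of_all _ fun x => sq_nonneg _)]
      exact hρ.trans_lt (by simp)
    have hsqle : ∫ x, f x ^ 2 ∂ρ ≤ K := by
      rw [integral_eq_lintegral_of_nonneg_ae (ae_of_all _ fun x => sq_nonneg _)
        (hf.pow 2).aestronglyMeasurable]
      simpa using ENNReal.toReal_mono (by simp) hρ
    have hfi : Integrable f ρ := by
      have := (memLp_two_iff_integrable_sq hf.aestronglyMeasurable).2 hsq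
      exact this.integrable (by norm_num)
    have hgi : Integrable (fun x => max (-R) (min (f x) R)) ρ := by
      refine Integrable.mono' (integrable_const R) (by fun_prop) (ae_of_all _ fun x => ?_)
      rw [Real.norm_eq_abs, abs_le]
      exact ⟨le_max_left _ _, max_le (by linarith) (min_le_right _ _)⟩
    rw [← integral_sub hfi hgi]
    refine (abs_integral_le_integral_abs).trans ?_
    refine (integral_mono (hfi.sub hgi).abs (hsq.div_const R) fun x => ?_).trans ?_
    · show |f x - max (-R) (min (f x) R)| ≤ f x ^ 2 / R
      rw [le_div_iff₀ hR]
      rcases le_total (f x) R with h1 | h1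
      · rw [min_eq_left h1]
        rcases le_total (-R) (f x) with h2 | h2
        · rw [max_eq_right h2]; simp; positivity
        · rw [max_eq_left h2, abs_of_nonpos (by linarith)]; nlinarith
      · rw [min_eq_right h1, max_eq_right (by linarith), abs_of_nonneg (by linarith)]
        nlinarith
    · rw [integral_div]
      gcongr
  rw [Metric.tendsto_nhds]
  intro ε hε
  obtain ⟨R, hR, hKR⟩ : ∃ R : ℝ, 0 < R ∧ K / R < ε / 3 := by
    refine ⟨(3 * K + 1) / ε, by positivity, ?_⟩
    rw [div_div_eq_mul_div, div_lt_iff₀ (by positivity)]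
    have := K.2
    nlinarith
  let F : BoundedContinuousFunction E ℝ := BoundedContinuousFunction.ofNormedAddCommGroup
    (fun x => max (-R) (min (f x) R)) (by fun_prop) R (fun x => by
      rw [Real.norm_eq_abs, abs_le]
      exact ⟨le_max_left _ _, max_le (by linarith) (min_le_right _ _)⟩)
  have hF := (ProbabilityMeasure.tendsto_iff_forall_integral_tendsto.1 hμ) F
  rw [Metric.tendsto_nhds] at hF
  filter_upwards [hK, hF (ε / 3) (by positivity)] with i hi1 hi2
  have a1 := htr R hR (μ i) hi1
  have a2 := htr R hR ν hKν
  rw [Real.dist_eq] at hi2 ⊢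
  change |∫ x, max (-R) (min (f x) R) ∂(μ i : Measure E) -
    ∫ x, max (-R) (min (f x) R) ∂(ν : Measure E)| < ε / 3 at hi2
  rw [abs_lt] at hi2 ⊢
  rw [abs_le] at a1 a2
  constructor <;> linarith

/-- Lower semicontinuity of the integral of a nonnegative continuous function. -/
lemma lintegral_le_of_tendsto {ι : Type*} {l : Filter ι} [l.NeBot] {μ : ι → ProbabilityMeasure E}
    {ν : ProbabilityMeasure E} (hμ : Tendsto μ l (𝓝 ν)) {f : E → ℝ≥0} (hf : Continuous f) {K : ℝ≥0}
    (hK : ∀ᶠ i in l, ∫⁻ x, f x ∂(μ i : Measure E) ≤ K) :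
    ∫⁻ x, f x ∂(ν : Measure E) ≤ K := by
  have hR : ∀ n : ℕ, ∫⁻ x, (min (f x) n : ℝ≥0) ∂(ν : Measure E) ≤ K := by
    intro n
    let F : BoundedContinuousFunction E ℝ≥0 :=
      BoundedContinuousFunction.mkOfBound ⟨fun x => min (f x) n, by fun_prop⟩ n (fun x y => by
        rw [NNReal.dist_eq, abs_le]
        have h1 : ((min (f x) n : ℝ≥0) : ℝ) ≤ n := by exact_mod_cast min_le_right _ _
        have h2 : ((min (f y) n : ℝ≥0) : ℝ) ≤ n := by exact_mod_cast min_le_right _ _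
        have h3 : 0 ≤ ((min (f x) n : ℝ≥0) : ℝ) := NNReal.coe_nonneg _
        have h4 : 0 ≤ ((min (f y) n : ℝ≥0) : ℝ) := NNReal.coe_nonneg _
        constructor <;> simp only [ContinuousMap.coe_mk] <;> linarith)
    have hF := (ProbabilityMeasure.tendsto_iff_forall_lintegral_tendsto.1 hμ) F
    refine le_of_tendsto hF (hK.mono fun i hi => le_trans (lintegral_mono fun x => ?_) hi)
    exact ENNReal.coe_le_coe.2 (min_le_left _ _)
  have hmono : Tendsto (fun n : ℕ => ∫⁻ x, (min (f x) n : ℝ≥0) ∂(ν : Measure E)) atTop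
      (𝓝 (∫⁻ x, f x ∂(ν : Measure E))) := by
    refine lintegral_tendsto_of_tendsto_of_monotone (fun n => by fun_prop) ?_ ?_
    · refine ae_of_all _ fun x n m hnm => ?_
      refine ENNReal.coe_le_coe.2 (min_le_min le_rfl ?_)
      exact_mod_cast hnm
    · refine ae_of_all _ fun x => ?_
      refine tendsto_const_nhds.congr' ?_
      obtain ⟨n, hn⟩ := exists_nat_ge (f x)
      filter_upwards [eventually_ge_atTop n] with m hm
      rw [min_eq_left (hn.trans (by exact_mod_cast hm))]
  exact le_of_tendsto' hmono hR

variable [InnerProductSpace ℝ E] [FiniteDimensional ℝ E]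

lemma lintegral_exp_inner_stdGaussian (u : E) :
    ∫⁻ x, ENNReal.ofReal (Real.exp ⟪u, x⟫) ∂(stdGaussian E) =
      ENNReal.ofReal (Real.exp (‖u‖ ^ 2 / 2)) := by
  have hL : (stdGaussian E).map (innerSL ℝ u) = gaussianReal 0 (‖u‖₊ ^ 2) := by
    rw [IsGaussian.map_eq_gaussianReal]
    congr 1
    · exact integral_strongDual_stdGaussian _
    · rw [variance_dual_stdGaussian]
      simp
      ext
      simp
  have hm : mgf id (gaussianReal 0 (‖u‖₊ ^ 2)) 1 = Real.exp (‖u‖ ^ 2 / 2) := by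
    rw [mgf_id_gaussianReal]; simp
  have hi : Integrable (fun x => Real.exp x) (gaussianReal 0 (‖u‖₊ ^ 2)) := by
    simpa using integrable_exp_mul_gaussianReal (μ := 0) (v := ‖u‖₊ ^ 2) 1
  have : ∫⁻ x, ENNReal.ofReal (Real.exp ⟪u, x⟫) ∂(stdGaussian E) =
      ∫⁻ y, ENNReal.ofReal (Real.exp y) ∂((stdGaussian E).map (innerSL ℝ u)) := by
    rw [lintegral_map (by fun_prop) (by fun_prop)]
    simp
  rw [this, hL, ← ofReal_integral_eq_lintegral_ofReal hi (ae_of_all _ fun x => (Real.exp_pos _).le),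
    ← hm, mgf]
  simp

/-- Sub-level sets of `x ↦ ∑ (e^{x_j} + e^{-x_j})` are bounded, so that this function controls
tightness. -/
lemma isTightMeasureSet_of_lintegral_exp_le {ι : Type*} [Fintype ι] (b : OrthonormalBasis ι ℝ E)
    {S : Set (Measure E)} {C : E → ℝ≥0}
    (h : ∀ μ ∈ S, ∀ j, ∫⁻ x, ENNReal.ofReal (Real.exp ⟪b j, x⟫) ∂μ ≤ C (b j) ∧
      ∫⁻ x, ENNReal.ofReal (Real.exp ⟪-b j, x⟫) ∂μ ≤ C (-b j)) :
    IsTightMeasureSet S := by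
  let g : E → ℝ≥0∞ := fun x => ∑ j, (ENNReal.ofReal (Real.exp ⟪b j, x⟫) +
    ENNReal.ofReal (Real.exp ⟪-b j, x⟫))
  have hgm : Measurable g := by fun_prop
  have hg : ∀ x, ENNReal.ofReal ‖x‖ ≤ g x := by
    intro x
    have h1 : ‖x‖ ≤ ∑ j, |⟪b j, x⟫| := by
      conv_lhs => rw [← b.sum_repr' x]
      refine (norm_sum_le _ _).trans (Finset.sum_le_sum fun j _ => ?_)
      simp [norm_smul]
    have h2 : ∀ j, |⟪b j, x⟫| ≤ Real.exp ⟪b j, x⟫ + Real.exp ⟪-b j, x⟫ := by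
      intro j
      rw [inner_neg_left]
      have e1 := Real.add_one_le_exp ⟪b j, x⟫
      have e2 := Real.add_one_le_exp (-⟪b j, x⟫)
      have p1 := Real.exp_pos ⟪b j, x⟫
      have p2 := Real.exp_pos (-⟪b j, x⟫)
      exact abs_le.2 ⟨by linarith, by linarith⟩
    calc ENNReal.ofReal ‖x‖ ≤ ENNReal.ofReal (∑ j, (Real.exp ⟪b j, x⟫ + Real.exp ⟪-b j, x⟫)) :=
          ENNReal.ofReal_le_ofReal (h1.trans (Finset.sum_le_sum fun j _ => h2 j))
      _ = g x := by
          rw [ENNReal.ofReal_sum_of_nonneg (fun j _ => by positivity)]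
          refine Finset.sum_congr rfl fun j _ => ?_
          rw [ENNReal.ofReal_add (Real.exp_pos _).le (Real.exp_pos _).le]
  let K : ℝ≥0 := ∑ j, (C (b j) + C (-b j))
  have hK : ∀ μ ∈ S, ∫⁻ x, g x ∂μ ≤ K := by
    intro μ hμ
    simp only [g]
    rw [lintegral_finsetSum _ (fun j _ => by fun_prop)]
    push_cast [K]
    refine Finset.sum_le_sum fun j _ => ?_
    rw [lintegral_add_left (by fun_prop)]
    exact add_le_add (h μ hμ j).1 (h μ hμ j).2
  rw [isTightMeasureSet_iff_exists_isCompact_measure_compl_le]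
  intro ε hε
  by_cases hεt : ε = ∞
  · exact ⟨∅, isCompact_empty, fun μ _ => by simp [hεt]⟩
  lift ε to ℝ≥0 using hεt
  have hε' : 0 < ε := by exact_mod_cast hε
  let R : ℝ≥0 := (K + 1) / ε
  have hR : 0 < R := by positivity
  refine ⟨Metric.closedBall 0 R, isCompact_closedBall _ _, fun μ hμ => ?_⟩
  have h1 : (Metric.closedBall (0 : E) R)ᶜ ⊆ {x | (R : ℝ≥0∞) ≤ g x} := by
    intro x hx
    simp only [Set.mem_compl_iff, mem_closedBall_zero_iff, not_le] at hx
    refine le_trans ?_ (hg x)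
    rw [← ENNReal.ofReal_coe_nnreal]
    exact ENNReal.ofReal_le_ofReal hx.le
  refine (measure_mono h1).trans ?_
  refine (meas_ge_le_lintegral_div hgm.aemeasurable (by simpa using hR.ne') (by simp)).trans ?_
  refine (ENNReal.div_le_div_right (hK μ hμ) _).trans ?_
  rw [← ENNReal.coe_div hR.ne', ENNReal.coe_le_coe]
  simp only [R]
  rw [div_div_eq_mul_div, div_le_iff₀ (by positivity), mul_comm]
  gcongr
  exact le_self_add

/-- Convergence of the moment generating function to that of the standard Gaussian implies weak
convergence, along any filter. -/
theorem tendsto_stdGaussian_of_lintegral_exp {ι : Type*} {l : Filter ι}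
    {μ : ι → ProbabilityMeasure E}
    (h : ∀ u : E, Tendsto (fun i => ∫⁻ x, ENNReal.ofReal (Real.exp ⟪u, x⟫) ∂(μ i : Measure E)) l
      (𝓝 (ENNReal.ofReal (Real.exp (‖u‖ ^ 2 / 2))))) :
    Tendsto μ l (𝓝 ⟨stdGaussian E, inferInstance⟩) := by
  -- along an ultrafilter the laws converge by tightness, and the limit is identified by its
  -- moment generating function; a general filter does not allow arguments by subsequences
  rw [tendsto_iff_ultrafilter]
  intro U hU
  have hU' : ∀ u : E, Tendsto (fun i => ∫⁻ x, ENNReal.ofReal (Real.exp ⟪u, x⟫) ∂(μ i : Measure E)) U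
      (𝓝 (ENNReal.ofReal (Real.exp (‖u‖ ^ 2 / 2)))) := fun u => (h u).mono_left hU
  let C : E → ℝ≥0 := fun u => (Real.exp (‖u‖ ^ 2 / 2)).toNNReal + 1
  have hC : ∀ u, ∀ᶠ i in (U : Filter ι),
      ∫⁻ x, ENNReal.ofReal (Real.exp ⟪u, x⟫) ∂(μ i : Measure E) ≤ C u := by
    intro u
    refine ((hU' u).eventually (gt_mem_nhds ?_)).mono fun i hi => le_of_lt hi
    rw [ENNReal.ofReal, ENNReal.coe_lt_coe]
    exact lt_add_one _
  let b := stdOrthonormalBasis ℝ E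
  let S : Set (ProbabilityMeasure E) :=
    {ρ | ∀ j, ∫⁻ x, ENNReal.ofReal (Real.exp ⟪b j, x⟫) ∂(ρ : Measure E) ≤ C (b j) ∧
      ∫⁻ x, ENNReal.ofReal (Real.exp ⟪-b j, x⟫) ∂(ρ : Measure E) ≤ C (-b j)}
  have hS : IsCompact (closure S) := by
    refine isCompact_closure_of_isTightMeasureSet (isTightMeasureSet_of_lintegral_exp_le b (C := C) ?_)
    rintro _ ⟨ρ, hρ, rfl⟩
    exact hρ
  have hUS : S ∈ U.map μ := by
    have : ∀ᶠ i in (U : Filter ι), ∀ j, ∫⁻ x, ENNReal.ofReal (Real.exp ⟪b j, x⟫) ∂(μ i : Measure E) ≤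
        C (b j) ∧ ∫⁻ x, ENNReal.ofReal (Real.exp ⟪-b j, x⟫) ∂(μ i : Measure E) ≤ C (-b j) :=
      eventually_all.2 fun j => (hC _).and (hC _)
    exact this
  obtain ⟨ν, -, hν⟩ := hS.ultrafilter_le_nhds (U.map μ)
    (le_principal_iff.2 (mem_of_superset hUS subset_closure))
  have hν' : Tendsto μ U (𝓝 ν) := hν
  suffices hνγ : ν = ⟨stdGaussian E, inferInstance⟩ by rw [← hνγ]; exact hν'
  have hsq : ∀ u x : E, ENNReal.ofReal (Real.exp ⟪u, x⟫ ^ 2) =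
      ENNReal.ofReal (Real.exp ⟪(2 : ℝ) • u, x⟫) := by
    intro u x
    rw [← Real.exp_nat_mul, inner_smul_left]; simp
  have hνle : ∀ u : E, ∫⁻ x, ENNReal.ofReal (Real.exp ⟪u, x⟫) ∂(ν : Measure E) ≤ C u := fun u =>
    lintegral_le_of_tendsto hν' (f := fun x => (Real.exp ⟪u, x⟫).toNNReal) (by fun_prop) (hC u)
  have hmgf : ∀ u : E, ∫⁻ x, ENNReal.ofReal (Real.exp ⟪u, x⟫) ∂(ν : Measure E) =
      ENNReal.ofReal (Real.exp (‖u‖ ^ 2 / 2)) := by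
    intro u
    have hf : Continuous fun x : E => Real.exp ⟪u, x⟫ := by fun_prop
    have ht := tendsto_integral_of_lintegral_sq_le hν' hf (K := C ((2 : ℝ) • u))
      (by simpa only [hsq] using hC _) (by simpa only [hsq] using hνle _)
    have ht' : Tendsto (fun i => ∫ x, Real.exp ⟪u, x⟫ ∂(μ i : Measure E)) U
        (𝓝 (Real.exp (‖u‖ ^ 2 / 2))) := by
      have := (ENNReal.tendsto_toReal ENNReal.ofReal_ne_top).comp (hU' u)
      rw [ENNReal.toReal_ofReal (Real.exp_pos _).le] at this
      refine this.congr fun i => ?_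
      rw [integral_eq_lintegral_of_nonneg_ae (ae_of_all _ fun x => (Real.exp_pos _).le)
        hf.aestronglyMeasurable]
      rfl
    rw [← tendsto_nhds_unique ht ht', integral_eq_lintegral_of_nonneg_ae
      (ae_of_all _ fun x => (Real.exp_pos _).le) hf.aestronglyMeasurable, ENNReal.ofReal_toReal]
    exact ((hνle u).trans_lt (by simp)).ne
  refine Subtype.ext (measure_ext_of_lintegral_exp (μ := (ν : Measure E)) (ν := stdGaussian E)
    (fun L => ?_) fun L => ?_)
  · obtain ⟨u, rfl⟩ := (InnerProductSpace.toDual ℝ E).surjective L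
    simp only [InnerProductSpace.toDual_apply_apply]
    rw [hmgf]; exact ENNReal.ofReal_ne_top
  · obtain ⟨u, rfl⟩ := (InnerProductSpace.toDual ℝ E).surjective L
    simp only [InnerProductSpace.toDual_apply_apply]
    rw [hmgf]; exact (lintegral_exp_inner_stdGaussian u).symm

/-- Functions whose square is dominated by finitely many exponentials have convergent integrals
when the moment generating functions converge. -/
theorem tendsto_integral_stdGaussian_of_lintegral_exp {ι : Type*} {l : Filter ι}
    {μ : ι → ProbabilityMeasure E}
    (h : ∀ u : E, Tendsto (fun i => ∫⁻ x, ENNReal.ofReal (Real.exp ⟪u, x⟫) ∂(μ i : Measure E)) l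
      (𝓝 (ENNReal.ofReal (Real.exp (‖u‖ ^ 2 / 2)))))
    {f : E → ℝ} (hf : Continuous f) (s : Finset E) (c : ℝ)
    (hfs : ∀ x, f x ^ 2 ≤ c * ∑ u ∈ s, Real.exp ⟪u, x⟫) :
    Tendsto (fun i => ∫ x, f x ∂(μ i : Measure E)) l (𝓝 (∫ x, f x ∂(stdGaussian E))) := by
  have hle : ∀ ρ : Measure E, ∫⁻ x, ENNReal.ofReal (f x ^ 2) ∂ρ ≤
      ENNReal.ofReal c * ∑ u ∈ s, ∫⁻ x, ENNReal.ofReal (Real.exp ⟪u, x⟫) ∂ρ := by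
    intro ρ
    rw [← lintegral_finsetSum _ (fun u _ => by fun_prop), ← lintegral_const_mul _ (by fun_prop)]
    refine lintegral_mono fun x => ?_
    rw [← ENNReal.ofReal_sum_of_nonneg (fun u _ => (Real.exp_pos _).le),
      ← ENNReal.ofReal_mul' (Finset.sum_nonneg fun u _ => (Real.exp_pos _).le)]
    exact ENNReal.ofReal_le_ofReal (hfs x)
  let K : ℝ≥0 := c.toNNReal * ∑ u ∈ s, ((Real.exp (‖u‖ ^ 2 / 2)).toNNReal + 1)
  refine tendsto_integral_of_lintegral_sq_le (ν := ⟨stdGaussian E, inferInstance⟩)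
    (tendsto_stdGaussian_of_lintegral_exp h) hf (K := K) ?_ ?_
  · have : ∀ᶠ i in l, ∀ u ∈ s, ∫⁻ x, ENNReal.ofReal (Real.exp ⟪u, x⟫) ∂(μ i : Measure E) ≤
        ((Real.exp (‖u‖ ^ 2 / 2)).toNNReal + 1 : ℝ≥0) := by
      refine (eventually_all_finset s).2 fun u _ => ?_
      refine ((h u).eventually (gt_mem_nhds ?_)).mono fun i hi => le_of_lt hi
      rw [ENNReal.ofReal, ENNReal.coe_lt_coe]
      exact lt_add_one _
    filter_upwards [this] with i hi
    refine (hle _).trans ?_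
    simp only [K, ENNReal.coe_mul, ENNReal.ofNNReal_finsetSum]
    exact mul_le_mul_right (Finset.sum_le_sum hi) _
  · refine (hle _).trans ?_
    simp only [K, ENNReal.coe_mul, ENNReal.ofNNReal_finsetSum]
    refine mul_le_mul_right (Finset.sum_le_sum fun u _ => ?_) _
    rw [ProbabilityMeasure.coe_mk, lintegral_exp_inner_stdGaussian, ENNReal.ofReal,
      ENNReal.coe_le_coe]
    exact le_self_add

end MGF

/-! ### The bounded Lipschitz distance -/

section BL

variable {E : Type*} [PseudoMetricSpace E] [MeasurableSpace E]

lemma blDist_le {μ ν : Measure E} {c : ℝ} (hc : 0 ≤ c)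
    (h : ∀ f : E → ℝ, LipschitzWith 1 f → (∀ x, |f x| ≤ 1) → |∫ x, f x ∂μ - ∫ x, f x ∂ν| ≤ c) :
    blDist μ ν ≤ c := by
  refine Real.sSup_le ?_ hc
  rintro _ ⟨f, h1, h2, rfl⟩
  exact h f h1 h2

lemma blDist_nonneg (μ ν : Measure E) : 0 ≤ blDist μ ν := by
  refine Real.sSup_nonneg ?_
  rintro _ ⟨f, h1, h2, rfl⟩
  exact abs_nonneg _

variable [BorelSpace E]

/-- Layer-cake comparison of integrals of a Lipschitz function under two laws that are close in the
Lévy–Prokhorov distance. -/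
lemma integral_sub_le_of_levyProkhorovEDist_lt {μ ν : Measure E} [IsProbabilityMeasure μ]
    [IsProbabilityMeasure ν] {ε : ℝ} (hε : 0 < ε)
    (h : levyProkhorovEDist μ ν < ENNReal.ofReal ε) {f : E → ℝ} (hf : LipschitzWith 1 f)
    (hf1 : ∀ x, |f x| ≤ 1) : ∫ x, f x ∂μ - ∫ x, f x ∂ν ≤ 3 * ε := by
  have hfm : Measurable f := hf.continuous.measurable
  have hfi : ∀ ρ : Measure E, [IsProbabilityMeasure ρ] → Integrable f ρ := fun ρ _ =>
    Integrable.mono' (integrable_const (1 : ℝ)) hfm.aestronglyMeasurable (ae_of_all _ hf1)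
  have hf0 : ∀ x, 0 ≤ f x + 1 := fun x => by have := (abs_le.1 (hf1 x)).1; linarith
  have hf2 : ∀ x, f x + 1 ≤ 2 := fun x => by have := (abs_le.1 (hf1 x)).2; linarith
  have key : ∫⁻ x, ENNReal.ofReal (f x + 1) ∂μ ≤
      ∫⁻ x, ENNReal.ofReal (f x + 1 + ε) ∂ν + ENNReal.ofReal (2 * ε) := by
    rw [lintegral_eq_lintegral_meas_le μ (ae_of_all _ hf0) (by fun_prop),
      lintegral_eq_lintegral_meas_le ν (ae_of_all _ fun x => by have := hf0 x; positivity)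
        (by fun_prop)]
    have e1 : ∫⁻ t in Set.Ioi (0 : ℝ), μ {a | t ≤ f a + 1} =
        ∫⁻ t in Set.Ioc (0 : ℝ) 2, μ {a | t ≤ f a + 1} := by
      rw [← Set.Ioc_union_Ioi_eq_Ioi (show (0 : ℝ) ≤ 2 by norm_num),
        lintegral_union measurableSet_Ioi (Set.Ioc_disjoint_Ioi le_rfl)]
      convert add_zero _
      refine (setLIntegral_congr_fun measurableSet_Ioi fun t ht => ?_).trans lintegral_zero
      have : {a | t ≤ f a + 1} = ∅ := by
        ext a
        simpa using (hf2 a).trans_lt ht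
      simp [this]
    rw [e1]
    have e2 : ∀ t : ℝ, μ {a | t ≤ f a + 1} ≤ ν {a | t ≤ f a + 1 + ε} + ENNReal.ofReal ε := by
      intro t
      refine (left_measure_le_of_levyProkhorovEDist_lt h
        (measurableSet_le measurable_const (by fun_prop))).trans ?_
      gcongr
      rw [ENNReal.toReal_ofReal hε.le]
      intro x hx
      obtain ⟨y, hy, hxy⟩ := Metric.mem_thickening_iff.1 hx
      have := hf.dist_le_mul y x
      rw [Real.dist_eq, NNReal.coe_one, one_mul, dist_comm] at this
      have h3 := (abs_le.1 this).2
      simp only [Set.mem_ofPred_eq] at hy ⊢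
      linarith
    refine (lintegral_mono e2).trans ?_
    rw [lintegral_add_right _ measurable_const]
    gcongr
    · exact Set.Ioc_subset_Ioi_self
    · rw [setLIntegral_const, Real.volume_Ioc, ← ENNReal.ofReal_mul hε.le]
      exact ENNReal.ofReal_le_ofReal (by linarith)
  have hi1 := (hfi μ).add (integrable_const (1 : ℝ))
  have hi2 := ((hfi ν).add (integrable_const (1 : ℝ))).add (integrable_const ε)
  have k1 := ofReal_integral_eq_lintegral_ofReal hi1 (ae_of_all _ hf0)
  have k2 := ofReal_integral_eq_lintegral_ofReal hi2
    (ae_of_all _ fun x => add_nonneg (hf0 x) hε.le)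
  simp only [Pi.add_apply] at k1 k2
  rw [← k1, ← k2, ← ENNReal.ofReal_add (integral_nonneg fun x => add_nonneg (hf0 x) hε.le)
    (by positivity), ENNReal.ofReal_le_ofReal_iff
    (add_nonneg (integral_nonneg fun x => add_nonneg (hf0 x) hε.le) (by positivity))] at key
  have k3 : ∫ x, f x + 1 ∂μ = ∫ x, f x ∂μ + 1 := by
    rw [integral_add (hfi μ) (integrable_const _)]; simp
  have k4 : ∫ x, f x + 1 + ε ∂ν = ∫ x, f x ∂ν + (1 + ε) := by
    simp_rw [add_assoc]
    rw [integral_add (hfi ν) (integrable_const _)]; simp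
  rw [k3, k4] at key
  linarith

/-- Weak convergence implies convergence in the bounded Lipschitz distance. -/
theorem tendsto_blDist [TopologicalSpace.SeparableSpace E] {ι : Type*} {l : Filter ι}
    {μ : ι → ProbabilityMeasure E} {ν : ProbabilityMeasure E} (h : Tendsto μ l (𝓝 ν)) :
    Tendsto (fun i => blDist (μ i : Measure E) (ν : Measure E)) l (𝓝 0) := by
  have h1 : Tendsto (fun i => levyProkhorovEDist (μ i : Measure E) (ν : Measure E)) l (𝓝 0) := by
    have := (LevyProkhorov.continuous_ofMeasure_probabilityMeasure (Ω := E)).tendsto ν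
    exact tendsto_iff_edist_tendsto_0.1 (this.comp h)
  rw [Metric.tendsto_nhds]
  intro ε hε
  filter_upwards [h1.eventually (gt_mem_nhds (show 0 < ENNReal.ofReal (ε / 4) by positivity))]
    with i hi
  rw [Real.dist_0_eq_abs, abs_of_nonneg (blDist_nonneg _ _)]
  refine (blDist_le (c := 3 * (ε / 4)) (by positivity) fun f h1 h2 => ?_).trans_lt (by linarith)
  refine abs_sub_le_iff.2 ⟨integral_sub_le_of_levyProkhorovEDist_lt (by positivity) hi h1 h2, ?_⟩
  rw [levyProkhorovEDist_comm] at hi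
  exact integral_sub_le_of_levyProkhorovEDist_lt (by positivity) hi h1 h2

end BL

/-! ### Maximal inequalities and chaining -/

section Chaining

variable {Ω : Type*} [MeasurableSpace Ω] {P : Measure Ω} [IsProbabilityMeasure P]

/-- Maximal inequality for finitely many variables with a Bernstein-type bound on their moment
generating functions. The maximum is dominated by an explicit measurable variable `W`, obtained
from `y ≤ log c + e^y / c`. -/
lemma exists_max_bound {ι : Type*} (s : Finset ι) (hs : s.Nonempty) {ξ : ι → Ω → ℝ}
    (hξ : ∀ i ∈ s, Measurable (ξ i)) {v b : ℝ} (hv : 0 < v) (hb : 0 ≤ b)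
    (hmgf : ∀ i ∈ s, ∀ τ : ℝ, |τ| * b ≤ 1 →
      ∫⁻ ω, ENNReal.ofReal (Real.exp (τ * ξ i ω)) ∂P ≤ ENNReal.ofReal (Real.exp (τ ^ 2 * v ^ 2))) :
    ∃ W : Ω → ℝ≥0∞, Measurable W ∧
      ∫⁻ ω, W ω ∂P ≤ ENNReal.ofReal (4 * v * √(Real.log (2 * s.card)) +
        3 * b * √(Real.log (2 * s.card)) ^ 2) ∧
      ∀ i ∈ s, ∀ ω, ENNReal.ofReal |ξ i ω| ≤ W ω := by
  have hn : (1 : ℝ) ≤ s.card := by exact_mod_cast hs.card_pos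
  set n : ℝ := (s.card : ℝ) with hndef
  set L := Real.log (2 * n) with hL
  have hL2 : 1 / 2 < L := by
    have h1 : Real.log 2 ≤ L := Real.log_le_log (by norm_num) (by linarith)
    have := Real.log_two_gt_d9
    linarith
  have hL0 : 0 < L := by linarith
  have hsL : 0 < √L := Real.sqrt_pos.2 hL0
  have hsq : √L ^ 2 = L := Real.sq_sqrt hL0.le
  -- up to constants the optimal exponent, subject to the constraint `τ * b ≤ 1`
  set τ : ℝ := 1 / (v / √L + b) with hτ
  have hden : 0 < v / √L + b := by positivity
  have hτ0 : 0 < τ := by positivity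
  have hτb : τ * b ≤ 1 := by
    rw [hτ, div_mul_eq_mul_div, one_mul, div_le_one hden]
    have : 0 < v / √L := by positivity
    linarith
  set B := τ ^ 2 * v ^ 2 with hB
  set c := 2 * n * Real.exp B with hc
  have hc0 : 0 < c := by positivity
  have hlogc : Real.log c = L + B := by
    rw [hc, Real.log_mul (by positivity) (Real.exp_pos _).ne', Real.log_exp]
  have hpt : ∀ y : ℝ, y ≤ Real.log c + Real.exp y / c := by
    intro y
    have := Real.add_one_le_exp (y - Real.log c)
    rw [Real.exp_sub, Real.exp_log hc0] at this
    linarith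
  let W : Ω → ℝ≥0∞ := fun ω => ENNReal.ofReal (Real.log c / τ) +
    ENNReal.ofReal (1 / (c * τ)) * ∑ i ∈ s, (ENNReal.ofReal (Real.exp (τ * ξ i ω)) +
      ENNReal.ofReal (Real.exp (-τ * ξ i ω)))
  have hm : ∀ i ∈ s, ∀ σ : ℝ, Measurable fun ω => ENNReal.ofReal (Real.exp (σ * ξ i ω)) :=
    fun i hi σ => by have := hξ i hi; fun_prop
  have hmp : ∀ i ∈ s, Measurable fun ω => ENNReal.ofReal (Real.exp (τ * ξ i ω)) +
      ENNReal.ofReal (Real.exp (-τ * ξ i ω)) := fun i hi => (hm i hi τ).add (hm i hi (-τ))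
  have hms : Measurable fun ω => ∑ i ∈ s, (ENNReal.ofReal (Real.exp (τ * ξ i ω)) +
      ENNReal.ofReal (Real.exp (-τ * ξ i ω))) := Finset.measurable_fun_sum s hmp
  refine ⟨W, measurable_const.add (hms.const_mul _), ?_, ?_⟩
  · have h1 : ∫⁻ ω, W ω ∂P ≤ ENNReal.ofReal (Real.log c / τ) +
        ENNReal.ofReal (1 / (c * τ)) * ∑ i ∈ s, (ENNReal.ofReal (Real.exp B) +
          ENNReal.ofReal (Real.exp B)) := by
      simp only [W]
      rw [lintegral_add_left measurable_const, lintegral_const, measure_univ, mul_one,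
        lintegral_const_mul _ hms, lintegral_finsetSum' _ fun i hi => (hmp i hi).aemeasurable]
      gcongr with i hi
      rw [lintegral_add_left (hm i hi τ)]
      refine add_le_add ((hmgf i hi τ ?_).trans_eq rfl) ((hmgf i hi (-τ) ?_).trans_eq ?_)
      · rw [abs_of_pos hτ0]; exact hτb
      · rw [abs_neg, abs_of_pos hτ0]; exact hτb
      · rw [neg_sq]
    refine h1.trans ?_
    rw [Finset.sum_const, nsmul_eq_mul, ← ENNReal.ofReal_add (Real.exp_pos _).le (Real.exp_pos _).le,
      ← ENNReal.ofReal_natCast, ← ENNReal.ofReal_mul (by positivity),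
      ← ENNReal.ofReal_mul (by positivity), ← ENNReal.ofReal_add
        (div_nonneg (by rw [hlogc]; positivity) hτ0.le) (by positivity)]
    refine ENNReal.ofReal_le_ofReal ?_
    have e1 : 1 / (c * τ) * (n * (Real.exp B + Real.exp B)) = 1 / τ := by
      rw [hc]; field_simp; ring
    rw [← hndef, e1, hlogc, hsq]
    have e2 : (L + B) / τ + 1 / τ = (L + 1) * (1 / τ) + τ * v ^ 2 := by
      rw [hB]; field_simp; ring
    have e3 : 1 / τ = v / √L + b := by rw [hτ, one_div_one_div]
    have e4 : τ * v ^ 2 ≤ v * √L := by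
      rw [hτ, div_mul_eq_mul_div, one_mul, div_le_iff₀ hden]
      have : v * √L * (v / √L + b) = v ^ 2 + v * √L * b := by field_simp
      rw [this]
      have : 0 ≤ v * √L * b := by positivity
      linarith
    have e5 : (L + 1) * (v / √L + b) ≤ 3 * L * (v / √L + b) :=
      mul_le_mul_of_nonneg_right (by linarith) hden.le
    have e6 : 3 * L * (v / √L + b) = 3 * v * √L + 3 * b * L := by
      have : L / √L = √L := by rw [div_eq_iff hsL.ne', ← sq, hsq]
      calc 3 * L * (v / √L + b) = 3 * v * (L / √L) + 3 * b * L := by ring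
        _ = _ := by rw [this]
    rw [e2, e3]
    linarith
  · intro i hi ω
    have hle : |ξ i ω| ≤ Real.log c / τ + 1 / (c * τ) *
        (Real.exp (τ * ξ i ω) + Real.exp (-τ * ξ i ω)) := by
      have h1 : τ * |ξ i ω| ≤ Real.log c + (Real.exp (τ * ξ i ω) + Real.exp (-τ * ξ i ω)) / c := by
        rcases abs_cases (ξ i ω) with ⟨h, -⟩ | ⟨h, -⟩
        · rw [h]
          refine (hpt _).trans ?_
          gcongr
          linarith [Real.exp_pos (-τ * ξ i ω)]
        · rw [h, mul_neg, ← neg_mul]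
          refine (hpt _).trans ?_
          gcongr
          linarith [Real.exp_pos (τ * ξ i ω)]
      rw [← le_div_iff₀' hτ0] at h1
      refine h1.trans_eq ?_
      field_simp
    calc ENNReal.ofReal |ξ i ω| ≤ ENNReal.ofReal (Real.log c / τ + 1 / (c * τ) *
        (Real.exp (τ * ξ i ω) + Real.exp (-τ * ξ i ω))) := ENNReal.ofReal_le_ofReal hle
      _ ≤ ENNReal.ofReal (Real.log c / τ) + ENNReal.ofReal (1 / (c * τ)) *
          (ENNReal.ofReal (Real.exp (τ * ξ i ω)) + ENNReal.ofReal (Real.exp (-τ * ξ i ω))) := by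
          refine ENNReal.ofReal_add_le.trans ?_
          rw [ENNReal.ofReal_mul (by positivity), ENNReal.ofReal_add (Real.exp_pos _).le
            (Real.exp_pos _).le]
      _ ≤ W ω := by
          simp only [W]
          gcongr
          exact Finset.single_le_sum (f := fun i => ENNReal.ofReal (Real.exp (τ * ξ i ω)) +
            ENNReal.ofReal (Real.exp (-τ * ξ i ω))) (fun i _ => zero_le) hi

lemma sqrtLogTwo_mono : Monotone sqrtLogTwo := by
  intro m n hmn
  induction n using ENat.recTopCoe with
  | top => exact le_top
  | coe n =>
    induction m using ENat.recTopCoe with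
    | top => simp at hmn
    | coe m =>
      have hmn' : m ≤ n := by exact_mod_cast hmn
      refine ENNReal.ofReal_le_ofReal (Real.sqrt_le_sqrt ?_)
      rcases Nat.eq_zero_or_pos m with rfl | hm
      · simp only [Nat.cast_zero, mul_zero, Real.log_zero]
        rcases Nat.eq_zero_or_pos n with rfl | hn
        · simp
        · refine Real.log_nonneg ?_
          have : (1 : ℝ) ≤ n := by exact_mod_cast hn
          linarith
      · exact Real.log_le_log (by positivity) (by gcongr)

/-- Comparison of the entropy integral with its dyadic sums. -/
lemma tsum_dyadic_le_lintegral {ℓ : ℝ → ℝ≥0∞} (hℓ : AntitoneOn ℓ (Set.Ioi 0)) {t : ℝ} (ht : 0 < t) :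
    ∑' j : ℕ, ENNReal.ofReal (t / 2 ^ j / 2) * ℓ (t / 2 ^ j) ≤ ∫⁻ ε in Set.Ioc 0 t, ℓ ε := by
  have hanti : Antitone fun j : ℕ => t / 2 ^ j := by
    intro i j hij
    exact div_le_div_of_nonneg_left ht.le (by positivity) (pow_le_pow_right₀ (by norm_num) hij)
  have hstep : ∀ j : ℕ, ENNReal.ofReal (t / 2 ^ j / 2) * ℓ (t / 2 ^ j) ≤
      ∫⁻ ε in Set.Ioc (t / 2 ^ (j + 1)) (t / 2 ^ j), ℓ ε := by
    intro j
    have h1 : volume (Set.Ioc (t / 2 ^ (j + 1)) (t / 2 ^ j)) = ENNReal.ofReal (t / 2 ^ j / 2) := by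
      rw [Real.volume_Ioc]; congr 1; rw [pow_succ]; field_simp; ring
    rw [← h1, mul_comm, ← setLIntegral_const]
    refine setLIntegral_mono' measurableSet_Ioc fun ε hε => ?_
    have hpos : 0 < t / 2 ^ (j + 1) := by positivity
    exact hℓ (hpos.trans hε.1) (Set.mem_Ioi.2 (by positivity)) hε.2
  have hdisj : Pairwise (Function.onFun Disjoint fun j : ℕ => Set.Ioc (t / 2 ^ (j + 1)) (t / 2 ^ j)) :=
    hanti.pairwise_disjoint_on_Ioc_succ
  calc _ ≤ ∑' j : ℕ, ∫⁻ ε in Set.Ioc (t / 2 ^ (j + 1)) (t / 2 ^ j), ℓ ε := ENNReal.tsum_le_tsum hstep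
    _ = ∫⁻ ε in ⋃ j : ℕ, Set.Ioc (t / 2 ^ (j + 1)) (t / 2 ^ j), ℓ ε :=
        (lintegral_iUnion (fun _ => measurableSet_Ioc) hdisj _).symm
    _ ≤ _ := by
        refine lintegral_mono_set (Set.iUnion_subset fun j ε hε => ⟨?_, ?_⟩)
        · exact lt_trans (by positivity) hε.1
        · refine hε.2.trans ?_
          simpa using hanti (Nat.zero_le j)

/-- Chaining. The increments of the process are sub-Gaussian for a multiple of the metric, and a
single variable satisfies a Bernstein bound. Instead of a supremum over the possibly uncountable
index set, the lemma provides a variable `W` that dominates each `|ξ θ|` almost surely. -/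
theorem exists_chaining_bound {T : Type*} [PseudoMetricSpace T] {S : Set T} (hS : S.Nonempty)
    {ξ : T → Ω → ℝ} (hξ : ∀ θ ∈ S, Measurable (ξ θ)) {K v b t I : ℝ} (hK : 0 < K) (hv : 0 < v)
    (hb : 0 ≤ b) (ht : 0 < t)
    (hinc : ∀ θ ∈ S, ∀ θ' ∈ S, ∀ δ : ℝ, 0 < δ → dist θ θ' ≤ δ → ∀ τ : ℝ,
      ∫⁻ ω, ENNReal.ofReal (Real.exp (τ * (ξ θ ω - ξ θ' ω))) ∂P ≤
        ENNReal.ofReal (Real.exp (τ ^ 2 * (K * δ) ^ 2)))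
    (hmgf : ∀ θ ∈ S, ∀ τ : ℝ, |τ| * b ≤ 1 →
      ∫⁻ ω, ENNReal.ofReal (Real.exp (τ * ξ θ ω)) ∂P ≤ ENNReal.ofReal (Real.exp (τ ^ 2 * v ^ 2)))
    {Λ : Ω → ℝ} (hLip : ∀ θ ∈ S, ∀ θ' ∈ S, ∀ᵐ ω ∂P, |ξ θ ω - ξ θ' ω| ≤ Λ ω * dist θ θ')
    (hI : ∫⁻ ε in Set.Ioc 0 t, sqrtLogTwo (Metric.externalCoveringNumber ε.toNNReal S) ≤
      ENNReal.ofReal I) :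
    ∃ W : Ω → ℝ≥0∞, Measurable W ∧
      ∫⁻ ω, W ω ∂P ≤ ENNReal.ofReal (32 * (K * I + v * (I / t) + b * (I / t) ^ 2)) ∧
      ∀ θ ∈ S, ∀ᵐ ω ∂P, ENNReal.ofReal |ξ θ ω| ≤ W ω := by
  classical
  set ℓ : ℝ → ℝ≥0∞ := fun ε => sqrtLogTwo (Metric.externalCoveringNumber ε.toNNReal S) with hℓdef
  have hℓanti : AntitoneOn ℓ (Set.Ioi 0) := fun x _ y _ hxy =>
    sqrtLogTwo_mono (Metric.externalCoveringNumber_anti (Real.toNNReal_le_toNNReal hxy))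
  set r : ℕ → ℝ := fun j => t / 2 ^ j with hr
  have hr0 : ∀ j, 0 < r j := fun j => by positivity
  have hrs : ∀ j, r j = 2 * r (j + 1) := fun j => by simp only [hr, pow_succ]; field_simp
  have hsum : ∑' j, ENNReal.ofReal (r j / 2) * ℓ (r j) ≤ ENNReal.ofReal I :=
    (tsum_dyadic_le_lintegral hℓanti ht).trans hI
  have hfin : ∀ j, ℓ (r j) ≠ ∞ := by
    intro j hj
    have h1 : ENNReal.ofReal (r j / 2) * ℓ (r j) ≤ ENNReal.ofReal I :=
      (ENNReal.le_tsum j).trans hsum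
    rw [hj, ENNReal.mul_top (by have := hr0 j; simpa using this)] at h1
    simp at h1
  -- an external net of radius `r j` yields a net of points of `S` of radius `2 * r j` that is
  -- not larger
  have hnet : ∀ j, ∃ A : Finset T, A.Nonempty ∧ (∀ u ∈ A, u ∈ S) ∧
      (∀ θ ∈ S, ∃ u ∈ A, dist θ u ≤ 2 * r j) ∧
      ENNReal.ofReal (√(Real.log (2 * A.card))) ≤ ℓ (r j) := by
    intro j
    have hext : Metric.externalCoveringNumber (r j).toNNReal S ≠ ⊤ := by
      intro h; exact hfin j (by simp only [hℓdef]; rw [h]; rfl)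
    have hle := Metric.coveringNumber_two_mul_le_externalCoveringNumber (r j).toNNReal S
    obtain ⟨A, hAS, hAfin, hcov, hcard⟩ := Metric.exists_set_encard_eq_coveringNumber
      (ne_top_of_le_ne_top hext hle)
    obtain ⟨A, rfl⟩ := hAfin.exists_finset_coe
    have hc : ∀ θ ∈ S, ∃ u ∈ A, dist θ u ≤ 2 * r j := by
      intro θ hθ
      obtain ⟨u, hu, hd⟩ := hcov hθ
      refine ⟨u, hu, ?_⟩
      have : edist θ u ≤ ((2 * (r j).toNNReal : ℝ≥0) : ℝ≥0∞) := hd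
      rw [edist_nndist, ENNReal.coe_le_coe] at this
      have h2 : dist θ u ≤ ((2 * (r j).toNNReal : ℝ≥0) : ℝ) := by exact_mod_cast this
      simpa [Real.coe_toNNReal _ (hr0 j).le] using h2
    refine ⟨A, ?_, fun u hu => hAS hu, hc, ?_⟩
    · obtain ⟨θ, hθ⟩ := hS
      obtain ⟨u, hu, -⟩ := hc θ hθ
      exact ⟨u, hu⟩
    · rw [← hcard, Set.encard_coe_eq_coe_finsetCard] at hle
      exact sqrtLogTwo_mono hle
  choose A hAne hAS hAcov hAcard using hnet
  have hπ : ∀ j, ∀ θ, ∃ u, θ ∈ S → u ∈ A j ∧ dist θ u ≤ 2 * r j := by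
    intro j θ
    by_cases h : θ ∈ S
    · obtain ⟨u, hu, hd⟩ := hAcov j θ h
      exact ⟨u, fun _ => ⟨hu, hd⟩⟩
    · exact ⟨θ, fun h' => absurd h' h⟩
  choose π hπ using hπ
  obtain ⟨W₀, hW₀m, hW₀i, hW₀⟩ := exists_max_bound (P := P) (A 0) (hAne 0)
    (fun u hu => hξ u (hAS 0 u hu)) hv hb (fun u hu => hmgf u (hAS 0 u hu))
  -- the links of the chain: the increments from the net at level `j + 1` to the net at level `j`
  -- are at most `2 * r j` long, so that they are bounded by a dyadic term of the entropy integral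
  have hlink : ∀ j, ∃ W : Ω → ℝ≥0∞, Measurable W ∧
      ∫⁻ ω, W ω ∂P ≤ ENNReal.ofReal (32 * K) * (ENNReal.ofReal (r (j + 1) / 2) * ℓ (r (j + 1))) ∧
      ∀ u ∈ A (j + 1), ∀ ω, ENNReal.ofReal |ξ u ω - ξ (π j u) ω| ≤ W ω := by
    intro j
    obtain ⟨W, h1, h2, h3⟩ := exists_max_bound (P := P) (A (j + 1)) (hAne _)
      (ξ := fun u ω => ξ u ω - ξ (π j u) ω) (v := K * (2 * r j)) (b := 0)
      (fun u hu => (hξ u (hAS _ u hu)).sub (hξ _ (hAS j _ (hπ j u (hAS _ u hu)).1)))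
      (by have := hr0 j; positivity) le_rfl
      (fun u hu τ _ => hinc u (hAS _ u hu) _ (hAS j _ (hπ j u (hAS _ u hu)).1) _
        (by have := hr0 j; positivity) (hπ j u (hAS _ u hu)).2 τ)
    refine ⟨W, h1, h2.trans ?_, h3⟩
    have e : 4 * (K * (2 * r j)) * √(Real.log (2 * (A (j + 1)).card)) +
        3 * 0 * √(Real.log (2 * (A (j + 1)).card)) ^ 2 =
        32 * K * (r (j + 1) / 2 * √(Real.log (2 * (A (j + 1)).card))) := by
      rw [hrs j]; ring
    have h0 := hr0 (j + 1)
    rw [e, ENNReal.ofReal_mul (by positivity), ENNReal.ofReal_mul (by positivity : 0 ≤ r (j + 1) / 2)]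
    gcongr
    exact hAcard (j + 1)
  choose W' hW'm hW'i hW' using hlink
  have hW₀I : ∫⁻ ω, W₀ ω ∂P ≤ ENNReal.ofReal (32 * (v * (I / t) + b * (I / t) ^ 2)) := by
    have h1 : ENNReal.ofReal (t / 2) * ℓ t ≤ ENNReal.ofReal I := by
      have := (ENNReal.le_tsum (f := fun j => ENNReal.ofReal (r j / 2) * ℓ (r j)) 0).trans hsum
      simpa [hr] using this
    have h2 : ENNReal.ofReal (t / 2 * √(Real.log (2 * (A 0).card))) ≤ ENNReal.ofReal I := by
      rw [ENNReal.ofReal_mul (by positivity)]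
      refine le_trans ?_ h1
      gcongr
      simpa [hr] using hAcard 0
    set y := √(Real.log (2 * (A 0).card))
    have hn : (1 : ℝ) ≤ (A 0).card := by exact_mod_cast (hAne 0).card_pos
    have hy : 0 < y := Real.sqrt_pos.2 (Real.log_pos (by linarith))
    have hI0 : 0 < I := by
      by_contra h
      rw [ENNReal.ofReal_of_nonpos (not_lt.1 h)] at h2
      have : 0 < t / 2 * y := by positivity
      simp only [nonpos_iff_eq_zero, ENNReal.ofReal_eq_zero] at h2
      linarith
    rw [ENNReal.ofReal_le_ofReal_iff hI0.le] at h2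
    have h3 : y ≤ 2 * (I / t) := by
      rw [mul_div_assoc', le_div_iff₀ ht]; linarith
    have h4 : y ^ 2 ≤ (2 * (I / t)) ^ 2 := by gcongr
    refine hW₀i.trans (ENNReal.ofReal_le_ofReal ?_)
    have h5 : 4 * v * y ≤ 4 * v * (2 * (I / t)) := by gcongr
    have h6 : 3 * b * y ^ 2 ≤ 3 * b * (2 * (I / t)) ^ 2 := by gcongr
    have h7 : 0 ≤ v * (I / t) := by positivity
    have h8 : 0 ≤ b * (I / t) ^ 2 := by positivity
    nlinarith
  have hI0 : 0 ≤ I := by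
    by_contra h
    rw [ENNReal.ofReal_of_nonpos (not_le.1 h).le] at hsum
    have h1 := (ENNReal.le_tsum (f := fun j => ENNReal.ofReal (r j / 2) * ℓ (r j)) 0).trans hsum
    have hn : (1 : ℝ) ≤ (A 0).card := by exact_mod_cast (hAne 0).card_pos
    have hy : 0 < √(Real.log (2 * (A 0).card)) := Real.sqrt_pos.2 (Real.log_pos (by linarith))
    have h2 : 0 < ℓ (r 0) := lt_of_lt_of_le (by simpa using hy) (hAcard 0)
    have h3 : 0 < ENNReal.ofReal (r 0 / 2) := by have := hr0 0; simpa using this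
    exact absurd h1 (not_le.2 (ENNReal.mul_pos h3.ne' h2.ne'))
  refine ⟨fun ω => W₀ ω + ∑' j, W' j ω, hW₀m.add (Measurable.tsum hW'm), ?_, ?_⟩
  · rw [lintegral_add_left hW₀m, lintegral_tsum fun j => (hW'm j).aemeasurable]
    have h1 : ∑' j, ∫⁻ ω, W' j ω ∂P ≤ ENNReal.ofReal (32 * K) * ENNReal.ofReal I := by
      refine (ENNReal.tsum_le_tsum hW'i).trans ?_
      rw [ENNReal.tsum_mul_left]
      gcongr
      refine le_trans ?_ hsum
      exact ENNReal.tsum_comp_le_tsum_of_injective (add_left_injective 1)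
        (fun j => ENNReal.ofReal (r j / 2) * ℓ (r j))
    refine (add_le_add hW₀I h1).trans ?_
    rw [← ENNReal.ofReal_mul (by positivity), ← ENNReal.ofReal_add (by positivity) (by positivity)]
    exact ENNReal.ofReal_le_ofReal (le_of_eq (by ring))
  · have hchain : ∀ J, ∀ u ∈ A J, ∀ ω,
        ENNReal.ofReal |ξ u ω| ≤ W₀ ω + ∑ j ∈ Finset.range J, W' j ω := by
      intro J
      induction J with
      | zero => intro u hu ω; simpa using hW₀ u hu ω
      | succ J ih =>
        intro u hu ω
        have h1 := ih _ (hπ J u (hAS _ u hu)).1 ω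
        have h2 := hW' J u hu ω
        have h3 : |ξ u ω| ≤ |ξ (π J u) ω| + |ξ u ω - ξ (π J u) ω| := by
          have := abs_add_le (ξ (π J u) ω) (ξ u ω - ξ (π J u) ω)
          simpa using this
        rw [Finset.sum_range_succ, ← add_assoc]
        refine (ENNReal.ofReal_le_ofReal h3).trans ?_
        rw [ENNReal.ofReal_add (abs_nonneg _) (abs_nonneg _)]
        exact add_le_add h1 h2
    intro θ hθ
    have hall : ∀ᵐ ω ∂P, ∀ J, |ξ θ ω - ξ (π J θ) ω| ≤ Λ ω * dist θ (π J θ) :=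
      ae_all_iff.2 fun J => hLip θ hθ _ (hAS J _ (hπ J θ hθ).1)
    filter_upwards [hall] with ω hω
    -- the Lipschitz constant may be random and large: it multiplies a distance that tends to zero
    have hlim : Tendsto (fun J => W₀ ω + ∑' j, W' j ω + ENNReal.ofReal (|Λ ω| * (2 * r J))) atTop
        (𝓝 (W₀ ω + ∑' j, W' j ω + 0)) := by
      refine Tendsto.add tendsto_const_nhds ?_
      have h1 : Tendsto r atTop (𝓝 0) := by
        have := (tendsto_pow_atTop_nhds_zero_of_lt_one (r := (1 / 2 : ℝ)) (by norm_num)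
          (by norm_num)).const_mul t
        simpa [hr, div_eq_mul_inv] using this
      have h2 : Tendsto (fun J => |Λ ω| * (2 * r J)) atTop (𝓝 0) := by
        simpa using (h1.const_mul 2).const_mul |Λ ω|
      simpa using ENNReal.tendsto_ofReal h2
    rw [add_zero] at hlim
    refine ge_of_tendsto' hlim fun J => ?_
    have h3 : |ξ θ ω| ≤ |ξ (π J θ) ω| + |Λ ω| * (2 * r J) := by
      have h4 := abs_add_le (ξ (π J θ) ω) (ξ θ ω - ξ (π J θ) ω)
      have h5 : Λ ω * dist θ (π J θ) ≤ |Λ ω| * (2 * r J) :=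
        mul_le_mul (le_abs_self _) (hπ J θ hθ).2 dist_nonneg (abs_nonneg _)
      have h6 := hω J
      simp only [add_sub_cancel] at h4
      linarith
    have hrJ := hr0 J
    refine (ENNReal.ofReal_le_ofReal h3).trans ?_
    rw [ENNReal.ofReal_add (abs_nonneg _) (by positivity)]
    gcongr
    refine (hchain J _ (hπ J θ hθ).1 ω).trans ?_
    gcongr
    exact ENNReal.sum_le_tsum _

end Chaining

/-! ### The law of the observations -/

lemma isProbabilityMeasure_uniformMeasure {d : ℕ} {S : Set (EuclideanSpace ℝ (Fin d))}
    (hS : MeasurableSet S) (h0 : 0 < volume S) (hfin : volume S < ∞) :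
    IsProbabilityMeasure (uniformMeasure S) := by
  refine ⟨?_⟩
  rw [uniformMeasure, Measure.smul_apply, comap_subtype_coe_apply hS, Set.image_univ,
    Subtype.range_coe, smul_eq_mul, ENNReal.inv_mul_cancel h0.ne' hfin.ne]

namespace Model

variable {d k : ℕ} {H V : Type*}
  [NormedAddCommGroup H] [InnerProductSpace ℝ H] [CompleteSpace H]
  [MeasurableSpace H] [BorelSpace H]
  [NormedAddCommGroup V] [InnerProductSpace ℝ V] [FiniteDimensional ℝ V]
  [MeasurableSpace V] [BorelSpace V]
  (M : Model d k H V)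

instance : IsProbabilityMeasure M.lam :=
  isProbabilityMeasure_uniformMeasure M.measurableSet_domain M.volume_pos M.volume_lt_top

lemma measurable_G_apply (θ : M.Θ) : Measurable (M.G θ) :=
  M.measurable_G.comp measurable_prodMk_left

lemma measurable_obsMap :
    Measurable fun p : M.𝒳 × V => (p.1, M.G M.θ₀ p.1 + p.2) :=
  measurable_fst.prodMk (((M.measurable_G_apply M.θ₀).comp measurable_fst).add measurable_snd)

instance : IsProbabilityMeasure M.obsLaw :=
  Measure.isProbabilityMeasure_map M.measurable_obsMap.aemeasurable

instance : IsProbabilityMeasure M.P := by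
  unfold P; infer_instance

/-- The noise variables `ε_i = Y_i - G_{θ₀}(X_i)`. -/
def noise (ω : ℕ → M.𝒳 × V) (i : ℕ) : V := (ω i).2 - M.G M.θ₀ (ω i).1

lemma measurable_noise (i : ℕ) : Measurable fun ω => M.noise ω i :=
  (measurable_snd.comp (measurable_pi_apply i)).sub
    ((M.measurable_G_apply M.θ₀).comp (measurable_fst.comp (measurable_pi_apply i)))

lemma measurable_design (i : ℕ) : Measurable fun ω : ℕ → M.𝒳 × V => (ω i).1 :=
  measurable_fst.comp (measurable_pi_apply i)

lemma lintegral_obsLaw {F : M.𝒳 × V → ℝ≥0∞} (hF : Measurable F) :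
    ∫⁻ z, F (z.1, z.2 - M.G M.θ₀ z.1) ∂M.obsLaw =
      ∫⁻ x, ∫⁻ e, F (x, e) ∂(stdGaussian V) ∂M.lam := by
  have hm : Measurable fun z : M.𝒳 × V => (z.1, z.2 - M.G M.θ₀ z.1) :=
    measurable_fst.prodMk (measurable_snd.sub ((M.measurable_G_apply M.θ₀).comp measurable_fst))
  have h := lintegral_map (μ := M.lam.prod (stdGaussian V)) (hF.comp hm) M.measurable_obsMap
  simp only [Function.comp_def] at h
  rw [obsLaw, h]
  simp only [add_sub_cancel_left]
  exact lintegral_prod _ hF.aemeasurable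

lemma measurePreserving_design (i : ℕ) :
    MeasurePreserving (fun ω : ℕ → M.𝒳 × V => (ω i).1) M.P M.lam := by
  refine ⟨M.measurable_design i, ?_⟩
  have h1 : M.P.map (fun ω => ω i) = M.obsLaw :=
    (measurePreserving_eval_infinitePi (fun _ : ℕ => M.obsLaw) i).map_eq
  have h2 : M.obsLaw.map Prod.fst = M.lam := by
    rw [obsLaw, Measure.map_map measurable_fst M.measurable_obsMap]
    have : (Prod.fst ∘ fun p : M.𝒳 × V => (p.1, M.G M.θ₀ p.1 + p.2)) = Prod.fst := rfl
    rw [this, Measure.map_fst_prod]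
    simp
  rw [← h2, ← h1, Measure.map_map measurable_fst (measurable_pi_apply i)]
  rfl

/-- Almost sure statements about a design point hold for the whole sample. -/
lemma ae_design {p : M.𝒳 → Prop} (h : ∀ᵐ x ∂M.lam, p x) : ∀ᵐ ω ∂M.P, ∀ i, p (ω i).1 :=
  ae_all_iff.2 fun i => (M.measurePreserving_design i).quasiMeasurePreserving.ae h

/-- Integrals of products over the sample factorize. -/
lemma lintegral_prod_P {f : M.𝒳 × V → ℝ≥0∞} (hf : Measurable f) (N : ℕ) :
    ∫⁻ ω, ∏ i ∈ Finset.range N, f (ω i) ∂M.P = (∫⁻ z, f z ∂M.obsLaw) ^ N := by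
  have hmp : ∀ i, ∫⁻ ω : ℕ → M.𝒳 × V, f (ω i) ∂M.P = ∫⁻ z, f z ∂M.obsLaw := fun i =>
    (measurePreserving_eval_infinitePi (fun _ : ℕ => M.obsLaw) i).lintegral_comp hf
  have hind : iIndepFun (fun i (ω : ℕ → M.𝒳 × V) => f (ω i)) M.P :=
    iIndepFun_infinitePi (P := fun _ : ℕ => M.obsLaw) (X := fun _ => f) fun _ => hf
  rw [lintegral_prod_eq_prod_lintegral_of_indepFun _ _ hind
    (fun i => hf.comp (measurable_pi_apply i))]
  simp [hmp]

lemma lintegral_exp_sum_P {q : M.𝒳 × V → ℝ} (hq : Measurable q) (N : ℕ) :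
    ∫⁻ ω, ENNReal.ofReal (Real.exp (∑ i ∈ Finset.range N, q (ω i))) ∂M.P =
      (∫⁻ z, ENNReal.ofReal (Real.exp (q z)) ∂M.obsLaw) ^ N := by
  rw [← M.lintegral_prod_P (by fun_prop)]
  refine lintegral_congr fun ω => ?_
  rw [Real.exp_sum, ENNReal.ofReal_prod_of_nonneg fun i _ => (Real.exp_pos _).le]

/-- The second moment of a sum of i.i.d. centered variables. -/
lemma lintegral_sq_sum_P {q : M.𝒳 × V → ℝ} (hq : MemLp q 2 M.obsLaw) (h0 : ∫ z, q z ∂M.obsLaw = 0)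
    (N : ℕ) :
    ∫⁻ ω, ENNReal.ofReal ((∑ i ∈ Finset.range N, q (ω i)) ^ 2) ∂M.P =
      N * ∫⁻ z, ENNReal.ofReal (q z ^ 2) ∂M.obsLaw := by
  have hmp : ∀ i, MeasurePreserving (fun ω : ℕ → M.𝒳 × V => ω i) M.P M.obsLaw := fun i =>
    measurePreserving_eval_infinitePi (fun _ : ℕ => M.obsLaw) i
  have hL : ∀ i, MemLp (fun ω : ℕ → M.𝒳 × V => q (ω i)) 2 M.P := fun i =>
    hq.comp_measurePreserving (hmp i)
  have hmean : ∀ i, ∫ ω : ℕ → M.𝒳 × V, q (ω i) ∂M.P = 0 := by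
    intro i
    have h1 : AEStronglyMeasurable q (M.P.map fun ω => ω i) := by
      rw [(hmp i).map_eq]; exact hq.1
    rw [← h0, ← (hmp i).map_eq, integral_map (measurable_pi_apply i).aemeasurable h1]
  have hind : iIndepFun (fun i (ω : ℕ → M.𝒳 × V) => hq.1.aemeasurable.mk q (ω i)) M.P :=
    iIndepFun_infinitePi (P := fun _ : ℕ => M.obsLaw) (X := fun _ => hq.1.aemeasurable.mk q)
      (fun _ => hq.1.aemeasurable.measurable_mk)
  have hmk : ∀ i, (fun ω : ℕ → M.𝒳 × V => q (ω i)) =ᵐ[M.P]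
      fun ω => hq.1.aemeasurable.mk q (ω i) := fun i =>
    (hmp i).quasiMeasurePreserving.ae_eq_comp hq.1.aemeasurable.ae_eq_mk
  have hpair : ∀ i j, i ≠ j → IndepFun (fun ω : ℕ → M.𝒳 × V => q (ω i)) (fun ω => q (ω j)) M.P :=
    fun i j hij => (hind.indepFun hij).congr (hmk i).symm (hmk j).symm
  have hsumL : MemLp (fun ω : ℕ → M.𝒳 × V => ∑ i ∈ Finset.range N, q (ω i)) 2 M.P :=
    memLp_finsetSum _ fun i _ => hL i
  have hvar : Var[∑ i ∈ Finset.range N, fun ω : ℕ → M.𝒳 × V => q (ω i); M.P] =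
      ∑ i ∈ Finset.range N, Var[fun ω : ℕ → M.𝒳 × V => q (ω i); M.P] :=
    IndepFun.variance_sum (fun i _ => hL i) fun i _ j _ hij => hpair i j hij
  have hsm : ∑ i ∈ Finset.range N, (fun ω : ℕ → M.𝒳 × V => q (ω i)) =
      fun ω => ∑ i ∈ Finset.range N, q (ω i) := by ext; simp
  have hv1 : ∀ i, Var[fun ω : ℕ → M.𝒳 × V => q (ω i); M.P] = ∫ z, q z ^ 2 ∂M.obsLaw := by
    intro i
    rw [variance_of_integral_eq_zero (hL i).1.aemeasurable (hmean i)]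
    have h1 : AEStronglyMeasurable (fun z => q z ^ 2) (M.P.map fun ω => ω i) := by
      rw [(hmp i).map_eq]; exact hq.1.pow 2
    rw [← (hmp i).map_eq, integral_map (measurable_pi_apply i).aemeasurable h1]
  rw [hsm, variance_of_integral_eq_zero hsumL.1.aemeasurable] at hvar
  · rw [← ofReal_integral_eq_lintegral_ofReal hsumL.integrable_sq (ae_of_all _ fun _ => sq_nonneg _),
      hvar, Finset.sum_congr rfl fun i _ => hv1 i, Finset.sum_const, Finset.card_range, nsmul_eq_mul,
      ENNReal.ofReal_mul (by positivity), ENNReal.ofReal_natCast,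
      ofReal_integral_eq_lintegral_ofReal hq.integrable_sq (ae_of_all _ fun _ => sq_nonneg _)]
  · rw [integral_finsetSum _ fun i _ => (hL i).integrable (by norm_num)]
    simp [hmean]

/-- Integrating out the noise. -/
lemma lintegral_exp_noise {f : M.𝒳 → V} (hf : Measurable f) {g : M.𝒳 → ℝ} (hg : Measurable g) :
    ∫⁻ z, ENNReal.ofReal (Real.exp (⟪f z.1, z.2 - M.G M.θ₀ z.1⟫ + g z.1)) ∂M.obsLaw =
      ∫⁻ x, ENNReal.ofReal (Real.exp (‖f x‖ ^ 2 / 2 + g x)) ∂M.lam := by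
  have := M.lintegral_obsLaw (F := fun p => ENNReal.ofReal (Real.exp (⟪f p.1, p.2⟫ + g p.1)))
    (by fun_prop)
  rw [this]
  refine lintegral_congr fun x => ?_
  simp only [Real.exp_add, ENNReal.ofReal_mul (Real.exp_pos _).le]
  rw [lintegral_mul_const _ (by fun_prop), lintegral_exp_inner_stdGaussian]

/-- The likelihood ratio has expectation one. -/
lemma lintegral_likelihood_ratio (N : ℕ) (θ : M.Θ) :
    ∫⁻ ω, ENNReal.ofReal (Real.exp (M.logLik N ω θ - M.logLik N ω M.θ₀)) ∂M.P = 1 := by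
  have h1 : ∀ ω, M.logLik N ω θ - M.logLik N ω M.θ₀ = ∑ i ∈ Finset.range N,
      (⟪M.G θ (ω i).1 - M.G M.θ₀ (ω i).1, (ω i).2 - M.G M.θ₀ (ω i).1⟫ +
        -‖M.G θ (ω i).1 - M.G M.θ₀ (ω i).1‖ ^ 2 / 2) := by
    intro ω
    rw [logLik, logLik, ← mul_sub, ← Finset.sum_sub_distrib, Finset.mul_sum]
    refine Finset.sum_congr rfl fun i _ => ?_
    have : (ω i).2 - M.G θ (ω i).1 = ((ω i).2 - M.G M.θ₀ (ω i).1) -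
      (M.G θ (ω i).1 - M.G M.θ₀ (ω i).1) := by abel
    rw [this, norm_sub_sq_real, real_inner_comm]
    ring
  have hm := (M.measurable_G_apply θ).sub (M.measurable_G_apply M.θ₀)
  have h0 := M.measurable_G_apply M.θ₀
  simp_rw [h1]
  rw [M.lintegral_exp_sum_P (q := fun z => ⟪M.G θ z.1 - M.G M.θ₀ z.1, z.2 - M.G M.θ₀ z.1⟫ +
        -‖M.G θ z.1 - M.G M.θ₀ z.1‖ ^ 2 / 2)]
  · rw [M.lintegral_exp_noise (f := fun x => M.G θ x - M.G M.θ₀ x)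
      (g := fun x => -‖M.G θ x - M.G M.θ₀ x‖ ^ 2 / 2) hm ((hm.norm.pow_const 2).neg.div_const 2)]
    have : ∀ x, ‖M.G θ x - M.G M.θ₀ x‖ ^ 2 / 2 + -‖M.G θ x - M.G M.θ₀ x‖ ^ 2 / 2 = 0 := by
      intro x; ring
    simp [this]
  · have hm' : Measurable fun z : M.𝒳 × V => M.G θ z.1 - M.G M.θ₀ z.1 := hm.comp measurable_fst
    have h0' : Measurable fun z : M.𝒳 × V => M.G M.θ₀ z.1 := h0.comp measurable_fst
    fun_prop

end Model

/-! ### Moment generating functions of empirical processes -/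

/-- Hoeffding's lemma. -/
lemma lintegral_exp_centered_le {Ω : Type*} [MeasurableSpace Ω] {μ : Measure Ω}
    [IsProbabilityMeasure μ] {X : Ω → ℝ} (hX : Measurable X) {B : ℝ} (hB : 0 ≤ B)
    (hXB : ∀ᵐ ω ∂μ, |X ω| ≤ B) (τ : ℝ) :
    ∫⁻ ω, ENNReal.ofReal (Real.exp (τ * (X ω - ∫ ω', X ω' ∂μ))) ∂μ ≤
      ENNReal.ofReal (Real.exp (τ ^ 2 * B ^ 2 / 2)) := by
  have h := hasSubgaussianMGF_of_mem_Icc (a := -B) (b := B) hX.aemeasurable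
    (hXB.mono fun ω h => abs_le.1 h)
  rw [← ofReal_integral_eq_lintegral_ofReal (h.integrable_exp_mul τ)
    (ae_of_all _ fun _ => (Real.exp_pos _).le)]
  refine ENNReal.ofReal_le_ofReal ((h.mgf_le τ).trans_eq ?_)
  congr 1
  have : ‖B - -B‖ = 2 * B := by rw [Real.norm_eq_abs, abs_of_nonneg (by linarith)]; ring
  simp only [NNReal.coe_pow, NNReal.coe_div, coe_nnnorm, this]
  push_cast
  ring

/-- Second-order expansion of the exponential moment of a variable bounded by one. -/
lemma lintegral_exp_le_of_abs_le_one {Ω : Type*} [MeasurableSpace Ω] {μ : Measure Ω}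
    [IsProbabilityMeasure μ] {u : Ω → ℝ} (hu : Measurable u) (hu1 : ∀ᵐ ω ∂μ, |u ω| ≤ 1) :
    ∫⁻ ω, ENNReal.ofReal (Real.exp (u ω)) ∂μ ≤
      ENNReal.ofReal (Real.exp (∫ ω, u ω ∂μ + ∫ ω, u ω ^ 2 ∂μ)) := by
  have hi1 : Integrable u μ := Integrable.mono' (integrable_const 1) hu.aestronglyMeasurable hu1
  have hi2 : Integrable (fun ω => u ω ^ 2) μ := by
    refine Integrable.mono' (integrable_const 1) (hu.pow_const 2).aestronglyMeasurable ?_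
    filter_upwards [hu1] with ω hω
    rw [Real.norm_eq_abs, abs_pow]
    exact pow_le_one₀ (abs_nonneg _) hω
  have hi3 : Integrable (fun ω => 1 + u ω + u ω ^ 2) μ := ((integrable_const 1).add hi1).add hi2
  calc ∫⁻ ω, ENNReal.ofReal (Real.exp (u ω)) ∂μ
      ≤ ∫⁻ ω, ENNReal.ofReal (1 + u ω + u ω ^ 2) ∂μ := by
        refine lintegral_mono_ae ?_
        filter_upwards [hu1] with ω hω
        have := (abs_le.1 (Real.abs_exp_sub_one_sub_id_le hω)).2
        exact ENNReal.ofReal_le_ofReal (by linarith)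
    _ = ENNReal.ofReal (∫ ω, (1 + u ω + u ω ^ 2) ∂μ) := by
        refine (ofReal_integral_eq_lintegral_ofReal hi3 (ae_of_all _ fun ω => ?_)).symm
        simp only [Pi.zero_apply]
        nlinarith [sq_nonneg (u ω + 1), sq_nonneg (u ω)]
    _ ≤ _ := by
        refine ENNReal.ofReal_le_ofReal ?_
        have hi4 : Integrable (fun ω => 1 + u ω) μ := (integrable_const 1).add hi1
        rw [integral_add hi4 hi2, integral_add (integrable_const 1) hi1]
        simp only [integral_const, probReal_univ, smul_eq_mul, mul_one]
        have := Real.add_one_le_exp (∫ ω, u ω ∂μ + ∫ ω, u ω ^ 2 ∂μ)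
        linarith

lemma abs_inner_le_of_norm_le {V : Type*} [NormedAddCommGroup V] [InnerProductSpace ℝ V]
    {v w : V} {B : ℝ} (hv : ‖v‖ ≤ B) (hw : ‖w‖ ≤ 1) :
    |⟪v, w⟫| ≤ B :=
  (abs_real_inner_le_norm v w).trans <| (mul_le_mul hv hw (norm_nonneg _)
    ((norm_nonneg _).trans hv)).trans_eq (mul_one B)

namespace Model

variable {d k : ℕ} {H V : Type*}
  [NormedAddCommGroup H] [InnerProductSpace ℝ H] [CompleteSpace H]
  [MeasurableSpace H] [BorelSpace H]
  [NormedAddCommGroup V] [InnerProductSpace ℝ V] [FiniteDimensional ℝ V]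
  [MeasurableSpace V] [BorelSpace V]
  (M : Model d k H V)

/-- The centered multiplier process `f ↦ ∑ ⟨f(X_i), ε_i - ζ(X_i)⟩`, where the bounded function `ζ`
accounts for the bias of a reference point. -/
def mulProc (N : ℕ) (ζ f : M.𝒳 → V) (ω : ℕ → M.𝒳 × V) : ℝ :=
  ∑ i ∈ Finset.range N, (⟪f (ω i).1, M.noise ω i - ζ (ω i).1⟫ + ∫ x, ⟪f x, ζ x⟫ ∂M.lam)

/-- The centered empirical process `φ ↦ ∑ (φ(X_i) - E φ(X_i))`. -/
def empProc (N : ℕ) (φ : M.𝒳 → ℝ) (ω : ℕ → M.𝒳 × V) : ℝ :=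
  ∑ i ∈ Finset.range N, (φ (ω i).1 - ∫ x, φ x ∂M.lam)

lemma measurable_mulProc (N : ℕ) {ζ f : M.𝒳 → V} (hζ : Measurable ζ) (hf : Measurable f) :
    Measurable (M.mulProc N ζ f) := by
  refine Finset.measurable_fun_sum _ fun i _ => Measurable.add ?_ measurable_const
  exact (hf.comp (M.measurable_design i)).inner
    ((M.measurable_noise i).sub (hζ.comp (M.measurable_design i)))

lemma measurable_empProc (N : ℕ) {φ : M.𝒳 → ℝ} (hφ : Measurable φ) :
    Measurable (M.empProc N φ) :=
  Finset.measurable_fun_sum _ fun i _ => (hφ.comp (M.measurable_design i)).sub measurable_const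

lemma ofReal_exp_pow (x : ℝ) (N : ℕ) :
    ENNReal.ofReal (Real.exp x) ^ N = ENNReal.ofReal (Real.exp (N * x)) := by
  rw [← ENNReal.ofReal_pow (Real.exp_pos _).le, ← Real.exp_nat_mul]

lemma lintegral_exp_empProc_le (N : ℕ) {φ : M.𝒳 → ℝ} (hφ : Measurable φ) {B : ℝ} (hB : 0 ≤ B)
    (hφB : ∀ᵐ x ∂M.lam, |φ x| ≤ B) (τ : ℝ) :
    ∫⁻ ω, ENNReal.ofReal (Real.exp (τ * M.empProc N φ ω)) ∂M.P ≤
      ENNReal.ofReal (Real.exp (τ ^ 2 * (√N * B) ^ 2)) := by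
  have h1 : ∀ ω, τ * M.empProc N φ ω = ∑ i ∈ Finset.range N,
      (⟪(0 : V), (ω i).2 - M.G M.θ₀ (ω i).1⟫ + τ * (φ (ω i).1 - ∫ x, φ x ∂M.lam)) := by
    intro ω
    simp only [empProc, Finset.mul_sum, inner_zero_left, zero_add]
  simp_rw [h1]
  have hG : Measurable fun z : M.𝒳 × V => M.G M.θ₀ z.1 :=
    (M.measurable_G_apply M.θ₀).comp measurable_fst
  have hφ' : Measurable fun z : M.𝒳 × V => φ z.1 := hφ.comp measurable_fst
  rw [M.lintegral_exp_sum_P (q := fun z => ⟪(0 : V), z.2 - M.G M.θ₀ z.1⟫ +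
    τ * (φ z.1 - ∫ x, φ x ∂M.lam)) (by fun_prop),
    M.lintegral_exp_noise (f := fun _ => 0) (g := fun x => τ * (φ x - ∫ x, φ x ∂M.lam))
      measurable_const (by fun_prop)]
  simp only [norm_zero, ne_eq, OfNat.ofNat_ne_zero, not_false_eq_true, zero_pow, zero_div, zero_add]
  refine (pow_le_pow_left₀ zero_le (lintegral_exp_centered_le hφ hB hφB τ) N).trans ?_
  rw [ofReal_exp_pow]
  refine ENNReal.ofReal_le_ofReal (Real.exp_le_exp.2 ?_)
  rw [mul_pow, Real.sq_sqrt (Nat.cast_nonneg N)]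
  have : 0 ≤ N * τ ^ 2 * B ^ 2 := by positivity
  nlinarith

/-- Given the design, the exponent is linear in the Gaussian noise, which is integrated out. -/
lemma lintegral_exp_mulProc (N : ℕ) {ζ f : M.𝒳 → V} (hζ : Measurable ζ) (hf : Measurable f)
    (τ : ℝ) :
    ∫⁻ ω, ENNReal.ofReal (Real.exp (τ * M.mulProc N ζ f ω)) ∂M.P =
      (∫⁻ x, ENNReal.ofReal (Real.exp (τ ^ 2 * ‖f x‖ ^ 2 / 2 +
        -τ * (⟪f x, ζ x⟫ - ∫ x, ⟪f x, ζ x⟫ ∂M.lam))) ∂M.lam) ^ N := by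
  have h1 : ∀ ω, τ * M.mulProc N ζ f ω = ∑ i ∈ Finset.range N,
      (⟪τ • f (ω i).1, (ω i).2 - M.G M.θ₀ (ω i).1⟫ +
        -τ * (⟪f (ω i).1, ζ (ω i).1⟫ - ∫ x, ⟪f x, ζ x⟫ ∂M.lam)) := by
    intro ω
    simp only [mulProc, Finset.mul_sum, noise]
    refine Finset.sum_congr rfl fun i _ => ?_
    rw [inner_sub_right, real_inner_smul_left]
    ring
  simp_rw [h1]
  have hG : Measurable fun z : M.𝒳 × V => M.G M.θ₀ z.1 :=
    (M.measurable_G_apply M.θ₀).comp measurable_fst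
  have hf' : Measurable fun z : M.𝒳 × V => f z.1 := hf.comp measurable_fst
  have hζ' : Measurable fun z : M.𝒳 × V => ζ z.1 := hζ.comp measurable_fst
  rw [M.lintegral_exp_sum_P (q := fun z => ⟪τ • f z.1, z.2 - M.G M.θ₀ z.1⟫ +
        -τ * (⟪f z.1, ζ z.1⟫ - ∫ x, ⟪f x, ζ x⟫ ∂M.lam)) (by fun_prop),
    M.lintegral_exp_noise (f := fun x => τ • f x)
      (g := fun x => -τ * (⟪f x, ζ x⟫ - ∫ x, ⟪f x, ζ x⟫ ∂M.lam)) (by fun_prop) (by fun_prop)]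
  simp only [norm_smul, mul_pow, Real.norm_eq_abs, sq_abs]

/-- Sub-Gaussian bound for the multiplier process in terms of the supremum norm. -/
lemma lintegral_exp_mulProc_le (N : ℕ) {ζ f : M.𝒳 → V} (hζ : Measurable ζ) (hf : Measurable f)
    (hζ1 : ∀ᵐ x ∂M.lam, ‖ζ x‖ ≤ 1) {B : ℝ} (hB : 0 ≤ B) (hfB : ∀ᵐ x ∂M.lam, ‖f x‖ ≤ B) (τ : ℝ) :
    ∫⁻ ω, ENNReal.ofReal (Real.exp (τ * M.mulProc N ζ f ω)) ∂M.P ≤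
      ENNReal.ofReal (Real.exp (τ ^ 2 * (√N * B) ^ 2)) := by
  rw [M.lintegral_exp_mulProc N hζ hf]
  have h1 : ∫⁻ x, ENNReal.ofReal (Real.exp (τ ^ 2 * ‖f x‖ ^ 2 / 2 +
        -τ * (⟪f x, ζ x⟫ - ∫ x, ⟪f x, ζ x⟫ ∂M.lam))) ∂M.lam ≤
      ENNReal.ofReal (Real.exp (τ ^ 2 * B ^ 2)) := by
    calc _ ≤ ∫⁻ x, ENNReal.ofReal (Real.exp (τ ^ 2 * B ^ 2 / 2)) * ENNReal.ofReal (Real.exp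
          (-τ * (⟪f x, ζ x⟫ - ∫ x, ⟪f x, ζ x⟫ ∂M.lam))) ∂M.lam := by
          refine lintegral_mono_ae ?_
          filter_upwards [hfB] with x hx
          rw [← ENNReal.ofReal_mul (Real.exp_pos _).le, ← Real.exp_add]
          gcongr
      _ ≤ ENNReal.ofReal (Real.exp (τ ^ 2 * B ^ 2 / 2)) *
          ENNReal.ofReal (Real.exp ((-τ) ^ 2 * B ^ 2 / 2)) := by
          rw [lintegral_const_mul _ (by fun_prop)]
          gcongr
          refine lintegral_exp_centered_le (by fun_prop) hB ?_ (-τ)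
          filter_upwards [hfB, hζ1] with x h1 h2 using abs_inner_le_of_norm_le h1 h2
      _ = _ := by
          rw [← ENNReal.ofReal_mul (Real.exp_pos _).le, ← Real.exp_add]
          congr 2
          ring
  refine (pow_le_pow_left₀ zero_le h1 N).trans_eq ?_
  rw [ofReal_exp_pow, mul_pow, Real.sq_sqrt (Nat.cast_nonneg N)]
  congr 2
  ring

/-- Bernstein bound for the multiplier process, with variance proxy given by the `L²` norm. -/
lemma lintegral_exp_mulProc_le_of_sq (N : ℕ) {ζ f : M.𝒳 → V} (hζ : Measurable ζ)
    (hf : Measurable f) (hζ1 : ∀ᵐ x ∂M.lam, ‖ζ x‖ ≤ 1) {B σ : ℝ}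
    (hfB : ∀ᵐ x ∂M.lam, ‖f x‖ ≤ B) (hfσ : ∫ x, ‖f x‖ ^ 2 ∂M.lam ≤ σ ^ 2) {τ : ℝ}
    (hτ : |τ| * (4 * B) ≤ 1) :
    ∫⁻ ω, ENNReal.ofReal (Real.exp (τ * M.mulProc N ζ f ω)) ∂M.P ≤
      ENNReal.ofReal (Real.exp (τ ^ 2 * (2 * √N * σ) ^ 2)) := by
  rw [M.lintegral_exp_mulProc N hζ hf]
  set φ : M.𝒳 → ℝ := fun x => ⟪f x, ζ x⟫ with hφ
  have hφm : Measurable φ := by fun_prop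
  have hφB : ∀ᵐ x ∂M.lam, |φ x| ≤ B := by
    filter_upwards [hfB, hζ1] with x h1 h2 using abs_inner_le_of_norm_le h1 h2
  have hφi : Integrable φ M.lam :=
    Integrable.mono' (integrable_const B) hφm.aestronglyMeasurable hφB
  have hfi : Integrable (fun x => ‖f x‖ ^ 2) M.lam := by
    refine Integrable.mono' (integrable_const (B ^ 2)) (by fun_prop) ?_
    filter_upwards [hfB] with x hx
    rw [Real.norm_eq_abs, abs_pow, abs_norm]
    gcongr
  have hφ2i : Integrable (fun x => φ x ^ 2) M.lam := by
    refine Integrable.mono' hfi (by fun_prop) ?_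
    filter_upwards [hζ1] with x hx
    rw [Real.norm_eq_abs, abs_pow]
    gcongr
    exact abs_inner_le_of_norm_le le_rfl hx
  have hφ2 : ∫ x, φ x ^ 2 ∂M.lam ≤ σ ^ 2 := by
    refine (integral_mono_ae hφ2i hfi ?_).trans hfσ
    filter_upwards [hζ1] with x hx
    have := abs_inner_le_of_norm_le (le_refl ‖f x‖) hx
    rw [← sq_abs]
    gcongr
  set m := ∫ x, φ x ∂M.lam with hm
  have hmB : |m| ≤ B := by
    refine (abs_integral_le_integral_abs).trans ?_
    refine (integral_mono_ae hφi.abs (integrable_const B) hφB).trans ?_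
    simp
  have hvar : ∫ x, (φ x - m) ^ 2 ∂M.lam ≤ σ ^ 2 := by
    have h1 : ∫ x, (φ x - m) ^ 2 ∂M.lam = ∫ x, φ x ^ 2 ∂M.lam - m ^ 2 := by
      have h2 : ∀ x, (φ x - m) ^ 2 = φ x ^ 2 - (2 * m * φ x - m ^ 2) := fun x => by ring
      simp_rw [h2]
      have hi4 : Integrable (fun x => 2 * m * φ x - m ^ 2) M.lam :=
        (hφi.const_mul _).sub (integrable_const _)
      rw [integral_sub hφ2i hi4,
        integral_sub (hφi.const_mul _) (integrable_const _), integral_const_mul, ← hm]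
      simp
      ring
    rw [h1]
    nlinarith [sq_nonneg m]
  set u : M.𝒳 → ℝ := fun x => τ ^ 2 * ‖f x‖ ^ 2 / 2 + -τ * (φ x - m) with hu
  have hu1 : ∀ᵐ x ∂M.lam, |u x| ≤ 1 := by
    filter_upwards [hfB, hφB] with x h1 h2
    have h3 : |φ x - m| ≤ 2 * B := (abs_sub _ _).trans (by linarith)
    have h4 : |τ| * |φ x - m| ≤ 1 / 2 := by
      have := mul_le_mul_of_nonneg_left h3 (abs_nonneg τ)
      linarith
    have h5 : τ ^ 2 * ‖f x‖ ^ 2 ≤ 1 / 16 := by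
      have h6 : |τ| * ‖f x‖ ≤ 1 / 4 := by
        have := mul_le_mul_of_nonneg_left h1 (abs_nonneg τ)
        linarith
      rw [← sq_abs, ← mul_pow]
      calc _ ≤ (1 / 4 : ℝ) ^ 2 := by gcongr
        _ = _ := by norm_num
    calc |u x| ≤ |τ ^ 2 * ‖f x‖ ^ 2 / 2| + |-τ * (φ x - m)| := abs_add_le _ _
      _ ≤ 1 / 32 + 1 / 2 := by
          rw [abs_of_nonneg (by positivity), abs_mul, abs_neg]
          linarith
      _ ≤ 1 := by norm_num
  have hui : ∫ x, u x ∂M.lam = τ ^ 2 / 2 * ∫ x, ‖f x‖ ^ 2 ∂M.lam := by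
    simp only [hu]
    have hi4 : Integrable (fun x => -τ * (φ x - m)) M.lam :=
      (hφi.sub (integrable_const _)).const_mul _
    rw [integral_add ((hfi.const_mul _).div_const _) hi4,
      integral_const_mul, integral_sub hφi (integrable_const _), ← hm, integral_div,
      integral_const_mul]
    simp
    ring
  have hui2 : ∫ x, u x ^ 2 ∂M.lam ≤ 3 * τ ^ 2 * σ ^ 2 := by
    have hdi : Integrable (fun x => (φ x - m) ^ 2) M.lam := by
      refine Integrable.mono' (integrable_const ((2 * B) ^ 2)) (by fun_prop) ?_
      filter_upwards [hφB] with x h2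
      have h3 : |φ x - m| ≤ 2 * B := (abs_sub _ _).trans (by linarith)
      rw [Real.norm_eq_abs, abs_pow]
      gcongr
    have hb : ∀ᵐ x ∂M.lam, u x ^ 2 ≤ τ ^ 2 * ‖f x‖ ^ 2 + 2 * τ ^ 2 * (φ x - m) ^ 2 := by
      filter_upwards [hfB] with x h1
      have h5 : τ ^ 2 * ‖f x‖ ^ 2 ≤ 1 / 16 := by
        have h6 : |τ| * ‖f x‖ ≤ 1 / 4 := by
          have := mul_le_mul_of_nonneg_left h1 (abs_nonneg τ)
          linarith
        rw [← sq_abs, ← mul_pow]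
        calc _ ≤ (1 / 4 : ℝ) ^ 2 := by gcongr
          _ = _ := by norm_num
      have h7 : 0 ≤ τ ^ 2 * ‖f x‖ ^ 2 := by positivity
      simp only [hu]
      nlinarith [sq_nonneg (τ ^ 2 * ‖f x‖ ^ 2 / 2 - -τ * (φ x - m)), mul_nonneg h7 (sub_nonneg.2 h5)]
    have hi3 : Integrable (fun x => τ ^ 2 * ‖f x‖ ^ 2 + 2 * τ ^ 2 * (φ x - m) ^ 2) M.lam :=
      (hfi.const_mul _).add (hdi.const_mul _)
    have hui2' : Integrable (fun x => u x ^ 2) M.lam := by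
      refine Integrable.mono' hi3 (by fun_prop) (hb.mono fun x hx => ?_)
      rwa [Real.norm_eq_abs, abs_of_nonneg (sq_nonneg _)]
    refine (integral_mono_ae hui2' hi3 hb).trans ?_
    rw [integral_add (hfi.const_mul _) (hdi.const_mul _), integral_const_mul, integral_const_mul]
    nlinarith [mul_le_mul_of_nonneg_left hfσ (sq_nonneg τ),
      mul_le_mul_of_nonneg_left hvar (sq_nonneg τ)]
  have h1 := lintegral_exp_le_of_abs_le_one (μ := M.lam) (u := u) (by fun_prop) hu1
  refine (pow_le_pow_left₀ zero_le h1 N).trans ?_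
  rw [ofReal_exp_pow]
  refine ENNReal.ofReal_le_ofReal (Real.exp_le_exp.2 ?_)
  rw [mul_pow, mul_pow, Real.sq_sqrt (Nat.cast_nonneg N), hui]
  have h8 : τ ^ 2 / 2 * ∫ x, ‖f x‖ ^ 2 ∂M.lam ≤ τ ^ 2 / 2 * σ ^ 2 := by gcongr
  have h9 : τ ^ 2 / 2 * ∫ x, ‖f x‖ ^ 2 ∂M.lam + ∫ x, u x ^ 2 ∂M.lam ≤ 4 * (τ ^ 2 * σ ^ 2) := by
    nlinarith [mul_nonneg (sq_nonneg τ) (sq_nonneg σ)]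
  calc (N : ℝ) * _ ≤ N * (4 * (τ ^ 2 * σ ^ 2)) := by gcongr
    _ = _ := by ring

lemma mulProc_sub (N : ℕ) {ζ f f' : M.𝒳 → V} (hf : Integrable (fun x => ⟪f x, ζ x⟫) M.lam)
    (hf' : Integrable (fun x => ⟪f' x, ζ x⟫) M.lam) (ω : ℕ → M.𝒳 × V) :
    M.mulProc N ζ f ω - M.mulProc N ζ f' ω = M.mulProc N ζ (fun x => f x - f' x) ω := by
  simp only [mulProc, inner_sub_left]
  rw [integral_sub hf hf', ← Finset.sum_sub_distrib]
  exact Finset.sum_congr rfl fun i _ => by ring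

lemma empProc_sub (N : ℕ) {φ φ' : M.𝒳 → ℝ} (hφ : Integrable φ M.lam)
    (hφ' : Integrable φ' M.lam) (ω : ℕ → M.𝒳 × V) :
    M.empProc N φ ω - M.empProc N φ' ω = M.empProc N (fun x => φ x - φ' x) ω := by
  simp only [empProc]
  rw [integral_sub hφ hφ', ← Finset.sum_sub_distrib]
  exact Finset.sum_congr rfl fun i _ => by ring

lemma ae_abs_mulProc_le (N : ℕ) {ζ f : M.𝒳 → V}
    (hζ1 : ∀ᵐ x ∂M.lam, ‖ζ x‖ ≤ 1) {B : ℝ} (hB : 0 ≤ B) (hfB : ∀ᵐ x ∂M.lam, ‖f x‖ ≤ B) :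
    ∀ᵐ ω ∂M.P, |M.mulProc N ζ f ω| ≤ (∑ i ∈ Finset.range N, (‖M.noise ω i‖ + 2)) * B := by
  have hm : |∫ x, ⟪f x, ζ x⟫ ∂M.lam| ≤ B := by
    have := norm_integral_le_of_norm_le_const (μ := M.lam) (f := fun x => ⟪f x, ζ x⟫) (C := B) (by
      filter_upwards [hfB, hζ1] with x h1 h2 using abs_inner_le_of_norm_le h1 h2)
    simpa using this
  filter_upwards [M.ae_design hfB, M.ae_design hζ1] with ω h1 h2
  rw [mulProc, Finset.sum_mul]
  refine (Finset.abs_sum_le_sum_abs _ _).trans (Finset.sum_le_sum fun i _ => ?_)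
  refine (abs_add_le _ _).trans ?_
  have h3 : |⟪f (ω i).1, M.noise ω i - ζ (ω i).1⟫| ≤ B * (‖M.noise ω i‖ + 1) := by
    refine (abs_real_inner_le_norm _ _).trans ?_
    refine mul_le_mul (h1 i) ((norm_sub_le _ _).trans (by linarith [h2 i])) (norm_nonneg _) hB
  linarith

lemma ae_abs_empProc_le (N : ℕ) {φ : M.𝒳 → ℝ} {B : ℝ} (hφB : ∀ᵐ x ∂M.lam, |φ x| ≤ B) :
    ∀ᵐ ω ∂M.P, |M.empProc N φ ω| ≤ (2 * N) * B := by
  have hm : |∫ x, φ x ∂M.lam| ≤ B := by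
    have := norm_integral_le_of_norm_le_const (μ := M.lam) (f := φ) (C := B) hφB
    simpa using this
  filter_upwards [M.ae_design hφB] with ω h1
  rw [empProc]
  refine (Finset.abs_sum_le_sum_abs _ _).trans ?_
  refine (Finset.sum_le_sum fun i _ => (abs_sub _ _).trans (add_le_add (h1 i) hm)).trans_eq ?_
  simp
  ring

variable {d k : ℕ} {H V : Type*}
  [NormedAddCommGroup H] [InnerProductSpace ℝ H] [CompleteSpace H]
  [MeasurableSpace H] [BorelSpace H]
  [NormedAddCommGroup V] [InnerProductSpace ℝ V] [FiniteDimensional ℝ V]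
  [MeasurableSpace V] [BorelSpace V]
  (M : Model d k H V)

/-! ### The information matrix and the least favorable directions -/

lemma inner_proj (D : ℕ) (x : H) (u : M.E D) : ⟪((M.proj D x : M.E D) : H), (u : H)⟫ = ⟪x, u⟫ := by
  rw [← Submodule.coe_inner]
  exact Submodule.inner_orthogonalProjectionOnto_eq_of_mem_right u x

lemma norm_proj_le (D : ℕ) (x : H) : ‖M.proj D x‖ ≤ ‖x‖ :=
  Submodule.norm_orthogonalProjectionOnto_apply_le _ x

lemma E_mono {D D' : ℕ} (h : D ≤ D') : M.E D ≤ M.E D' := by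
  refine Submodule.span_mono ?_
  rintro _ ⟨i, rfl⟩
  exact ⟨Fin.castLE h i, rfl⟩

lemma tendsto_proj (x : H) : Tendsto (fun D => ((M.proj D x : M.E D) : H)) atTop (𝓝 x) := by
  refine Submodule.starProjection_tendsto_self (fun D => M.E D) (fun _ _ h => M.E_mono h) x ?_
  rw [← M.e.dense_span]
  refine Submodule.topologicalClosure_mono (Submodule.span_le.2 ?_)
  rintro _ ⟨i, rfl⟩
  exact Submodule.mem_iSup_of_mem (i + 1) (Submodule.subset_span ⟨⟨i, Nat.lt_succ_self i⟩, rfl⟩)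

/-- The first `D` basis vectors as an orthonormal basis of `E_D`. -/
def basisOE (D : ℕ) : OrthonormalBasis (Fin D) ℝ (M.E D) :=
  OrthonormalBasis.mk (v := M.basisE D)
    (by
      have h := M.e.orthonormal.comp (fun i : Fin D => (i : ℕ)) Fin.val_injective
      rw [orthonormal_iff_ite] at h ⊢
      exact h)
    (by
      rintro x -
      have hx : (x : H) ∈ Submodule.span ℝ (Set.range fun i : Fin D => M.e i) := x.2
      have h2 : Submodule.map (M.E D).subtype (Submodule.span ℝ (Set.range (M.basisE D))) =
          Submodule.span ℝ (Set.range fun i : Fin D => M.e i) := by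
        rw [Submodule.map_span, ← Set.range_comp]
        rfl
      rw [← h2] at hx
      obtain ⟨y, hy, hyx⟩ := hx
      rwa [← Subtype.ext hyx])

lemma basisOE_apply (D : ℕ) (i : Fin D) : (M.basisOE D i : H) = M.e i := by
  rw [basisOE, OrthonormalBasis.coe_mk]; rfl

lemma basisOE_eq (D : ℕ) (i : Fin D) : M.basisOE D i = M.basisE D i := by
  rw [basisOE, OrthonormalBasis.coe_mk]

variable (A : H →L[ℝ] Lp V 2 M.lam)

/-- `⟨ℐ_D u, w⟩ = ⟨A u, A w⟩`. -/
lemma inner_infoD (D : ℕ) (u w : M.E D) :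
    ⟪(M.infoD A D u : H), (w : H)⟫ = ⟪A (u : H), A (w : H)⟫ := by
  have : M.infoD A D u = M.proj D (M.info A (u : H)) := rfl
  rw [this, inner_proj]
  exact ContinuousLinearMap.adjoint_inner_left A _ _

/-- The linear combination `∑ y_j ψ̄_D^j`. -/
def dir (D : ℕ) (y : EuclideanSpace ℝ (Fin k)) : M.E D := ∑ j, y j • M.psiBar A D j

variable {A}

lemma infoD_psiBar {D : ℕ} (hinv : (M.infoD A D).IsInvertible) (j : Fin k) :
    M.infoD A D (M.psiBar A D j) = M.proj D (M.ψ j) :=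
  hinv.self_apply_inverse _

lemma infoD_dir {D : ℕ} (hinv : (M.infoD A D).IsInvertible) (y : EuclideanSpace ℝ (Fin k)) :
    M.infoD A D (M.dir A D y) = M.proj D (∑ j, y j • M.ψ j) := by
  simp only [dir, map_sum, map_smul, M.infoD_psiBar hinv]

lemma inner_A_dir {D : ℕ} (hinv : (M.infoD A D).IsInvertible) (y : EuclideanSpace ℝ (Fin k))
    (u : M.E D) : ⟪A (M.dir A D y : H), A (u : H)⟫ = ∑ j, y j * ⟪M.ψ j, (u : H)⟫ := by
  rw [← inner_infoD, M.infoD_dir hinv, inner_proj, sum_inner]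
  simp only [real_inner_smul_left]

variable (A) in
/-- The matrix `𝒥_D ℐ_D⁻¹ 𝒥_Dᵀ`, whose entries are `⟨ψ̄_D^i, ψ_j⟩`. -/
def gram (D : ℕ) : Matrix (Fin k) (Fin k) ℝ := Matrix.of fun i j => ⟪(M.psiBar A D i : H), M.ψ j⟫

lemma isUnit_infoMatrix {D : ℕ} (hinv : (M.infoD A D).IsInvertible) :
    IsUnit (M.infoMatrix A D).det := by
  rw [isUnit_iff_ne_zero]
  intro h
  obtain ⟨v, hv, hv0⟩ := Matrix.exists_vecMul_eq_zero_iff.2 h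
  refine hv ?_
  set w : M.E D := ∑ i, v i • M.basisE D i with hw
  have h1 : M.infoD A D w = 0 := by
    refine InnerProductSpace.ext_inner_left_basis (𝕜 := ℝ) (M.basisOE D).toBasis fun j => ?_
    rw [OrthonormalBasis.coe_toBasis, inner_zero_right, Submodule.coe_inner, basisOE_apply,
      real_inner_comm, hw]
    have := congrFun hv0 j
    simp only [Matrix.vecMul, dotProduct, infoMatrix, Matrix.of_apply, Pi.zero_apply] at this
    simp only [map_sum, map_smul, Submodule.coe_sum, Submodule.coe_smul, sum_inner,
      real_inner_smul_left]
    exact this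
  have h2 : w = 0 := by
    have := hinv.inverse_apply_self w
    rw [h1, map_zero] at this
    exact this.symm
  funext i
  have h3 : (M.basisOE D).repr w i = v i := by
    rw [hw, OrthonormalBasis.repr_apply_apply, inner_sum]
    simp only [← basisOE_eq, inner_smul_right, orthonormal_iff_ite.1 (M.basisOE D).orthonormal]
    simp
  rw [← h3, h2]
  simp

lemma effInfo_eq {D : ℕ} (hinv : (M.infoD A D).IsInvertible) :
    M.effInfo A D = (M.gram A D)⁻¹ := by
  have hX : (Matrix.of fun l i => ⟪(M.psiBar A D l : H), M.e (i : Fin D)⟫ :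
      Matrix (Fin k) (Fin D) ℝ) * M.infoMatrix A D = M.jacobian D := by
    ext l j
    have h1 := M.infoD_psiBar hinv l
    have h2 : M.psiBar A D l = ∑ i, ⟪(M.psiBar A D l : H), M.e (i : Fin D)⟫ • M.basisE D i := by
      conv_lhs => rw [← (M.basisOE D).sum_repr' (M.psiBar A D l)]
      refine Finset.sum_congr rfl fun i _ => ?_
      rw [Submodule.coe_inner, basisOE_apply, basisOE_eq, real_inner_comm]
    have h3 : ⟪(M.infoD A D (M.psiBar A D l) : H), M.e (j : ℕ)⟫ = ⟪M.ψ l, M.e (j : ℕ)⟫ := by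
      rw [h1]
      exact M.inner_proj D _ (M.basisE D j)
    rw [h2] at h3
    simp only [map_sum, map_smul, Submodule.coe_sum, Submodule.coe_smul, sum_inner,
      real_inner_smul_left] at h3
    simpa [Matrix.mul_apply, infoMatrix, jacobian] using h3
  have hX' : M.jacobian D * (M.infoMatrix A D)⁻¹ =
      Matrix.of fun l i => ⟪(M.psiBar A D l : H), M.e (i : Fin D)⟫ := by
    rw [← hX, Matrix.mul_assoc, Matrix.mul_nonsing_inv _ (M.isUnit_infoMatrix hinv), Matrix.mul_one]
  rw [effInfo, hX']
  congr 1
  ext l m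
  rw [Matrix.mul_apply, gram, Matrix.of_apply]
  conv_rhs => rw [← M.inner_proj D (M.ψ m) (M.psiBar A D l) |>.trans (real_inner_comm _ _),
    real_inner_comm, ← Submodule.coe_inner, ← (M.basisOE D).sum_inner_mul_inner]
  refine Finset.sum_congr rfl fun i _ => ?_
  rw [Submodule.coe_inner, Submodule.coe_inner, basisOE_apply, Matrix.transpose_apply, jacobian,
    Matrix.of_apply, Matrix.of_apply, ← basisOE_apply, real_inner_comm
      ((M.proj D (M.ψ m) : M.E D) : H), M.inner_proj]

lemma gram_apply {D : ℕ} (hinv : (M.infoD A D).IsInvertible) (i j : Fin k) :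
    M.gram A D i j = ⟪A (M.psiBar A D i : H), A (M.psiBar A D j : H)⟫ := by
  rw [gram, Matrix.of_apply, real_inner_comm (A (M.psiBar A D j : H)), ← inner_infoD,
    M.infoD_psiBar hinv, inner_proj, real_inner_comm]

lemma norm_A_dir_sq {D : ℕ} (hinv : (M.infoD A D).IsInvertible) (y : EuclideanSpace ℝ (Fin k)) :
    ‖A (M.dir A D y : H)‖ ^ 2 = y.ofLp ⬝ᵥ (M.gram A D).mulVec y.ofLp := by
  rw [← real_inner_self_eq_norm_sq]
  simp only [dir, Submodule.coe_sum, Submodule.coe_smul, map_sum, map_smul, inner_sum, sum_inner,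
    real_inner_smul_right, real_inner_smul_left, dotProduct, Matrix.mulVec, M.gram_apply hinv,
    Finset.mul_sum]
  rw [Finset.sum_comm]
  exact Finset.sum_congr rfl fun i _ => Finset.sum_congr rfl fun j _ => by ring

/-- For large `D` the projected representers are uniformly linearly independent. -/
lemma exists_norm_le_norm_proj_sum : ∃ c : ℝ, 0 < c ∧ ∀ᶠ D in atTop,
    ∀ y : EuclideanSpace ℝ (Fin k), c * ‖y‖ ≤ ‖M.proj D (∑ j, y j • M.ψ j)‖ := by
  let f : EuclideanSpace ℝ (Fin k) →ₗ[ℝ] H :=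
    (Fintype.linearCombination ℝ M.ψ).comp (WithLp.linearEquiv 2 ℝ (Fin k → ℝ)).toLinearMap
  have hf : ∀ y, f y = ∑ j, y j • M.ψ j := fun y => by
    simp [f, Fintype.linearCombination_apply]
  have hinj : LinearMap.ker f = ⊥ := by
    rw [LinearMap.ker_eq_bot']
    intro y hy
    rw [hf] at hy
    ext j
    exact Fintype.linearIndependent_iff.1 M.linearIndependent_ψ _ hy j
  obtain ⟨K, hK, hKf⟩ := f.exists_antilipschitzWith hinj
  have hlow : ∀ y, ‖y‖ ≤ K * ‖f y‖ := fun y => by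
    have := hKf.le_mul_dist y 0
    simpa using this
  refine ⟨1 / (2 * K), by positivity, ?_⟩
  have hψ : ∀ j, ∀ᶠ D in atTop, ‖M.ψ j - M.proj D (M.ψ j)‖ ≤ 1 / (2 * K * (k + 1)) := by
    intro j
    have h1 : Tendsto (fun D => ‖M.ψ j - M.proj D (M.ψ j)‖) atTop (𝓝 0) := by
      have := (tendsto_const_nhds (x := M.ψ j)).sub (M.tendsto_proj (M.ψ j))
      simpa using this.norm
    exact h1.eventually_le_const (by positivity)
  filter_upwards [eventually_all.2 hψ] with D hD y
  have h1 : ‖f y - M.proj D (f y)‖ ≤ ‖y‖ / (2 * K) := by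
    have h2 : f y - M.proj D (f y) = ∑ j, y j • (M.ψ j - M.proj D (M.ψ j)) := by
      rw [hf, map_sum]
      simp only [map_smul, smul_sub, Finset.sum_sub_distrib, Submodule.coe_sum, Submodule.coe_smul]
    rw [h2]
    calc _ ≤ ∑ j, ‖y‖ * (1 / (2 * K * (k + 1))) := by
          refine (norm_sum_le _ _).trans (Finset.sum_le_sum fun j _ => ?_)
          rw [norm_smul]
          exact mul_le_mul (PiLp.norm_apply_le y j) (hD j) (norm_nonneg _) (norm_nonneg _)
      _ = ‖y‖ / (2 * K) * (k / (k + 1)) := by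
          rw [Finset.sum_const, Finset.card_univ, Fintype.card_fin, nsmul_eq_mul]
          field_simp
      _ ≤ ‖y‖ / (2 * K) * 1 := by
          gcongr
          rw [div_le_one (by positivity)]
          linarith
      _ = _ := mul_one _
  rw [← hf]
  have h3 : ‖f y‖ ≤ ‖M.proj D (f y)‖ + ‖f y - M.proj D (f y)‖ := by
    have := norm_add_le ((M.proj D (f y) : M.E D) : H) (f y - M.proj D (f y))
    simpa using this
  have h4 : ‖y‖ / K ≤ ‖f y‖ := by
    rw [div_le_iff₀' (by exact_mod_cast hK)]
    exact hlow y
  have h5 : ‖y‖ / K = 2 * (‖y‖ / (2 * K)) := by field_simp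
  have h6 : 1 / (2 * K) * ‖y‖ = ‖y‖ / (2 * K) := by ring
  rw [h6]
  linarith

/-- A lower bound for `‖A u‖`, from `P A* A u = P (∑ y_j ψ_j)`. -/
lemma norm_proj_sum_le {D : ℕ} (hinv : (M.infoD A D).IsInvertible)
    (y : EuclideanSpace ℝ (Fin k)) :
    ‖M.proj D (∑ j, y j • M.ψ j)‖ ≤ ‖A‖ * ‖A (M.dir A D y : H)‖ := by
  rw [← M.infoD_dir hinv]
  refine (M.norm_proj_le D _).trans ?_
  refine ((ContinuousLinearMap.adjoint A).le_opNorm _).trans_eq ?_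
  rw [LinearIsometryEquiv.norm_map]
  rfl

variable (A) in
/-- The action of `i_D^{1/2}` on `ℝ^k`. -/
def sqrtMap (D : ℕ) : EuclideanSpace ℝ (Fin k) →ₗ[ℝ] EuclideanSpace ℝ (Fin k) :=
  Matrix.toEuclideanLin (M.sqrtEffInfo A D)

lemma posDef_gram {D : ℕ} (hinv : (M.infoD A D).IsInvertible) {c : ℝ} (hc : 0 < c)
    (hD : ∀ y : EuclideanSpace ℝ (Fin k), c * ‖y‖ ≤ ‖M.proj D (∑ j, y j • M.ψ j)‖) :
    (M.gram A D).PosDef := by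
  refine Matrix.PosDef.of_dotProduct_mulVec_pos ?_ fun x hx => ?_
  · ext i j
    simp [M.gram_apply hinv, real_inner_comm]
  · have h1 := M.norm_A_dir_sq hinv (WithLp.toLp 2 x)
    simp only [star_trivial]
    rw [← h1]
    have hx' : 0 < ‖WithLp.toLp 2 x‖ := norm_pos_iff.2 (by simpa using hx)
    have h2 := (hD (WithLp.toLp 2 x)).trans (M.norm_proj_sum_le hinv _)
    have h3 : 0 < ‖A (M.dir A D (WithLp.toLp 2 x) : H)‖ := by
      by_contra h
      have h4 : ‖A (M.dir A D (WithLp.toLp 2 x) : H)‖ = 0 := le_antisymm (not_lt.1 h) (norm_nonneg _)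
      rw [h4, mul_zero] at h2
      have : 0 < c * ‖WithLp.toLp 2 x‖ := by positivity
      linarith
    positivity

lemma sqrtEffInfo_isHermitian (D : ℕ) : (M.sqrtEffInfo A D).IsHermitian :=
  (Matrix.nonneg_iff_posSemidef.1 (CFC.sqrt_nonneg _)).1

/-- `i_D` is the inverse of the Gram matrix, and its square root commutes with it. -/
lemma sqrtEffInfo_mul_gram_mul {D : ℕ} (hinv : (M.infoD A D).IsInvertible) {c : ℝ} (hc : 0 < c)
    (hD : ∀ y : EuclideanSpace ℝ (Fin k), c * ‖y‖ ≤ ‖M.proj D (∑ j, y j • M.ψ j)‖) :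
    M.sqrtEffInfo A D * M.gram A D * M.sqrtEffInfo A D = 1 := by
  have hG := M.posDef_gram hinv hc hD
  have h1 : M.sqrtEffInfo A D * M.sqrtEffInfo A D = (M.gram A D)⁻¹ := by
    rw [sqrtEffInfo, M.effInfo_eq hinv]
    exact CFC.sqrt_mul_sqrt_self _ (Matrix.nonneg_iff_posSemidef.2 hG.inv.posSemidef)
  have h2 : M.sqrtEffInfo A D * (M.sqrtEffInfo A D * M.gram A D) = 1 := by
    rw [← Matrix.mul_assoc, h1]
    exact Matrix.nonsing_inv_mul _ ((Matrix.isUnit_iff_isUnit_det _).1 hG.isUnit)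
  exact mul_eq_one_comm.1 h2

/-- The vector `u = ∑ (i_D^{1/2} v)_j ψ̄_D^j` satisfies `‖A u‖ = ‖v‖`. -/
lemma norm_A_dir_sqrtMap {D : ℕ} (hinv : (M.infoD A D).IsInvertible) {c : ℝ} (hc : 0 < c)
    (hD : ∀ y : EuclideanSpace ℝ (Fin k), c * ‖y‖ ≤ ‖M.proj D (∑ j, y j • M.ψ j)‖)
    (v : EuclideanSpace ℝ (Fin k)) : ‖A (M.dir A D (M.sqrtMap A D v) : H)‖ = ‖v‖ := by
  have h1 := M.norm_A_dir_sq hinv (M.sqrtMap A D v)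
  have h2 : (M.sqrtMap A D v).ofLp = (M.sqrtEffInfo A D).mulVec v.ofLp := rfl
  have h3 : (M.sqrtEffInfo A D).transpose = M.sqrtEffInfo A D := M.sqrtEffInfo_isHermitian D
  have h4 : (M.sqrtEffInfo A D).mulVec v.ofLp ⬝ᵥ (M.gram A D).mulVec
      ((M.sqrtEffInfo A D).mulVec v.ofLp) = v.ofLp ⬝ᵥ v.ofLp := by
    rw [Matrix.mulVec_mulVec, ← Matrix.vecMul_transpose, h3, ← Matrix.dotProduct_mulVec,
      Matrix.mulVec_mulVec, ← Matrix.mul_assoc, M.sqrtEffInfo_mul_gram_mul hinv hc hD,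
      Matrix.one_mulVec]
  rw [h2, h4] at h1
  have h5 : v.ofLp ⬝ᵥ v.ofLp = ‖v‖ ^ 2 := by
    rw [← real_inner_self_eq_norm_sq, PiLp.inner_apply]
    simp [dotProduct, sq]
  rw [h5] at h1
  exact (pow_left_inj₀ (norm_nonneg _) (norm_nonneg _) two_ne_zero).1 h1

/-- Uniform bound for the square roots `i_D^{1/2}`. -/
lemma norm_sqrtMap_le {D : ℕ} (hinv : (M.infoD A D).IsInvertible) {c : ℝ} (hc : 0 < c)
    (hD : ∀ y : EuclideanSpace ℝ (Fin k), c * ‖y‖ ≤ ‖M.proj D (∑ j, y j • M.ψ j)‖)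
    (v : EuclideanSpace ℝ (Fin k)) : ‖M.sqrtMap A D v‖ ≤ ‖A‖ / c * ‖v‖ := by
  have h1 := (hD (M.sqrtMap A D v)).trans (M.norm_proj_sum_le hinv _)
  rw [M.norm_A_dir_sqrtMap hinv hc hD] at h1
  rw [div_mul_eq_mul_div, le_div_iff₀ hc]
  linarith

lemma inner_sqrtMap (D : ℕ) (v w : EuclideanSpace ℝ (Fin k)) :
    ⟪v, M.sqrtMap A D w⟫ = ⟪M.sqrtMap A D v, w⟫ := by
  have h3 : (M.sqrtEffInfo A D).transpose = M.sqrtEffInfo A D := M.sqrtEffInfo_isHermitian D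
  have h : ∀ a b : EuclideanSpace ℝ (Fin k), ⟪a, b⟫ = a.ofLp ⬝ᵥ b.ofLp := fun a b => by
    rw [PiLp.inner_apply]
    simp [dotProduct, mul_comm]
  have h2 : ∀ v, (M.sqrtMap A D v).ofLp = (M.sqrtEffInfo A D).mulVec v.ofLp := fun _ => rfl
  rw [h, h, h2, h2, Matrix.dotProduct_mulVec, ← Matrix.mulVec_transpose, h3]

lemma shift_eq (N : ℕ) (v : EuclideanSpace ℝ (Fin k)) :
    M.shift A N v = (√N)⁻¹ • M.dir A (M.D N) (M.sqrtMap A (M.D N) v) := by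
  have h3 : (M.sqrtEffInfo A (M.D N)).transpose = M.sqrtEffInfo A (M.D N) :=
    M.sqrtEffInfo_isHermitian _
  have h4 : ∀ i j, M.sqrtEffInfo A (M.D N) j i = M.sqrtEffInfo A (M.D N) i j :=
    fun i j => congrFun (congrFun h3 i) j
  have h2 : ∀ j, (M.sqrtMap A (M.D N) v) j = ∑ i, v i * M.sqrtEffInfo A (M.D N) i j := by
    intro j
    have : (M.sqrtMap A (M.D N) v).ofLp = (M.sqrtEffInfo A (M.D N)).mulVec v.ofLp := rfl
    rw [this]
    simp only [Matrix.mulVec, dotProduct]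
    exact Finset.sum_congr rfl fun i _ => by rw [h4 i j, mul_comm]
  simp only [shift, dir, h2, Finset.smul_sum, Finset.sum_smul, smul_smul]
  rw [Finset.sum_comm]
  exact Finset.sum_congr rfl fun i _ => Finset.sum_congr rfl fun j _ => by congr 1; ring

/-! ### The Gaussian prior -/

variable {d k : ℕ} {H V : Type*}
  [NormedAddCommGroup H] [InnerProductSpace ℝ H] [CompleteSpace H]
  [MeasurableSpace H] [BorelSpace H]
  [NormedAddCommGroup V] [InnerProductSpace ℝ V] [FiniteDimensional ℝ V]
  [MeasurableSpace V] [BorelSpace V] (M : Model d k H V)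

/-- The linear functional `⟨·, h⟩_{H_N}` on the approximation space. -/
def ipDual (N : ℕ) (h : M.E (M.D N)) : StrongDual ℝ (M.E (M.D N)) :=
  LinearMap.toContinuousLinearMap
    { toFun := fun θ => (M.ip N).inner θ h
      map_add' := fun θ θ' => (M.ip N).add_left θ θ' h
      map_smul' := fun c θ => by simpa using (M.ip N).smul_left θ h c }

lemma ipDual_apply (N : ℕ) (h θ : M.E (M.D N)) : M.ipDual N h θ = (M.ip N).inner θ h := rfl

lemma ipDual_comm (N : ℕ) (h θ : M.E (M.D N)) : M.ipDual N h θ = M.ipDual N θ h := by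
  rw [ipDual_apply, ipDual_apply]
  exact (M.ip N).conj_inner_symm h θ

lemma ipDual_add (N : ℕ) (h h' θ : M.E (M.D N)) :
    M.ipDual N (h + h') θ = M.ipDual N h θ + M.ipDual N h' θ := by
  rw [ipDual_comm, map_add, M.ipDual_comm N θ, M.ipDual_comm N θ h']

lemma ipDual_smul (N : ℕ) (c : ℝ) (h θ : M.E (M.D N)) :
    M.ipDual N (c • h) θ = c * M.ipDual N h θ := by
  rw [ipDual_comm, map_smul, M.ipDual_comm N θ, smul_eq_mul]

lemma ipDual_self_nonneg (N : ℕ) (h : M.E (M.D N)) : 0 ≤ M.ipDual N h h :=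
  (M.ip N).re_inner_nonneg h

lemma ipDual_self_pos (N : ℕ) {h : M.E (M.D N)} (hh : h ≠ 0) : 0 < M.ipDual N h h :=
  lt_of_le_of_ne (M.ipDual_self_nonneg N h) fun h0 => hh ((M.ip N).definite h h0.symm)

lemma ipNorm_sq (N : ℕ) (h : M.E (M.D N)) : M.ipNorm N h ^ 2 = M.ipDual N h h :=
  Real.sq_sqrt (M.ipDual_self_nonneg N h)

lemma abs_ipDual_le (N : ℕ) (h θ : M.E (M.D N)) :
    |M.ipDual N h θ| ≤ M.ipNorm N h * M.ipNorm N θ := by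
  have := @InnerProductSpace.Core.inner_mul_inner_self_le ℝ _ _ _ _
    (M.ip N).toCore θ h
  have h2 : |M.ipDual N h θ| ^ 2 ≤ (M.ipNorm N h * M.ipNorm N θ) ^ 2 := by
    rw [mul_pow, ipNorm_sq, ipNorm_sq, sq]
    have e : |M.ipDual N h θ| * |M.ipDual N θ h| ≤ M.ipDual N θ θ * M.ipDual N h h := this
    rw [M.ipDual_comm N θ h] at e
    linarith
  exact le_of_sq_le_sq h2 (by unfold ipNorm; positivity)

lemma exists_ipDual_eq (N : ℕ) (L : StrongDual ℝ (M.E (M.D N))) : ∃ h, M.ipDual N h = L := by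
  let Φ : M.E (M.D N) →ₗ[ℝ] StrongDual ℝ (M.E (M.D N)) :=
    { toFun := M.ipDual N
      map_add' := fun h h' => by ext θ; exact M.ipDual_add N h h' θ
      map_smul' := fun c h => by ext θ; exact M.ipDual_smul N c h θ }
  have hinj : Function.Injective Φ := by
    rw [injective_iff_map_eq_zero]
    intro h hh
    by_contra hne
    have := M.ipDual_self_pos N hne
    have h0 : M.ipDual N h h = 0 := by
      have : Φ h h = 0 := by rw [hh]; rfl
      exact this
    linarith
  have hf : Module.finrank ℝ (M.E (M.D N)) = Module.finrank ℝ (StrongDual ℝ (M.E (M.D N))) := by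
    rw [← (LinearMap.toContinuousLinearMap (𝕜 := ℝ) (E := M.E (M.D N)) (F' := ℝ)).finrank_eq]
    exact Subspace.dual_finrank_eq.symm
  exact (LinearMap.injective_iff_surjective_of_finrank_eq_finrank hf).1 hinj L

lemma prior_map_ipDual (N : ℕ) (h : M.E (M.D N)) :
    (M.prior N).map (M.ipDual N h) = gaussianReal 0 (M.ipDual N h h).toNNReal :=
  M.prior_map N h

instance secondCountable_E (D : ℕ) : SecondCountableTopology (M.E D) :=
  (ContinuousLinearEquiv.ofFinrankEq (𝕜 := ℝ) (E := M.E D)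
    (F := EuclideanSpace ℝ (Fin (Module.finrank ℝ (M.E D)))) (by simp)).toHomeomorph
    |>.secondCountableTopology

instance isGaussian_prior (N : ℕ) : IsGaussian (M.prior N) :=
  isGaussian_of_map_eq_gaussianReal fun L => by
    obtain ⟨h, rfl⟩ := M.exists_ipDual_eq N L
    exact ⟨_, _, M.prior_map_ipDual N h⟩

lemma lintegral_exp_ipDual (N : ℕ) (h : M.E (M.D N)) :
    ∫⁻ θ, ENNReal.ofReal (Real.exp (M.ipDual N h θ)) ∂(M.prior N) =
      ENNReal.ofReal (Real.exp (M.ipDual N h h / 2)) := by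
  have hm : mgf id (gaussianReal 0 (M.ipDual N h h).toNNReal) 1 =
      Real.exp (M.ipDual N h h / 2) := by
    rw [mgf_id_gaussianReal]; simp [M.ipDual_self_nonneg N h]
  have hi : Integrable (fun x => Real.exp x) (gaussianReal 0 (M.ipDual N h h).toNNReal) := by
    simpa using integrable_exp_mul_gaussianReal (μ := 0) (v := (M.ipDual N h h).toNNReal) 1
  have : ∫⁻ x, ENNReal.ofReal (Real.exp (M.ipDual N h x)) ∂(M.prior N) =
      ∫⁻ y, ENNReal.ofReal (Real.exp y) ∂((M.prior N).map (M.ipDual N h)) := by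
    rw [lintegral_map (by fun_prop) (by fun_prop)]
  rw [this, prior_map_ipDual,
    ← ofReal_integral_eq_lintegral_ofReal hi (ae_of_all _ fun x => (Real.exp_pos _).le), ← hm, mgf]
  simp

/-- The Cameron–Martin formula. -/
lemma prior_map_add (N : ℕ) (h : M.E (M.D N)) :
    (M.prior N).map (fun θ => θ + h) = (M.prior N).withDensity
      fun θ => ENNReal.ofReal (Real.exp (M.ipDual N h θ - M.ipDual N h h / 2)) := by
  have hsplit : ∀ x y : ℝ, ENNReal.ofReal (Real.exp (x + y)) =
      ENNReal.ofReal (Real.exp x) * ENNReal.ofReal (Real.exp y) := fun x y => by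
    rw [Real.exp_add, ENNReal.ofReal_mul (Real.exp_pos _).le]
  have hmeas : Measurable fun θ =>
      ENNReal.ofReal (Real.exp (M.ipDual N h θ - M.ipDual N h h / 2)) := by fun_prop
  have hL : ∀ u, ∫⁻ x, ENNReal.ofReal (Real.exp (M.ipDual N u x)) ∂((M.prior N).map (· + h)) =
      ENNReal.ofReal (Real.exp (M.ipDual N u u / 2 + M.ipDual N u h)) := by
    intro u
    rw [lintegral_map (by fun_prop) (by fun_prop)]
    simp_rw [map_add, hsplit]
    rw [lintegral_mul_const _ (by fun_prop), lintegral_exp_ipDual]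
  have hR : ∀ u, ∫⁻ x, ENNReal.ofReal (Real.exp (M.ipDual N u x)) ∂((M.prior N).withDensity
      fun θ => ENNReal.ofReal (Real.exp (M.ipDual N h θ - M.ipDual N h h / 2))) =
      ENNReal.ofReal (Real.exp (M.ipDual N u u / 2 + M.ipDual N u h)) := by
    intro u
    rw [lintegral_withDensity_eq_lintegral_mul _ hmeas (by fun_prop)]
    have : ∀ θ, (((fun θ => ENNReal.ofReal (Real.exp (M.ipDual N h θ - M.ipDual N h h / 2))) *
        fun x => ENNReal.ofReal (Real.exp (M.ipDual N u x))) θ) =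
        ENNReal.ofReal (Real.exp (M.ipDual N (h + u) θ)) *
          ENNReal.ofReal (Real.exp (-(M.ipDual N h h / 2))) := fun θ => by
      rw [Pi.mul_apply, ← hsplit, ← hsplit, ipDual_add]
      congr 2; ring
    simp_rw [this]
    rw [lintegral_mul_const _ (by fun_prop), lintegral_exp_ipDual, ← hsplit]
    congr 2
    rw [map_add, ipDual_add, ipDual_add, M.ipDual_comm N u h]
    ring
  have hfin : IsFiniteMeasure ((M.prior N).withDensity
      fun θ => ENNReal.ofReal (Real.exp (M.ipDual N h θ - M.ipDual N h h / 2))) := by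
    constructor
    have := hR 0
    have h0 : ∀ x, M.ipDual N 0 x = 0 := fun x => by rw [ipDual_comm, map_zero]
    simp only [h0, Real.exp_zero, ENNReal.ofReal_one, lintegral_one] at this
    rw [this]
    exact ENNReal.ofReal_lt_top
  have hprob : IsProbabilityMeasure ((M.prior N).map (· + h)) :=
    Measure.isProbabilityMeasure_map (by fun_prop)
  refine measure_ext_of_lintegral_exp (fun L => ?_) fun L => ?_
  · obtain ⟨u, rfl⟩ := M.exists_ipDual_eq N L
    rw [hL]; exact ENNReal.ofReal_ne_top
  · obtain ⟨u, rfl⟩ := M.exists_ipDual_eq N L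
    rw [hL, hR]

/-- Gaussian tails of the linear functionals `⟨·, h⟩_{H_N}`. -/
lemma prior_abs_ipDual_le (N : ℕ) (h : M.E (M.D N)) {x : ℝ} (hx : 0 ≤ x) :
    M.prior N {θ | x * M.ipNorm N h < |M.ipDual N h θ|} ≤
      2 * ENNReal.ofReal (Real.exp (-(x ^ 2 / 2))) := by
  have hone : ∀ u : M.E (M.D N), 0 < M.ipNorm N u →
      M.prior N {θ | x * M.ipNorm N u < M.ipDual N u θ} ≤
        ENNReal.ofReal (Real.exp (-(x ^ 2 / 2))) := by
    intro u hu
    have hsub : {θ | x * M.ipNorm N u < M.ipDual N u θ} ⊆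
        {θ | ENNReal.ofReal (Real.exp (x ^ 2)) ≤
          ENNReal.ofReal (Real.exp (M.ipDual N ((x / M.ipNorm N u) • u) θ))} := by
      intro θ hθ
      have hθ' : x * M.ipNorm N u < M.ipDual N u θ := hθ
      refine ENNReal.ofReal_le_ofReal (Real.exp_le_exp.2 ?_)
      rw [ipDual_smul]
      calc x ^ 2 = x / M.ipNorm N u * (x * M.ipNorm N u) := by field_simp
        _ ≤ _ := by gcongr
    refine (measure_mono hsub).trans ?_
    refine (meas_ge_le_lintegral_div (by fun_prop) (by simp [Real.exp_pos])
      ENNReal.ofReal_ne_top).trans ?_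
    rw [lintegral_exp_ipDual, ← ENNReal.ofReal_div_of_pos (Real.exp_pos _), ← Real.exp_sub]
    refine ENNReal.ofReal_le_ofReal (Real.exp_le_exp.2 (le_of_eq ?_))
    rw [ipDual_smul, map_smul, smul_eq_mul, ← ipNorm_sq]
    field_simp
    ring
  have hnn : ∀ u, 0 ≤ M.ipNorm N u := fun u => Real.sqrt_nonneg _
  rcases (hnn h).eq_or_lt with h0 | h0
  · have : {θ | x * M.ipNorm N h < |M.ipDual N h θ|} = ∅ := by
      ext θ
      have := M.abs_ipDual_le N h θ
      simp only [Set.mem_ofPred_eq, Set.mem_empty_iff_false, iff_false, not_lt]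
      rw [← h0] at this ⊢
      linarith
    rw [this]; simp
  · have hneg : M.ipNorm N (-h) = M.ipNorm N h := by
      rw [← sq_eq_sq₀ (hnn _) (hnn _)]
      have := ipNorm_sq M N (-h)
      have h2 := ipNorm_sq M N h
      have h3 : M.ipDual N (-h) (-h) = M.ipDual N h h := by
        rw [map_neg, ipDual_comm, map_neg, neg_neg]
      exact this.trans (h3.trans h2.symm)
    have hsub : {θ | x * M.ipNorm N h < |M.ipDual N h θ|} ⊆
        {θ | x * M.ipNorm N h < M.ipDual N h θ} ∪
          {θ | x * M.ipNorm N (-h) < M.ipDual N (-h) θ} := by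
      intro θ hθ
      rcases lt_abs.1 (show x * M.ipNorm N h < |M.ipDual N h θ| from hθ) with h1 | h1
      · exact Or.inl h1
      · refine Or.inr ?_
        show x * M.ipNorm N (-h) < M.ipDual N (-h) θ
        rw [hneg, ipDual_comm, map_neg, ipDual_comm]
        exact h1
    refine (measure_mono hsub).trans ((measure_union_le _ _).trans ?_)
    rw [two_mul]
    exact add_le_add (hone h h0) (hone (-h) (hneg ▸ h0))

lemma integrable_norm_pow_prior (N n : ℕ) :
    Integrable (fun θ : M.E (M.D N) => ‖(θ : H)‖ ^ n) (M.prior N) := by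
  have := IsGaussian.memLp_id (M.prior N) n (by simp)
  have h2 := this.integrable_norm_pow'
  simpa using h2

/-- The moments of a Gaussian measure are comparable: the sixth moment is controlled by the
fourth. -/
lemma integral_norm_pow_six_le (N : ℕ) :
    ∫ θ, ‖(θ : H)‖ ^ 6 ∂(M.prior N) ≤
      1440 * Real.exp (1 / 2) * (∫ θ, ‖(θ : H)‖ ^ 4 ∂(M.prior N)) ^ (3 / 2 : ℝ) := by
  -- each coordinate is a functional `⟨·, h i⟩_{H_N}`, hence Gaussian of variance `w i`
  have hcoord : ∀ i : Fin (M.D N), ∃ h : M.E (M.D N), h ≠ 0 ∧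
      ∀ θ, M.ipDual N h θ = ⟪M.basisOE (M.D N) i, θ⟫ := by
    intro i
    obtain ⟨h, hh⟩ := M.exists_ipDual_eq N (innerSL ℝ (M.basisOE (M.D N) i))
    refine ⟨h, ?_, fun θ => by rw [hh]; rfl⟩
    rintro rfl
    have h1 : M.ipDual N 0 (M.basisOE (M.D N) i) = 1 := by
      rw [hh]; simp
    rw [ipDual_comm, map_zero] at h1
    norm_num at h1
  choose h hne hh using hcoord
  set w : Fin (M.D N) → ℝ := fun i => M.ipDual N (h i) (h i) with hw
  have hwpos : ∀ i, 0 < w i := fun i => M.ipDual_self_pos N (hne i)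
  have hnorm : ∀ θ : M.E (M.D N), ‖(θ : H)‖ ^ 2 = ∑ i, (M.ipDual N (h i) θ) ^ 2 := by
    intro θ
    simp_rw [hh]
    have := (M.basisOE (M.D N)).sum_sq_norm_inner_right θ
    simpa using this.symm
  have hmem : ∀ i (n : ℕ), Integrable (fun θ => (M.ipDual N (h i) θ) ^ n) (M.prior N) := by
    intro i n
    have h1 : Integrable (fun x : ℝ => x ^ n) ((M.prior N).map (M.ipDual N (h i))) := by
      rw [prior_map_ipDual]
      have := (memLp_id_gaussianReal' (μ := 0) (v := (M.ipDual N (h i) (h i)).toNNReal) n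
        (by simp)).integrable_norm_pow'
      refine this.mono' (by fun_prop) (ae_of_all _ fun x => by simp)
    exact h1.comp_measurable (by fun_prop)
  have h2m : ∀ i, ∫ θ, (M.ipDual N (h i) θ) ^ 2 ∂(M.prior N) = w i := by
    intro i
    have h1 : ∫ θ, (M.ipDual N (h i) θ) ^ 2 ∂(M.prior N) =
        ∫ x, x ^ 2 ∂((M.prior N).map (M.ipDual N (h i))) :=
      (integral_map (M.ipDual N (h i)).continuous.measurable.aemeasurable
        (by fun_prop : Continuous fun x : ℝ => x ^ 2).aestronglyMeasurable).symm
    rw [h1, prior_map_ipDual]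
    have h3 := variance_id_gaussianReal (μ := 0) (v := (M.ipDual N (h i) (h i)).toNNReal)
    rw [variance_eq_integral (by fun_prop)] at h3
    simpa [hw, M.ipDual_self_nonneg] using h3
  have h6m : ∀ i, ∫ θ, (M.ipDual N (h i) θ) ^ 6 ∂(M.prior N) ≤
      1440 * Real.exp (1 / 2) * w i ^ 3 := by
    intro i
    -- `x⁶ ≤ 6! w³ (e^{x / √w} + e^{-x / √w})`
    set s := √(w i) with hs
    have hspos : 0 < s := Real.sqrt_pos.2 (hwpos i)
    have hsq : s ^ 2 = w i := Real.sq_sqrt (hwpos i).le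
    have hexp : ∀ τ : ℝ, τ ^ 2 = (s⁻¹) ^ 2 →
        ∫⁻ θ, ENNReal.ofReal (Real.exp (M.ipDual N (τ • h i) θ)) ∂(M.prior N) =
          ENNReal.ofReal (Real.exp (1 / 2)) := by
      intro τ hτ
      rw [lintegral_exp_ipDual, ipDual_smul, map_smul, smul_eq_mul]
      congr 3
      change τ * (τ * w i) = 1
      rw [← mul_assoc, ← sq, hτ, ← hsq]; field_simp
    have hpt : ∀ θ, (M.ipDual N (h i) θ) ^ 6 ≤ 720 * w i ^ 3 *
        (Real.exp (M.ipDual N (s⁻¹ • h i) θ) + Real.exp (M.ipDual N ((-s⁻¹) • h i) θ)) := by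
      intro θ
      rw [ipDual_smul, ipDual_smul]
      set x := M.ipDual N (h i) θ
      have h1 := Real.pow_div_factorial_le_exp _ (abs_nonneg (s⁻¹ * x)) 6
      have h2 : Real.exp |s⁻¹ * x| ≤ Real.exp (s⁻¹ * x) + Real.exp (-s⁻¹ * x) := by
        rw [neg_mul]
        rcases abs_cases (s⁻¹ * x) with ⟨h, _⟩ | ⟨h, _⟩ <;> rw [h] <;>
          nlinarith [Real.exp_pos (s⁻¹ * x), Real.exp_pos (-(s⁻¹ * x))]
      have h3 : x ^ 6 = w i ^ 3 * |s⁻¹ * x| ^ 6 := by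
        rw [← hsq, Even.pow_abs (by decide), mul_pow]; field_simp
      have h4 : |s⁻¹ * x| ^ 6 ≤ 720 * Real.exp |s⁻¹ * x| := by
        have : ((6 : ℕ).factorial : ℝ) = 720 := by norm_num [Nat.factorial]
        rw [this] at h1
        linarith
      rw [h3]
      have := pow_pos (hwpos i) 3
      nlinarith
    have hint : ∀ τ : ℝ, τ ^ 2 = (s⁻¹) ^ 2 →
        Integrable (fun θ => Real.exp (M.ipDual N (τ • h i) θ)) (M.prior N) ∧
        ∫ θ, Real.exp (M.ipDual N (τ • h i) θ) ∂(M.prior N) = Real.exp (1 / 2) := by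
      intro τ hτ
      have hi : Integrable (fun θ => Real.exp (M.ipDual N (τ • h i) θ)) (M.prior N) := by
        refine ⟨by fun_prop, ?_⟩
        rw [hasFiniteIntegral_iff_ofReal (ae_of_all _ fun _ => (Real.exp_pos _).le), hexp τ hτ]
        exact ENNReal.ofReal_lt_top
      refine ⟨hi, ?_⟩
      rw [integral_eq_lintegral_of_nonneg_ae (ae_of_all _ fun _ => (Real.exp_pos _).le)
        hi.aestronglyMeasurable, hexp τ hτ, ENNReal.toReal_ofReal (Real.exp_pos _).le]
    obtain ⟨i1, e1⟩ := hint s⁻¹ rfl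
    obtain ⟨i2, e2⟩ := hint (-s⁻¹) (by ring)
    calc ∫ θ, (M.ipDual N (h i) θ) ^ 6 ∂(M.prior N)
        ≤ ∫ θ, 720 * w i ^ 3 * (Real.exp (M.ipDual N (s⁻¹ • h i) θ) +
          Real.exp (M.ipDual N ((-s⁻¹) • h i) θ)) ∂(M.prior N) :=
          integral_mono (hmem i 6) ((i1.add i2).const_mul _) hpt
      _ = 1440 * Real.exp (1 / 2) * w i ^ 3 := by
          rw [integral_const_mul, integral_add i1 i2, e1, e2]; ring
  set S := ∑ i, w i with hS
  have hE2 : ∫ θ, ‖(θ : H)‖ ^ 2 ∂(M.prior N) = S := by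
    simp_rw [hnorm]
    rw [integral_finsetSum _ fun i _ => hmem i 2]
    simp_rw [h2m]; rfl
  have hS0 : 0 ≤ S := Finset.sum_nonneg fun i _ => (hwpos i).le
  -- Jensen's inequality with the weights `w i / S`
  have h6 : ∫ θ, ‖(θ : H)‖ ^ 6 ∂(M.prior N) ≤ 1440 * Real.exp (1 / 2) * S ^ 3 := by
    rcases hS0.eq_or_lt with h0 | hSpos
    · have hemp : ∀ i : Fin (M.D N), False := fun i => by
        have := Finset.single_le_sum (fun j _ => (hwpos j).le) (Finset.mem_univ i)
        have := hwpos i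
        linarith
      have hz : ∀ θ : M.E (M.D N), ‖(θ : H)‖ ^ 6 = 0 := fun θ => by
        have h1 := hnorm θ
        have : IsEmpty (Fin (M.D N)) := ⟨hemp⟩
        rw [Finset.univ_eq_empty, Finset.sum_empty] at h1
        rw [show (6 : ℕ) = 2 * 3 by rfl, pow_mul, h1]; norm_num
      simp_rw [hz]
      simp [← h0]
    have hpt : ∀ θ : M.E (M.D N), ‖(θ : H)‖ ^ 6 ≤
        ∑ i, S ^ 2 * ((w i)⁻¹ ^ 2 * (M.ipDual N (h i) θ) ^ 6) := by
      intro θ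
      have hj := Real.pow_arith_mean_le_arith_mean_pow Finset.univ (fun i => w i / S)
        (fun i => (M.ipDual N (h i) θ) ^ 2 / w i) (fun i _ => by have := hwpos i; positivity)
        (by rw [← Finset.sum_div]; exact div_self hSpos.ne')
        (fun i _ => by have := hwpos i; positivity) 3
      have e1 : ∑ i, w i / S * ((M.ipDual N (h i) θ) ^ 2 / w i) = ‖(θ : H)‖ ^ 2 / S := by
        rw [hnorm, Finset.sum_div]
        exact Finset.sum_congr rfl fun i _ => by have := (hwpos i).ne'; field_simp
      rw [e1] at hj
      calc ‖(θ : H)‖ ^ 6 = S ^ 3 * (‖(θ : H)‖ ^ 2 / S) ^ 3 := by field_simp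
        _ ≤ S ^ 3 * ∑ i, w i / S * ((M.ipDual N (h i) θ) ^ 2 / w i) ^ 3 := by gcongr
        _ = _ := by
          rw [Finset.mul_sum]
          exact Finset.sum_congr rfl fun i _ => by have := (hwpos i).ne'; field_simp
    calc ∫ θ, ‖(θ : H)‖ ^ 6 ∂(M.prior N)
        ≤ ∫ θ, ∑ i, S ^ 2 * ((w i)⁻¹ ^ 2 * (M.ipDual N (h i) θ) ^ 6) ∂(M.prior N) :=
          integral_mono (M.integrable_norm_pow_prior N 6)
            (integrable_finsetSum _ fun i _ => ((hmem i 6).const_mul _).const_mul _) hpt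
      _ = ∑ i, S ^ 2 * ((w i)⁻¹ ^ 2 * ∫ θ, (M.ipDual N (h i) θ) ^ 6 ∂(M.prior N)) := by
          rw [integral_finsetSum _ fun i _ => ((hmem i 6).const_mul _).const_mul _]
          simp_rw [integral_const_mul]
      _ ≤ ∑ i, S ^ 2 * ((w i)⁻¹ ^ 2 * (1440 * Real.exp (1 / 2) * w i ^ 3)) := by
          gcongr with i _
          exact h6m i
      _ = 1440 * Real.exp (1 / 2) * S ^ 3 := by
          rw [show S ^ 3 = S ^ 2 * S by ring, hS, Finset.mul_sum, Finset.mul_sum]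
          exact Finset.sum_congr rfl fun i _ => by have := (hwpos i).ne'; field_simp
  have h4 : S ^ 2 ≤ ∫ θ, ‖(θ : H)‖ ^ 4 ∂(M.prior N) := by
    have i2 := M.integrable_norm_pow_prior N 2
    have i4 := M.integrable_norm_pow_prior N 4
    have hi : Integrable (fun θ : M.E (M.D N) => 2 * S * ‖(θ : H)‖ ^ 2 - S ^ 2) (M.prior N) :=
      (i2.const_mul _).sub (integrable_const _)
    calc S ^ 2 = ∫ θ, (2 * S * ‖(θ : H)‖ ^ 2 - S ^ 2) ∂(M.prior N) := by
          rw [integral_sub (i2.const_mul _) (integrable_const _), integral_const_mul, hE2]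
          simp; ring
      _ ≤ _ := integral_mono hi i4 fun θ => by
          show 2 * S * ‖(θ : H)‖ ^ 2 - S ^ 2 ≤ ‖(θ : H)‖ ^ 4
          nlinarith [sq_nonneg (‖(θ : H)‖ ^ 2 - S)]
  refine h6.trans ?_
  gcongr
  calc S ^ 3 = (S ^ 2) ^ (3 / 2 : ℝ) := by
        rw [← Real.rpow_natCast S 2, ← Real.rpow_mul hS0, ← Real.rpow_natCast S 3]; norm_num
    _ ≤ _ := Real.rpow_le_rpow (by positivity) h4 (by norm_num)

end Model

/-! ### Convergence in probability as convergence along a filter -/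

section InProb

variable {Ω : Type*} [MeasurableSpace Ω]

/-- The filter on `ℕ × Ω` of the sets whose `N`-th section has a probability that tends to one;
convergence in probability of `X N ω` is convergence of `X` along this filter. -/
def inProb (P : Measure Ω) : Filter (ℕ × Ω) where
  sets := {s | Tendsto (fun N => P {ω | (N, ω) ∉ s}) atTop (𝓝 0)}
  univ_sets := by simp
  sets_of_superset := fun {s t} hs hst =>
    tendsto_of_tendsto_of_tendsto_of_le_of_le tendsto_const_nhds hs (fun _ => zero_le)
      fun N => measure_mono fun ω hω h => hω (hst h)
  inter_sets := fun {s t} hs ht => by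
    have h : Tendsto (fun N => P {ω | (N, ω) ∉ s} + P {ω | (N, ω) ∉ t}) atTop (𝓝 (0 + 0)) :=
      Tendsto.add hs ht
    rw [add_zero] at h
    refine tendsto_of_tendsto_of_tendsto_of_le_of_le tendsto_const_nhds h (fun _ => zero_le)
      fun N => (measure_mono ?_).trans (measure_union_le _ _)
    intro ω hω
    by_cases hs' : (N, ω) ∈ s
    · exact Or.inr fun ht' => hω ⟨hs', ht'⟩
    · exact Or.inl hs'

variable {P : Measure Ω}

lemma eventually_inProb {q : ℕ × Ω → Prop} :
    (∀ᶠ p in inProb P, q p) ↔ Tendsto (fun N => P {ω | ¬ q (N, ω)}) atTop (𝓝 0) := Iff.rfl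

lemma eventually_inProb_of_ae {q : ℕ → Ω → Prop} (h : ∀ᶠ N in atTop, ∀ᵐ ω ∂P, q N ω) :
    ∀ᶠ p in inProb P, q p.1 p.2 := by
  rw [eventually_inProb]
  refine tendsto_const_nhds.congr' ?_
  filter_upwards [h] with N hN
  exact (ae_iff.1 hN).symm

lemma tendsto_fst_inProb : Tendsto Prod.fst (inProb P) atTop := fun s hs =>
  eventually_inProb_of_ae (P := P) (q := fun N _ => N ∈ s) <| by
    filter_upwards [hs] with N hN
    exact Eventually.of_forall fun _ => hN

lemma eventually_inProb_of_tendsto_one [IsProbabilityMeasure P] {q : ℕ → Ω → Prop}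
    (hm : ∀ N, MeasurableSet {ω | q N ω})
    (h : Tendsto (fun N => P {ω | q N ω}) atTop (𝓝 1)) : ∀ᶠ p in inProb P, q p.1 p.2 := by
  rw [eventually_inProb]
  have h2 := ENNReal.Tendsto.sub (tendsto_const_nhds (x := (1 : ℝ≥0∞))) h (Or.inl ENNReal.one_ne_top)
  rw [tsub_self] at h2
  refine h2.congr fun N => ?_
  rw [← prob_compl_eq_one_sub (hm N)]
  rfl

/-- Markov's inequality. -/
lemma tendsto_inProb_of_lintegral {X : ℕ → Ω → ℝ≥0∞} (hX : ∀ᶠ N in atTop, AEMeasurable (X N) P)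
    (h : Tendsto (fun N => ∫⁻ ω, X N ω ∂P) atTop (𝓝 0)) :
    Tendsto (fun p : ℕ × Ω => X p.1 p.2) (inProb P) (𝓝 0) := by
  rw [ENNReal.tendsto_nhds_zero]
  intro ε hε
  rcases eq_or_ne ε ∞ with rfl | hε'
  · exact Eventually.of_forall fun _ => le_top
  rw [eventually_inProb]
  have h2 : Tendsto (fun N => (∫⁻ ω, X N ω ∂P) / ε) atTop (𝓝 (0 / ε)) :=
    ENNReal.Tendsto.div_const h (Or.inr hε.ne')
  rw [ENNReal.zero_div] at h2
  refine tendsto_of_tendsto_of_tendsto_of_le_of_le' tendsto_const_nhds h2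
    (Eventually.of_forall fun _ => zero_le) ?_
  filter_upwards [hX] with N hXN
  refine (measure_mono ?_).trans (meas_ge_le_lintegral_div hXN hε.ne' hε')
  intro ω hω
  exact (not_le.1 hω).le

/-- A real random variable of order `O_P(ρ_N)` times a deterministic sequence of order `o(1/ρ_N)`
tends to zero in probability. -/
lemma IsBigOInProb.tendsto_mul {X : ℕ → Ω → ℝ} {ρ κ : ℕ → ℝ} (h : IsBigOInProb P X ρ)
    (hκ : ∀ N, 0 ≤ κ N) (hρ : ∀ N, 0 ≤ ρ N) (hκρ : Tendsto (fun N => κ N * ρ N) atTop (𝓝 0)) :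
    Tendsto (fun p : ℕ × Ω => κ p.1 * X p.1 p.2) (inProb P) (𝓝 0) := by
  rw [Metric.tendsto_nhds]
  intro ε hε
  rw [eventually_inProb, ENNReal.tendsto_nhds_zero]
  intro η hη
  obtain ⟨K, hK⟩ := h η hη
  have h2 : Tendsto (fun N => (|K| + 1) * (κ N * ρ N)) atTop (𝓝 0) := by
    simpa using hκρ.const_mul (|K| + 1)
  filter_upwards [hK, h2.eventually (gt_mem_nhds hε)] with N hN hN2
  refine (measure_mono ?_).trans hN
  intro ω hω
  simp only [dist_zero_right, not_lt, Real.norm_eq_abs, Set.mem_ofPred_eq, abs_mul,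
    abs_of_nonneg (hκ N)] at hω ⊢
  by_contra hcon
  push Not at hcon
  have h3 : κ N * |X N ω| ≤ κ N * (K * ρ N) := mul_le_mul_of_nonneg_left hcon (hκ N)
  have h4 : κ N * (K * ρ N) ≤ (|K| + 1) * (κ N * ρ N) := by
    have := mul_nonneg (hκ N) (hρ N)
    nlinarith [le_abs_self K]
  linarith

lemma tendstoInMeasure_of_tendsto_inProb {F : Type*} [PseudoEMetricSpace F] {X : ℕ → Ω → F}
    {c : F} (h : Tendsto (fun p : ℕ × Ω => X p.1 p.2) (inProb P) (𝓝 c)) :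
    TendstoInMeasure P X atTop (fun _ => c) := by
  intro ε hε
  have h2 := EMetric.tendsto_nhds.1 h ε hε
  rw [eventually_inProb] at h2
  simpa using h2

end InProb

/-! ### The local parameter sets -/

lemma IsExtendedNorm.sum_le {F : Type*} [AddCommGroup F] [Module ℝ F] {n : F → ℝ≥0∞}
    (hn : IsExtendedNorm n) {ι : Type*} (s : Finset ι) (c : ι → ℝ) (x : ι → F) :
    n (∑ i ∈ s, c i • x i) ≤ ∑ i ∈ s, ‖c i‖ₑ * n (x i) := by
  classical
  induction s using Finset.induction_on with
  | empty => simpa using (hn.smul 0 0).le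
  | insert i s hi ih =>
    rw [Finset.sum_insert hi, Finset.sum_insert hi]
    exact (hn.add_le _ _).trans (add_le_add (hn.smul _ _).le ih)

/-- On a finite-dimensional space, an extended norm is measurable: it is continuous on the closed
subspace where it is finite. -/
lemma IsExtendedNorm.measurable {F : Type*} [NormedAddCommGroup F] [NormedSpace ℝ F]
    [FiniteDimensional ℝ F] [MeasurableSpace F] [BorelSpace F] {n : F → ℝ≥0∞}
    (hn : IsExtendedNorm n) : Measurable n := by
  have h0 : n 0 = 0 := by simpa using hn.smul 0 0
  let S : Submodule ℝ F :=
    { carrier := {x | n x < ∞}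
      add_mem' := fun {x y} hx hy => (hn.add_le x y).trans_lt (ENNReal.add_lt_top.2 ⟨hx, hy⟩)
      zero_mem' := by simp [h0]
      smul_mem' := fun c x hx => by
        simp only [Set.mem_ofPred_eq, hn.smul]
        exact ENNReal.mul_lt_top (by simp) hx }
  have hS : IsClosed (S : Set F) := S.closed_of_finiteDimensional
  have hmemS : ∀ x, x ∈ S ↔ n x < ∞ := fun _ => Iff.rfl
  -- Lipschitz bound in the coordinates of a basis
  let b := Module.finBasis ℝ S
  have hbound : ∀ x : S, n x ≤ ∑ i, ‖b.equivFun x i‖ₑ * n (b i : F) := by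
    intro x
    have hx : (x : F) = ∑ i, b.equivFun x i • (b i : F) := by
      have h := congrArg (S.subtype) (b.sum_equivFun x)
      rw [map_sum] at h
      exact h.symm
    rw [hx]
    exact hn.sum_le _ _ _
  have hcoord : Continuous fun x : S => b.equivFun x :=
    LinearMap.continuous_of_finiteDimensional b.equivFun.toLinearMap
  have hcont0 : Tendsto (fun x : S => n x) (𝓝 0) (𝓝 0) := by
    have h1 : Tendsto (fun x : S => ∑ i, ‖b.equivFun x i‖ₑ * n (b i : F)) (𝓝 0) (𝓝 0) := by
      have : Tendsto (fun x : S => ∑ i, ‖b.equivFun x i‖ₑ * n (b i : F)) (𝓝 0)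
          (𝓝 (∑ i, ‖b.equivFun (0 : S) i‖ₑ * n (b i : F))) := by
        refine tendsto_finsetSum _ fun i _ => ENNReal.Tendsto.mul_const ?_
          (Or.inr ((hmemS _).1 (b i).2).ne)
        exact (continuous_enorm.comp ((continuous_apply i).comp hcoord)).tendsto 0
      simpa using this
    exact tendsto_of_tendsto_of_tendsto_of_le_of_le tendsto_const_nhds h1 (fun _ => zero_le) hbound
  have hneg : ∀ x, n (-x) = n x := fun x => by simpa using hn.smul (-1) x
  have hcont : Continuous fun x : S => (n x).toReal := by
    refine continuous_iff_continuousAt.2 fun x => ?_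
    have h2 : Tendsto (fun y : S => (n ((y - x : S) : F)).toReal) (𝓝 x) (𝓝 0) := by
      have h3 : Tendsto (fun y : S => y - x) (𝓝 x) (𝓝 0) := by
        have : Continuous fun y : S => y - x := by fun_prop
        simpa using this.tendsto x
      exact (ENNReal.tendsto_toReal ENNReal.zero_ne_top).comp (hcont0.comp h3)
    refine tendsto_iff_dist_tendsto_zero.2 (squeeze_zero (fun _ => dist_nonneg) (fun y => ?_) h2)
    have hsub : ∀ u v : S, (n u).toReal ≤ (n v).toReal + (n ((u - v : S) : F)).toReal := by
      intro u v
      rw [← ENNReal.toReal_add ((hmemS _).1 v.2).ne ((hmemS _).1 (u - v).2).ne]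
      refine ENNReal.toReal_mono
        (ENNReal.add_ne_top.2 ⟨((hmemS _).1 v.2).ne, ((hmemS _).1 (u - v).2).ne⟩) ?_
      simpa using hn.add_le (v : F) ((u - v : S) : F)
    have hsymm : n ((x - y : S) : F) = n ((y - x : S) : F) := by
      rw [← hneg]; simp
    rw [Real.dist_eq, abs_le]
    constructor
    · have := hsub x y
      rw [hsymm] at this
      linarith
    · linarith [hsub y x]
  refine measurable_of_Iic fun c => ?_
  rcases eq_or_ne c ∞ with rfl | hc
  · simp
  have : n ⁻¹' Set.Iic c = Subtype.val '' {x : S | (n x).toReal ≤ c.toReal} := by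
    ext x
    simp only [Set.mem_preimage, Set.mem_Iic, Set.mem_image, Set.mem_ofPred_eq, Subtype.exists,
      exists_and_right, exists_eq_right]
    constructor
    · intro h
      exact ⟨(hmemS x).2 (h.trans_lt hc.lt_top), ENNReal.toReal_mono hc h⟩
    · rintro ⟨hx, h⟩
      exact (ENNReal.toReal_le_toReal ((hmemS x).1 hx).ne hc).1 h
  rw [this]
  exact (hS.isClosedEmbedding_subtypeVal.isClosedMap _
    (isClosed_le hcont continuous_const)).measurableSet

lemma IsExtendedNorm.comp_subtype {F : Type*} [AddCommGroup F] [Module ℝ F] {n : F → ℝ≥0∞}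
    (hn : IsExtendedNorm n) (S : Submodule ℝ F) : IsExtendedNorm fun x : S => n x where
  add_le x y := hn.add_le x y
  smul c x := hn.smul c x
  eq_zero x hx := Subtype.ext (hn.eq_zero x hx)

namespace Model

variable {d k : ℕ} {H V : Type*}
  [NormedAddCommGroup H] [InnerProductSpace ℝ H] [CompleteSpace H]
  [MeasurableSpace H] [BorelSpace H]
  [NormedAddCommGroup V] [InnerProductSpace ℝ V] [FiniteDimensional ℝ V]
  [MeasurableSpace V] [BorelSpace V] (M : Model d k H V)

lemma measurable_toΘ (D : ℕ) : Measurable fun θ : M.E D => M.toΘ θ :=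
  Measurable.subtype_mk measurable_subtype_coe

lemma measurable_G_comp {Ω : Type*} [MeasurableSpace Ω] {f : Ω → M.Θ} {g : Ω → M.𝒳}
    (hf : Measurable f) (hg : Measurable g) : Measurable fun ω => M.G (f ω) (g ω) :=
  M.measurable_G.comp (hf.prodMk hg)

lemma measurable_L2norm_sub (D : ℕ) :
    Measurable fun θ : M.E D => M.L2norm (M.G (M.toΘ θ) - M.G M.θ₀) := by
  unfold L2norm
  simp_rw [eLpNorm_eq_lintegral_rpow_enorm_toReal (two_ne_zero) (ENNReal.ofNat_ne_top)]
  refine Measurable.pow_const ?_ _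
  refine Measurable.lintegral_prod_right' (ν := M.lam)
    (f := fun p : M.E D × M.𝒳 => ‖(M.G (M.toΘ p.1) - M.G M.θ₀) p.2‖ₑ ^ (2 : ℝ≥0∞).toReal) ?_
  refine Measurable.pow_const (Measurable.enorm ?_) _
  exact (M.measurable_G_comp ((M.measurable_toΘ D).comp measurable_fst) measurable_snd).sub
    ((M.measurable_G_apply M.θ₀).comp measurable_snd)

lemma measurableSet_localSet {nR : H → ℝ≥0∞} (hn : IsExtendedNorm nR) (r₁ : ℝ) (N : ℕ) (m : ℝ) :
    MeasurableSet (M.localSet nR r₁ N m) := by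
  refine MeasurableSet.inter ?_ ?_
  · exact measurableSet_le (M.measurable_L2norm_sub _) measurable_const
  · exact measurableSet_le (hn.comp_subtype (M.E (M.D N))).measurable measurable_const

lemma localSet_mono {nR : H → ℝ≥0∞} {r₁ : ℝ} {N : ℕ} {m m' : ℝ} (h : m ≤ m') :
    M.localSet nR r₁ N m ⊆ M.localSet nR r₁ N m' := fun _ hθ =>
  ⟨hθ.1.trans (ENNReal.ofReal_le_ofReal (by unfold rate; gcongr)),
    hθ.2.trans (ENNReal.ofReal_le_ofReal h)⟩

lemma rate_pos (ρ : ℝ) {N : ℕ} (hN : 1 ≤ N) : 0 < rate ρ N :=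
  Real.rpow_pos_of_pos (by exact_mod_cast hN) _

lemma tendsto_rate {ρ : ℝ} (hρ : 0 < ρ) : Tendsto (rate ρ) atTop (𝓝 0) :=
  (tendsto_rpow_neg_atTop hρ).comp tendsto_natCast_atTop_atTop

/-- `Θ_{N,m}` is stable under the perturbations `λᵀ h_N`, up to doubling `m`. -/
lemma eventually_add_shift_mem {nR : H → ℝ≥0∞} {r₁ : ℝ} (hn : IsExtendedNorm nR)
    {A : H →L[ℝ] Lp V 2 M.lam} (hinv : ∀ D : ℕ, (M.infoD A D).IsInvertible)
    (h1 : ∀ (v : EuclideanSpace ℝ (Fin k)) (m : ℝ), 0 < m →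
      Tendsto (fun N => (⨆ θ ∈ M.localSet nR r₁ N m,
          M.L2norm (M.G (M.toΘ (θ + M.shift A N v)) - M.G (M.toΘ θ))) /
        ENNReal.ofReal (rate r₁ N)) atTop (𝓝 0))
    (h2 : ∀ j, Tendsto (fun N : ℕ => nR (M.psiBar A (M.D N) j : H) / ENNReal.ofReal (Real.sqrt N))
      atTop (𝓝 0)) (v : EuclideanSpace ℝ (Fin k)) {m : ℝ} (hm : 0 < m) :
    ∀ᶠ N in atTop, ∀ θ ∈ M.localSet nR r₁ N m,
      θ + M.shift A N v ∈ M.localSet nR r₁ N (2 * m) := by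
  obtain ⟨c, hc, hcD⟩ := M.exists_norm_le_norm_proj_sum
  have hm' : 0 < ENNReal.ofReal m := ENNReal.ofReal_pos.2 hm
  -- the coefficients of `λᵀ h_N` in the vectors `ψ̄_D^j` are `O(N^{-1/2})`, which makes the
  -- perturbation small for the norm of `ℛ`
  have hR : Tendsto (fun N : ℕ => ∑ j : Fin k, ENNReal.ofReal (‖A‖ / c * ‖v‖) *
      (nR (M.psiBar A (M.D N) j : H) / ENNReal.ofReal (Real.sqrt N))) atTop (𝓝 0) := by
    have : Tendsto (fun N : ℕ => ∑ j : Fin k, ENNReal.ofReal (‖A‖ / c * ‖v‖) *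
      (nR (M.psiBar A (M.D N) j : H) / ENNReal.ofReal (Real.sqrt N))) atTop
      (𝓝 (∑ j : Fin k, ENNReal.ofReal (‖A‖ / c * ‖v‖) * 0)) :=
      tendsto_finsetSum _ fun j _ => ENNReal.Tendsto.const_mul (h2 j) (Or.inr ENNReal.ofReal_ne_top)
    simpa using this
  filter_upwards [(h1 v m hm).eventually (gt_mem_nhds hm'), hR.eventually (gt_mem_nhds hm'),
    M.tendsto_D.eventually hcD, eventually_ge_atTop 1] with N hN1 hN2 hND hN θ hθ
  have hrate : 0 < ENNReal.ofReal (rate r₁ N) := ENNReal.ofReal_pos.2 (rate_pos r₁ hN)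
  constructor
  · have h3 : M.L2norm (M.G (M.toΘ (θ + M.shift A N v)) - M.G (M.toΘ θ)) ≤
        ENNReal.ofReal (m * rate r₁ N) := by
      rw [ENNReal.ofReal_mul hm.le]
      refine le_trans ?_ ((ENNReal.div_le_iff hrate.ne' ENNReal.ofReal_ne_top).1 hN1.le)
      exact le_iSup₂ (f := fun θ (_ : θ ∈ M.localSet nR r₁ N m) =>
        M.L2norm (M.G (M.toΘ (θ + M.shift A N v)) - M.G (M.toΘ θ))) θ hθ
    have e : M.G (M.toΘ (θ + M.shift A N v)) - M.G M.θ₀ =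
        (M.G (M.toΘ (θ + M.shift A N v)) - M.G (M.toΘ θ)) + (M.G (M.toΘ θ) - M.G M.θ₀) := by abel
    rw [e]
    refine (eLpNorm_add_le ((M.memLp_G _).sub (M.memLp_G _)).aestronglyMeasurable
      ((M.memLp_G _).sub (M.memLp_G _)).aestronglyMeasurable (by norm_num)).trans ?_
    refine (add_le_add h3 hθ.1).trans ?_
    have := (rate_pos r₁ hN).le
    rw [← ENNReal.ofReal_add (by positivity) (by positivity)]
    exact ENNReal.ofReal_le_ofReal (by linarith)
  · have hs : nR (M.shift A N v : H) ≤ ENNReal.ofReal m := by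
      refine le_trans ?_ hN2.le
      have hsq : 0 < √(N : ℝ) := Real.sqrt_pos.2 (by exact_mod_cast hN)
      have e : (M.shift A N v : H) = ∑ j, ((√N)⁻¹ * M.sqrtMap A (M.D N) v j) •
          (M.psiBar A (M.D N) j : H) := by
        rw [M.shift_eq, dir]
        simp [Finset.smul_sum, smul_smul]
      rw [e]
      refine (hn.sum_le _ _ _).trans (Finset.sum_le_sum fun j _ => ?_)
      have h4 : ‖(√(N : ℝ))⁻¹ * M.sqrtMap A (M.D N) v j‖ₑ ≤
          ENNReal.ofReal (‖A‖ / c * ‖v‖) / ENNReal.ofReal (√N) := by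
        rw [← ENNReal.ofReal_div_of_pos hsq, ← ofReal_norm]
        refine ENNReal.ofReal_le_ofReal ?_
        rw [norm_mul, norm_inv, Real.norm_of_nonneg hsq.le, inv_mul_eq_div]
        gcongr
        exact (PiLp.norm_apply_le _ j).trans (M.norm_sqrtMap_le (hinv _) hc hND v)
      refine (mul_le_mul_left h4 _).trans (le_of_eq ?_)
      simp only [ENNReal.div_eq_inv_mul]
      ring
    refine (hn.add_le _ _).trans ((add_le_add hθ.2 hs).trans ?_)
    rw [← ENNReal.ofReal_add hm.le hm.le]
    exact ENNReal.ofReal_le_ofReal (by linarith)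

end Model

/-! ### Uniform approximation of the regression function -/

/-- A sequence that converges in `L²` and has summable increments in `L^∞` converges in `L^∞`. -/
lemma eLpNorm_top_sub_le_of_telescoping {α F : Type*} [MeasurableSpace α] {μ : Measure α}
    [NormedAddCommGroup F] {u : ℕ → α → F} {f : α → F}
    (hu : ∀ j, AEStronglyMeasurable (u j) μ) (hf : AEStronglyMeasurable f μ)
    (hlim : Tendsto (fun j => eLpNorm (u j - f) 2 μ) atTop (𝓝 0)) {K : ℝ} (hK : 0 ≤ K)
    (hstep : ∀ j, eLpNorm (u j - u (j + 1)) ∞ μ ≤ ENNReal.ofReal (K * (1 / 2) ^ j)) :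
    eLpNorm (u 0 - f) ∞ μ ≤ ENNReal.ofReal (2 * K) := by
  have hpart : ∀ j, eLpNorm (u 0 - u j) ∞ μ ≤
      ENNReal.ofReal (K * ∑ i ∈ Finset.range j, (1 / 2 : ℝ) ^ i) := by
    intro j
    induction j with
    | zero => simp
    | succ j ih =>
      have e : u 0 - u (j + 1) = (u 0 - u j) + (u j - u (j + 1)) := by abel
      rw [e]
      refine (eLpNorm_add_le ((hu _).sub (hu _)) ((hu _).sub (hu _)) le_top).trans
        ((add_le_add ih (hstep j)).trans ?_)
      rw [← ENNReal.ofReal_add (by positivity) (by positivity), Finset.sum_range_succ, mul_add]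
  obtain ⟨ns, -, hns⟩ := (tendstoInMeasure_of_tendsto_eLpNorm two_ne_zero hu hf
    hlim).exists_seq_tendsto_ae
  have hae : ∀ᵐ x ∂μ, Tendsto (fun n => (u 0 - u (ns n)) x) atTop (𝓝 ((u 0 - f) x)) := by
    filter_upwards [hns] with x hx
    exact hx.const_sub (u 0 x)
  refine (Lp.eLpNorm_lim_le_liminf_eLpNorm (fun n => (hu 0).sub (hu (ns n))) _ hae).trans ?_
  refine (Filter.liminf_le_liminf (Eventually.of_forall fun n => (hpart (ns n)).trans ?_)).trans
    (Filter.liminf_const _).le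
  rw [mul_comm 2 K]
  exact ENNReal.ofReal_le_ofReal (mul_le_mul_of_nonneg_left (sum_geometric_two_le _) hK)

namespace Model

variable {d k : ℕ} {H V : Type*}
  [NormedAddCommGroup H] [InnerProductSpace ℝ H] [CompleteSpace H]
  [MeasurableSpace H] [BorelSpace H]
  [NormedAddCommGroup V] [InnerProductSpace ℝ V] [FiniteDimensional ℝ V]
  [MeasurableSpace V] [BorelSpace V] {M : Model d k H V}

/-- A set of positive evidence is nonempty. -/
lemma PosteriorContraction.eventually_nonempty {nR : H → ℝ≥0∞} {r₁ r₂ M₀ a b c : ℝ}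
    (hcontr : M.PosteriorContraction nR r₁ r₂ M₀ a b c) :
    ∀ᶠ N in atTop, (M.localSet nR r₁ N M₀).Nonempty := by
  have h := (hcontr.contraction (fun _ => Set.univ) (fun _ => MeasurableSet.univ)
    (Eventually.of_forall fun N => by simp [Real.exp_nonneg])).2
  filter_upwards [h.eventually (lt_mem_nhds (zero_lt_one))] with N hN
  obtain ⟨ω, hω⟩ := nonempty_of_measure_ne_zero hN.ne'
  by_contra hne
  rw [Set.not_nonempty_iff_eq_empty] at hne
  simp only [hne, Set.inter_empty, Measure.restrict_empty, integral_zero_measure,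
    Set.mem_ofPred_eq] at hω
  exact absurd hω (Real.exp_pos _).le.not_gt

lemma mem_image_localSet {nR : H → ℝ≥0∞} {r₁ : ℝ} {N : ℕ} {m : ℝ} {t : M.Θ} :
    t ∈ M.toΘ '' M.localSet nR r₁ N m ↔ (t : H) ∈ M.E (M.D N) ∧
      M.L2norm (M.G t - M.G M.θ₀) ≤ ENNReal.ofReal (m * rate r₁ N) ∧
      nR t ≤ ENNReal.ofReal m := by
  constructor
  · rintro ⟨θ, hθ, rfl⟩
    exact ⟨θ.2, hθ.1, hθ.2⟩
  · rintro ⟨h0, h1, h2⟩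
    exact ⟨⟨t, h0⟩, ⟨h1, h2⟩, rfl⟩

/-- The entropy integral of a nonempty set grows at least linearly. -/
lemma le_entropy {nR : H → ℝ≥0∞} {r₁ : ℝ} {dΘ : MetricSpace M.Θ} {N : ℕ} {m : ℝ} {B t : ℝ}
    (hne : (M.localSet nR r₁ N m).Nonempty) (ht : 0 < t)
    (h : ∫⁻ ε in Set.Ioc 0 t, sqrtLogTwo (M.covNum dΘ ε.toNNReal
      (M.toΘ '' M.localSet nR r₁ N m)) ≤ ENNReal.ofReal B) : √(Real.log 2) * t ≤ B := by
  have h1 : ∀ ε : ℝ, ENNReal.ofReal √(Real.log 2) ≤ sqrtLogTwo (M.covNum dΘ ε.toNNReal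
      (M.toΘ '' M.localSet nR r₁ N m)) := by
    intro ε
    have h2 : (1 : ℕ∞) ≤ M.covNum dΘ ε.toNNReal (M.toΘ '' M.localSet nR r₁ N m) := by
      rw [Order.one_le_iff_pos]
      exact (@Metric.externalCoveringNumber_pos_iff M.Θ
        dΘ.toPseudoMetricSpace.toPseudoEMetricSpace _ _).2 (hne.image _)
    refine le_trans (le_of_eq ?_) (sqrtLogTwo_mono h2)
    have : sqrtLogTwo ((1 : ℕ) : ℕ∞) = ENNReal.ofReal √(Real.log (2 * (1 : ℕ))) := rfl
    rw [Nat.cast_one] at this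
    rw [this]; simp
  have h3 : ENNReal.ofReal (√(Real.log 2) * t) ≤ ENNReal.ofReal B := by
    refine le_trans ?_ h
    refine le_trans (le_of_eq ?_) (lintegral_mono fun ε => h1 ε)
    rw [lintegral_const, ENNReal.ofReal_mul (Real.sqrt_nonneg _)]
    simp
  have hpos : 0 < √(Real.log 2) * t :=
    mul_pos (Real.sqrt_pos.2 (Real.log_pos (by norm_num))) ht
  exact (ENNReal.ofReal_le_ofReal_iff' .. |>.1 h3).resolve_right (by linarith)

/-- The local sets are of diameter `O(N^{-1/4})` in `L^∞`. As the entropy integral grows at least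
linearly, `g_N δ_N` is at most a multiple of `(g_N² δ_N J_N(δ_N))^{1/2}`. -/
lemma eventually_LinftyNorm_sub_le {nR : H → ℝ≥0∞} {r₁ m : ℝ} (hm : 0 < m)
    {A : H →L[ℝ] Lp V 2 M.lam} {dΘ : MetricSpace M.Θ} {δΘ σ g r : ℕ → ℝ} {J : ℕ → ℝ → ℝ}
    (hent : M.EntropyBounds nR r₁ A dΘ δΘ σ g r J)
    (h5 : Tendsto (fun N : ℕ => Real.sqrt N * g N ^ 2 * δΘ N * J N (δΘ N)) atTop (𝓝 0)) :
    ∃ K : ℝ, 0 < K ∧ ∀ᶠ N in atTop, ∀ t ∈ M.toΘ '' M.localSet nR r₁ N m,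
      ∀ t' ∈ M.toΘ '' M.localSet nR r₁ N m,
        M.LinftyNorm (M.G t - M.G t') ≤ ENNReal.ofReal (K * (N : ℝ) ^ (-(1 / 4) : ℝ)) := by
  obtain ⟨C, hC, hb⟩ := hent.bounds m hm
  have hl2 : 0 < √(Real.log 2) := Real.sqrt_pos.2 (Real.log_pos (by norm_num))
  refine ⟨2 * C ^ 2 * √(C / √(Real.log 2)), by positivity, ?_⟩
  filter_upwards [h5.eventually (gt_mem_nhds zero_lt_one), eventually_ge_atTop 1] with N h5N hN
  rintro _ ⟨θ, hθ, rfl⟩ _ ⟨θ', hθ', rfl⟩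
  obtain ⟨b1, -, b3, -, b5⟩ := hb N hN
  obtain ⟨hδ, -, hg, -⟩ := hent.pos N hN
  have hNpos : (0 : ℝ) < N := by exact_mod_cast hN
  have hJ := le_entropy ⟨θ, hθ⟩ hδ (b5 (δΘ N) hδ.le)
  refine (b3 θ hθ θ' hθ').trans (ENNReal.ofReal_le_ofReal ?_)
  have hd : dΘ.dist (M.toΘ θ) (M.toΘ θ') ≤ 2 * C * δΘ N := by
    have h1 := dΘ.dist_triangle (M.toΘ θ) M.θ₀ (M.toΘ θ')
    have h2 := b1 θ hθ
    have h3 := b1 θ' hθ'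
    have h4 := dΘ.dist_comm M.θ₀ (M.toΘ θ')
    linarith
  have hsq : (g N * δΘ N) ^ 2 ≤ (√(C / √(Real.log 2)) * (N : ℝ) ^ (-(1 / 4) : ℝ)) ^ 2 := by
    have e1 : ((N : ℝ) ^ (-(1 / 4) : ℝ)) ^ 2 = (√(N : ℝ))⁻¹ := by
      rw [← Real.rpow_natCast, ← Real.rpow_mul hNpos.le, Real.sqrt_eq_rpow, ← Real.rpow_neg hNpos.le]
      norm_num
    rw [mul_pow √(C / _), Real.sq_sqrt (by positivity), e1]
    have hsN : 0 < √(N : ℝ) := Real.sqrt_pos.2 hNpos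
    rw [← div_eq_mul_inv, le_div_iff₀ hsN, le_div_iff₀ hl2]
    have h6 : √(N : ℝ) * g N ^ 2 * δΘ N * (√(Real.log 2) * δΘ N) ≤
        √(N : ℝ) * g N ^ 2 * δΘ N * (C * J N (δΘ N)) := by gcongr
    nlinarith
  have h7 := le_of_sq_le_sq hsq (by positivity)
  calc C * g N * dΘ.dist (M.toΘ θ) (M.toΘ θ') ≤ C * g N * (2 * C * δΘ N) := by gcongr
    _ = 2 * C ^ 2 * (g N * δΘ N) := by ring
    _ ≤ 2 * C ^ 2 * (√(C / √(Real.log 2)) * (N : ℝ) ^ (-(1 / 4) : ℝ)) := by gcongr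
    _ = _ := by ring

/-- Elements of the local sets approximate the true regression function uniformly. As the truth
need not belong to the approximation spaces, this follows by telescoping along the sample sizes
`16 ^ j * N`: consecutive elements belong to a common local set. -/
lemma tendsto_LinftyNorm_sub_truth {nR : H → ℝ≥0∞} {r₁ M₀ : ℝ} (hr₁ : r₁ ∈ Set.Ioo (0 : ℝ) (1 / 2))
    (hM₀ : 0 < M₀)
    {A : H →L[ℝ] Lp V 2 M.lam} {dΘ : MetricSpace M.Θ} {δΘ σ g r : ℕ → ℝ} {J : ℕ → ℝ → ℝ}
    (hent : M.EntropyBounds nR r₁ A dΘ δΘ σ g r J)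
    (h5 : Tendsto (fun N : ℕ => Real.sqrt N * g N ^ 2 * δΘ N * J N (δΘ N)) atTop (𝓝 0))
    {t : ℕ → M.Θ} (ht : ∀ᶠ N in atTop, t N ∈ M.toΘ '' M.localSet nR r₁ N M₀) :
    Tendsto (fun N => M.LinftyNorm (M.G (t N) - M.G M.θ₀)) atTop (𝓝 0) := by
  obtain ⟨K, hK, hdiam⟩ := eventually_LinftyNorm_sub_le (M := M) (m := 4 * M₀) (by linarith) hent h5
  have hK0 : Tendsto (fun N : ℕ => ENNReal.ofReal (2 * (K * (N : ℝ) ^ (-(1 / 4) : ℝ)))) atTop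
      (𝓝 0) := by
    have h1 : Tendsto (fun N : ℕ => 2 * (K * (N : ℝ) ^ (-(1 / 4) : ℝ))) atTop (𝓝 0) := by
      have := ((tendsto_rate (ρ := 1 / 4) (by norm_num)).const_mul K).const_mul 2
      simpa [rate] using this
    simpa using ENNReal.tendsto_ofReal h1
  refine tendsto_of_tendsto_of_tendsto_of_le_of_le' tendsto_const_nhds hK0
    (Eventually.of_forall fun _ => zero_le) ?_
  obtain ⟨N₀, hN₀⟩ := eventually_atTop.1 (ht.and hdiam)
  filter_upwards [eventually_ge_atTop N₀, eventually_ge_atTop 1] with N hN hN1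
  have hNpos : (0 : ℝ) < N := by exact_mod_cast hN1
  have hge : ∀ j, N ≤ 16 ^ j * N := fun j => Nat.le_mul_of_pos_left N (by positivity)
  have hge1 : ∀ j, 1 ≤ 16 ^ j * N := fun j => hN1.trans (hge j)
  have hj : ∀ j, t (16 ^ j * N) ∈ M.toΘ '' M.localSet nR r₁ (16 ^ j * N) M₀ :=
    fun j => (hN₀ _ (hN.trans (hge j))).1
  have e0 : M.LinftyNorm (M.G (t N) - M.G M.θ₀) =
      eLpNorm ((fun j => M.G (t (16 ^ j * N))) 0 - M.G M.θ₀) ∞ M.lam := by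
    simp [LinftyNorm]
  rw [e0]
  refine eLpNorm_top_sub_le_of_telescoping (u := fun j => M.G (t (16 ^ j * N)))
    (fun j => (M.memLp_G _).aestronglyMeasurable) (M.memLp_G _).aestronglyMeasurable ?_
    (by positivity) (fun j => ?_)
  · -- convergence in `L²`
    have h1 : Tendsto (fun j : ℕ => ENNReal.ofReal (M₀ * rate r₁ (16 ^ j * N))) atTop (𝓝 0) := by
      have h2 : Tendsto (fun j : ℕ => 16 ^ j * N) atTop atTop :=
        (tendsto_pow_atTop_atTop_of_one_lt (by norm_num : 1 < 16)).atTop_mul_const' hN1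
      have h3 := ((tendsto_rate hr₁.1).comp h2).const_mul M₀
      rw [mul_zero] at h3
      simpa using ENNReal.tendsto_ofReal h3
    exact tendsto_of_tendsto_of_tendsto_of_le_of_le tendsto_const_nhds h1 (fun _ => zero_le)
      fun j => (mem_image_localSet.1 (hj j)).2.1
  · -- consecutive elements are in a common local set
    set p := 16 ^ j * N with hp
    have hq : 16 ^ (j + 1) * N = 16 * p := by rw [hp]; ring
    have hj0 := mem_image_localSet.1 (hj j)
    have hj1 := mem_image_localSet.1 (hj (j + 1))
    rw [hq] at hj1
    simp only [hq]
    have hp1 : 1 ≤ p := hge1 j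
    have hppos : (0 : ℝ) < p := by exact_mod_cast hp1
    have hgoal : K * (1 / 2 : ℝ) ^ j * (N : ℝ) ^ (-(1 / 4) : ℝ) = K * (p : ℝ) ^ (-(1 / 4) : ℝ) := by
      rw [hp]
      push_cast
      rw [Real.mul_rpow (by positivity) hNpos.le, mul_assoc]
      congr 2
      rw [← Real.rpow_natCast 16 j, ← Real.rpow_mul (by norm_num), mul_comm (j : ℝ),
        Real.rpow_mul (by norm_num), Real.rpow_natCast]
      congr 1
      rw [show (16 : ℝ) = 2 ^ (4 : ℝ) by norm_num, ← Real.rpow_mul (by norm_num)]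
      norm_num [Real.rpow_neg]
    have hgoal' : K * (N : ℝ) ^ (-(1 / 4) : ℝ) * (1 / 2 : ℝ) ^ j = K * (p : ℝ) ^ (-(1 / 4) : ℝ) := by
      rw [← hgoal]; ring
    rw [hgoal']
    -- the dimension need not be monotone in the sample size: of two consecutive approximation
    -- spaces the larger one contains both parameters
    rcases le_total (M.D p) (M.D (16 * p)) with hD | hD
    · have hle : (4 * M₀) * rate r₁ (16 * p) ≥ M₀ * rate r₁ p := by
        have e : rate r₁ (16 * p) = (16 : ℝ) ^ (-r₁) * rate r₁ p := by
          unfold rate; push_cast; rw [Real.mul_rpow (by norm_num) hppos.le]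
        have h16 : (16 : ℝ) ^ (-(1 / 2) : ℝ) ≤ (16 : ℝ) ^ (-r₁) :=
          Real.rpow_le_rpow_of_exponent_le (by norm_num) (by linarith [hr₁.2])
        have h4 : (16 : ℝ) ^ (-(1 / 2) : ℝ) = 1 / 4 := by
          rw [show (16 : ℝ) = 4 ^ (2 : ℝ) by norm_num, ← Real.rpow_mul (by norm_num)]
          norm_num [Real.rpow_neg]
        rw [e]
        rw [h4] at h16
        have := rate_pos r₁ hp1
        have := mul_pos hM₀ this
        nlinarith
      refine ((hN₀ (16 * p) (by have := hge j; omega)).2 (t p) ?_ (t (16 * p)) ?_).trans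
        (ENNReal.ofReal_le_ofReal ?_)
      · exact mem_image_localSet.2 ⟨M.E_mono hD hj0.1,
          hj0.2.1.trans (ENNReal.ofReal_le_ofReal hle),
          hj0.2.2.trans (ENNReal.ofReal_le_ofReal (by linarith))⟩
      · exact Set.image_mono (M.localSet_mono (by linarith)) (mem_image_localSet.2 hj1)
      · push_cast
        exact mul_le_mul_of_nonneg_left (Real.rpow_le_rpow_of_nonpos hppos (by linarith)
          (by norm_num)) hK.le
    · refine (hN₀ p (hN.trans (hge j))).2 (t p) ?_ (t (16 * p)) ?_
      · exact Set.image_mono (M.localSet_mono (by linarith)) (mem_image_localSet.2 hj0)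
      · refine Set.image_mono (M.localSet_mono (by linarith)) (mem_image_localSet.2
          ⟨M.E_mono hD hj1.1, hj1.2.1.trans (ENNReal.ofReal_le_ofReal ?_), hj1.2.2⟩)
        unfold rate
        push_cast
        exact mul_le_mul_of_nonneg_left (Real.rpow_le_rpow_of_nonpos hppos (by linarith)
          (by linarith [hr₁.1])) hM₀.le

/-! ### Remainder terms of the likelihood expansion -/

section Ambient

variable {d k : ℕ} {H V : Type*}
  [NormedAddCommGroup H] [InnerProductSpace ℝ H] [CompleteSpace H]
  [MeasurableSpace H] [BorelSpace H]
  [NormedAddCommGroup V] [InnerProductSpace ℝ V] [FiniteDimensional ℝ V]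
  [MeasurableSpace V] [BorelSpace V] {M : Model d k H V} {A : H →L[ℝ] Lp V 2 M.lam}

lemma measurable_coe_Lp (f : Lp V 2 M.lam) : Measurable (f : M.𝒳 → V) :=
  (Lp.stronglyMeasurable f).measurable

lemma measurable_linErr (θ : M.Θ) : Measurable (M.linErr A θ) :=
  ((M.measurable_G_apply θ).sub (M.measurable_G_apply M.θ₀)).sub (measurable_coe_Lp _)

lemma memLp_linErr (θ : M.Θ) : MemLp (M.linErr A θ) 2 M.lam :=
  ((M.memLp_G θ).sub (M.memLp_G M.θ₀)).sub (Lp.memLp _)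

lemma integrable_inner_of_memLp {f g : M.𝒳 → V} (hf : MemLp f 2 M.lam) (hg : MemLp g 2 M.lam) :
    Integrable (fun x => ⟪f x, g x⟫) M.lam := by
  refine (L2.integrable_inner (𝕜 := ℝ) (hf.toLp f) (hg.toLp g)).congr ?_
  filter_upwards [hf.coeFn_toLp, hg.coeFn_toLp] with x h1 h2
  rw [h1, h2]

lemma inner_toLp_eq_integral {f g : M.𝒳 → V} (hf : MemLp f 2 M.lam) (hg : MemLp g 2 M.lam) :
    ⟪hf.toLp f, hg.toLp g⟫ = ∫ x, ⟪f x, g x⟫ ∂M.lam := by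
  rw [L2.inner_def]
  refine integral_congr_ae ?_
  filter_upwards [hf.coeFn_toLp, hg.coeFn_toLp] with x h1 h2
  rw [h1, h2]

lemma ae_norm_le_of_LinftyNorm_le {f : M.𝒳 → V} {B : ℝ} (hB : 0 ≤ B)
    (h : M.LinftyNorm f ≤ ENNReal.ofReal B) : ∀ᵐ x ∂M.lam, ‖f x‖ ≤ B := by
  rw [LinftyNorm, eLpNorm_exponent_top] at h
  filter_upwards [enorm_ae_le_eLpNormEssSup f M.lam] with x hx
  have := hx.trans h
  rw [← ofReal_norm] at this
  exact (ENNReal.ofReal_le_ofReal_iff hB).1 this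

lemma integral_norm_sq_le_of_L2norm_le {f : M.𝒳 → V} (hf : MemLp f 2 M.lam) {B : ℝ} (hB : 0 ≤ B)
    (h : M.L2norm f ≤ ENNReal.ofReal B) : ∫ x, ‖f x‖ ^ 2 ∂M.lam ≤ B ^ 2 := by
  have h1 : ‖hf.toLp f‖ ^ 2 = ∫ x, ‖f x‖ ^ 2 ∂M.lam := by
    rw [← real_inner_self_eq_norm_sq, inner_toLp_eq_integral]
    simp_rw [real_inner_self_eq_norm_sq]
  rw [← h1, Lp.norm_toLp]
  exact pow_le_pow_left₀ ENNReal.toReal_nonneg (ENNReal.toReal_le_of_le_ofReal hB h) 2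

variable {nR : H → ℝ≥0∞} {r₁ : ℝ} {dΘ : MetricSpace M.Θ} {δΘ σ g r : ℕ → ℝ} {J : ℕ → ℝ → ℝ}

lemma dist_le_of_mem_image {N : ℕ} {m C : ℝ}
    (hd : ∀ θ ∈ M.localSet nR r₁ N m, dΘ.dist (M.toΘ θ) M.θ₀ ≤ C * δΘ N) {t t' : M.Θ}
    (ht : t ∈ M.toΘ '' M.localSet nR r₁ N m) (ht' : t' ∈ M.toΘ '' M.localSet nR r₁ N m) :
    dΘ.dist t t' ≤ 2 * C * δΘ N := by
  obtain ⟨θ, hθ, rfl⟩ := ht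
  obtain ⟨θ', hθ', rfl⟩ := ht'
  have h1 := dΘ.dist_triangle (M.toΘ θ) M.θ₀ (M.toΘ θ')
  have h2 := hd θ hθ
  have h3 := hd θ' hθ'
  have h4 := dΘ.dist_comm M.θ₀ (M.toΘ θ')
  linarith

/-- The multiplier process of the linearization errors is uniformly small on a local set. Chaining
starts at the distance `σ_N / r_N`, at which the Lipschitz bound of the increments reaches the `L²`
bound `σ_N` of single errors; the latter enters through a Bernstein inequality. -/
lemma exists_bound_mulProc {m : ℝ} (hm : 0 < m) (hent : M.EntropyBounds nR r₁ A dΘ δΘ σ g r J)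
    (h3 : Tendsto (fun N : ℕ => Real.sqrt N * r N * J N (σ N / r N)) atTop (𝓝 0))
    (h4 : Tendsto (fun N : ℕ => Real.sqrt (Real.log N) * r N ^ 3 * δΘ N *
      J N (σ N / r N) ^ 2 / σ N ^ 2) atTop (𝓝 0))
    {t₁ : ℕ → M.Θ} (ht₁ : ∀ᶠ N in atTop, t₁ N ∈ M.toΘ '' M.localSet nR r₁ N m)
    (hζ : ∀ᶠ N in atTop, ∀ᵐ x ∂M.lam, ‖M.G (t₁ N) x - M.G M.θ₀ x‖ ≤ 1) :
    ∃ ρ : ℕ → ℝ, Tendsto ρ atTop (𝓝 0) ∧ ∀ᶠ N in atTop, ∃ W : (ℕ → M.𝒳 × V) → ℝ≥0∞,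
      Measurable W ∧ ∫⁻ ω, W ω ∂M.P ≤ ENNReal.ofReal (ρ N) ∧
      ∀ t ∈ M.toΘ '' M.localSet nR r₁ N m, ∀ᵐ ω ∂M.P, ENNReal.ofReal
        |M.mulProc N (fun x => M.G (t₁ N) x - M.G M.θ₀ x)
          (fun x => M.linErr A t x - M.linErr A (t₁ N) x) ω| ≤ W ω := by
  obtain ⟨C, hC, hb⟩ := hent.bounds m hm
  refine ⟨fun N => 160 * C ^ 2 * (Real.sqrt N * r N * J N (σ N / r N)) +
    256 * C ^ 4 * (Real.sqrt (Real.log N) * r N ^ 3 * δΘ N * J N (σ N / r N) ^ 2 / σ N ^ 2),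
    by simpa using (h3.const_mul (160 * C ^ 2)).add (h4.const_mul (256 * C ^ 4)), ?_⟩
  filter_upwards [ht₁, hζ, eventually_ge_atTop 3] with N ht hζN hN3
  have hN : 1 ≤ N := by omega
  obtain ⟨b1, b2, -, b4, b5⟩ := hb N hN
  obtain ⟨hδ, hσ, -, hr⟩ := hent.pos N hN
  have hNpos : (0 : ℝ) < N := by exact_mod_cast hN
  have hsN : 0 < √(N : ℝ) := Real.sqrt_pos.2 hNpos
  set S := M.toΘ '' M.localSet nR r₁ N m with hS
  set ζ : M.𝒳 → V := fun x => M.G (t₁ N) x - M.G M.θ₀ x with hζdef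
  have hζm : Measurable ζ := (M.measurable_G_apply _).sub (M.measurable_G_apply _)
  have hζL : MemLp ζ 2 M.lam := (M.memLp_G _).sub (M.memLp_G _)
  let f : M.Θ → M.𝒳 → V := fun t x => M.linErr A t x - M.linErr A (t₁ N) x
  have hfm : ∀ t, Measurable (f t) := fun t => (measurable_linErr t).sub (measurable_linErr _)
  have hfL : ∀ t, MemLp (f t) 2 M.lam := fun t => (memLp_linErr t).sub (memLp_linErr _)
  have hdiff : ∀ t t' ω, M.mulProc N ζ (f t) ω - M.mulProc N ζ (f t') ω =
      M.mulProc N ζ (fun x => M.linErr A t x - M.linErr A t' x) ω := by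
    intro t t' ω
    rw [M.mulProc_sub N (integrable_inner_of_memLp (hfL t) hζL)
      (integrable_inner_of_memLp (hfL t') hζL)]
    congr 1
    funext x
    simp [f]
  have hsup : ∀ t ∈ S, ∀ t' ∈ S, ∀ δ, 0 ≤ δ → dΘ.dist t t' ≤ δ →
      ∀ᵐ x ∂M.lam, ‖M.linErr A t x - M.linErr A t' x‖ ≤ C * r N * δ := by
    rintro _ ⟨θ, hθ, rfl⟩ _ ⟨θ', hθ', rfl⟩ δ hδ0 hd
    refine ae_norm_le_of_LinftyNorm_le (by positivity) ((b4 θ hθ θ' hθ').trans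
      (ENNReal.ofReal_le_ofReal ?_))
    gcongr
  have hL2 : ∀ t ∈ S, ∫ x, ‖f t x‖ ^ 2 ∂M.lam ≤ (2 * C * σ N) ^ 2 := by
    intro t htS
    refine integral_norm_sq_le_of_L2norm_le (hfL t) (by positivity) ?_
    have h1 : ∀ s ∈ S, M.L2norm (M.linErr A s) ≤ ENNReal.ofReal (C * σ N) := by
      rintro _ ⟨θ, hθ, rfl⟩
      exact b2 θ hθ
    refine (eLpNorm_sub_le (memLp_linErr _).aestronglyMeasurable
      (memLp_linErr _).aestronglyMeasurable (by norm_num)).trans ?_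
    refine (add_le_add (h1 t htS) (h1 _ ht)).trans ?_
    rw [← ENNReal.ofReal_add (by positivity) (by positivity)]
    exact ENNReal.ofReal_le_ofReal (by linarith)
  obtain ⟨W, hWm, hWi, hW⟩ := @exists_chaining_bound _ _ M.P _ M.Θ dΘ.toPseudoMetricSpace S
    ⟨_, ht⟩ (fun t => M.mulProc N ζ (f t)) (fun t _ => M.measurable_mulProc N hζm (hfm t))
    (√N * (C * r N)) (2 * √N * (2 * C * σ N)) (4 * (C * r N * (2 * C * δΘ N))) (σ N / r N)
    (C * J N (σ N / r N)) (by positivity) (by positivity) (by positivity) (by positivity)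
    (fun t htS t' htS' δ hδ0 hd τ => by
      simp_rw [hdiff]
      refine (M.lintegral_exp_mulProc_le N hζm ((measurable_linErr t).sub (measurable_linErr t'))
        hζN (by positivity) (hsup t htS t' htS' δ hδ0.le hd) τ).trans (le_of_eq ?_)
      ring_nf)
    (fun t htS τ hτ => M.lintegral_exp_mulProc_le_of_sq N hζm (hfm t) hζN
      (hsup t htS _ ht _ (by positivity) (dist_le_of_mem_image b1 htS ht)) (hL2 t htS) hτ)
    (fun ω => (∑ i ∈ Finset.range N, (‖M.noise ω i‖ + 2)) * (C * r N))
    (fun t htS t' htS' => by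
      have hnn : 0 ≤ dΘ.dist t t' := @dist_nonneg _ dΘ.toPseudoMetricSpace _ _
      filter_upwards [M.ae_abs_mulProc_le N hζN (by positivity)
        (hsup t htS t' htS' _ hnn le_rfl)] with ω hω
      rw [hdiff, mul_assoc]
      exact hω)
    (b5 _ (by positivity))
  refine ⟨W, hWm, hWi.trans (ENNReal.ofReal_le_ofReal ?_), hW⟩
  have hlog : 1 ≤ √(Real.log N) := by
    rw [Real.one_le_sqrt, Real.le_log_iff_exp_le hNpos]
    refine Real.exp_one_lt_d9.le.trans ?_
    have : (3 : ℝ) ≤ N := by exact_mod_cast hN3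
    linarith
  have hX : 0 ≤ r N ^ 3 * δΘ N * J N (σ N / r N) ^ 2 / σ N ^ 2 := by positivity
  have e : 32 * (√N * (C * r N) * (C * J N (σ N / r N)) +
      2 * √N * (2 * C * σ N) * (C * J N (σ N / r N) / (σ N / r N)) +
      4 * (C * r N * (2 * C * δΘ N)) * (C * J N (σ N / r N) / (σ N / r N)) ^ 2) =
      160 * C ^ 2 * (√N * r N * J N (σ N / r N)) +
      256 * C ^ 4 * (r N ^ 3 * δΘ N * J N (σ N / r N) ^ 2 / σ N ^ 2) := by
    field_simp
    ring
  rw [e]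
  have h5 : r N ^ 3 * δΘ N * J N (σ N / r N) ^ 2 / σ N ^ 2 ≤
      √(Real.log N) * r N ^ 3 * δΘ N * J N (σ N / r N) ^ 2 / σ N ^ 2 := by
    have := le_mul_of_one_le_left hX hlog
    calc _ ≤ _ := this
      _ = _ := by ring
  gcongr

/-- The empirical process of the squared distances to a reference point is uniformly small on a
local set. -/
lemma exists_bound_empProc {m : ℝ} (hm : 0 < m) (hent : M.EntropyBounds nR r₁ A dΘ δΘ σ g r J)
    (h5 : Tendsto (fun N : ℕ => Real.sqrt N * g N ^ 2 * δΘ N * J N (δΘ N)) atTop (𝓝 0))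
    {t₁ : ℕ → M.Θ} (ht₁ : ∀ᶠ N in atTop, t₁ N ∈ M.toΘ '' M.localSet nR r₁ N m) :
    ∃ ρ : ℕ → ℝ, Tendsto ρ atTop (𝓝 0) ∧ ∀ᶠ N in atTop, ∃ W : (ℕ → M.𝒳 × V) → ℝ≥0∞,
      Measurable W ∧ ∫⁻ ω, W ω ∂M.P ≤ ENNReal.ofReal (ρ N) ∧
      ∀ t ∈ M.toΘ '' M.localSet nR r₁ N m, ∀ᵐ ω ∂M.P, ENNReal.ofReal
        |M.empProc N (fun x => ‖M.G t x - M.G (t₁ N) x‖ ^ 2) ω| ≤ W ω := by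
  obtain ⟨C, hC, hb⟩ := hent.bounds m hm
  refine ⟨fun N => 32 * (4 * C ^ 4 + 4 * C ^ 5) * (Real.sqrt N * g N ^ 2 * δΘ N * J N (δΘ N)),
    by simpa using h5.const_mul (32 * (4 * C ^ 4 + 4 * C ^ 5)), ?_⟩
  filter_upwards [ht₁, eventually_ge_atTop 1] with N ht hN
  obtain ⟨b1, -, b3, -, b5⟩ := hb N hN
  obtain ⟨hδ, -, hg, -⟩ := hent.pos N hN
  have hNpos : (0 : ℝ) < N := by exact_mod_cast hN
  have hsN : 0 < √(N : ℝ) := Real.sqrt_pos.2 hNpos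
  set S := M.toΘ '' M.localSet nR r₁ N m with hS
  let φ : M.Θ → M.𝒳 → ℝ := fun t x => ‖M.G t x - M.G (t₁ N) x‖ ^ 2
  have hφm : ∀ t, Measurable (φ t) := fun t =>
    ((M.measurable_G_apply t).sub (M.measurable_G_apply _)).norm.pow_const 2
  have hφi : ∀ t, Integrable (φ t) M.lam := fun t => by
    refine (integrable_inner_of_memLp ((M.memLp_G t).sub (M.memLp_G (t₁ N)))
      ((M.memLp_G t).sub (M.memLp_G (t₁ N)))).congr (ae_of_all _ fun x => ?_)
    exact real_inner_self_eq_norm_sq _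
  have hsup : ∀ t ∈ S, ∀ t' ∈ S, ∀ δ, 0 ≤ δ → dΘ.dist t t' ≤ δ →
      ∀ᵐ x ∂M.lam, ‖M.G t x - M.G t' x‖ ≤ C * g N * δ := by
    rintro _ ⟨θ, hθ, rfl⟩ _ ⟨θ', hθ', rfl⟩ δ hδ0 hd
    refine ae_norm_le_of_LinftyNorm_le (by positivity) ((b3 θ hθ θ' hθ').trans
      (ENNReal.ofReal_le_ofReal ?_))
    gcongr
  have hrad : ∀ t ∈ S, ∀ᵐ x ∂M.lam, ‖M.G t x - M.G (t₁ N) x‖ ≤ C * g N * (2 * C * δΘ N) :=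
    fun t htS => hsup t htS _ ht _ (by positivity) (dist_le_of_mem_image b1 htS ht)
  have hinc : ∀ t ∈ S, ∀ t' ∈ S, ∀ δ, 0 ≤ δ → dΘ.dist t t' ≤ δ →
      ∀ᵐ x ∂M.lam, |φ t x - φ t' x| ≤ 4 * C ^ 3 * g N ^ 2 * δΘ N * δ := by
    intro t htS t' htS' δ hδ0 hd
    filter_upwards [hsup t htS t' htS' δ hδ0 hd, hrad t htS, hrad t' htS'] with x h1 h2 h3
    have e : φ t x - φ t' x = (‖M.G t x - M.G (t₁ N) x‖ - ‖M.G t' x - M.G (t₁ N) x‖) *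
        (‖M.G t x - M.G (t₁ N) x‖ + ‖M.G t' x - M.G (t₁ N) x‖) := by simp only [φ]; ring
    rw [e, abs_mul]
    have h4 : |‖M.G t x - M.G (t₁ N) x‖ - ‖M.G t' x - M.G (t₁ N) x‖| ≤ C * g N * δ := by
      refine (abs_norm_sub_norm_le _ _).trans ?_
      rw [sub_sub_sub_cancel_right]
      exact h1
    rw [abs_of_nonneg (by positivity : 0 ≤ ‖M.G t x - M.G (t₁ N) x‖ + ‖M.G t' x - M.G (t₁ N) x‖)]
    calc _ ≤ (C * g N * δ) * (C * g N * (2 * C * δΘ N) + C * g N * (2 * C * δΘ N)) := by gcongr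
      _ = _ := by ring
  have hdiff : ∀ t t' ω, M.empProc N (φ t) ω - M.empProc N (φ t') ω =
      M.empProc N (fun x => φ t x - φ t' x) ω := fun t t' ω => M.empProc_sub N (hφi t) (hφi t') ω
  obtain ⟨W, hWm, hWi, hW⟩ := @exists_chaining_bound _ _ M.P _ M.Θ dΘ.toPseudoMetricSpace S
    ⟨_, ht⟩ (fun t => M.empProc N (φ t)) (fun t _ => M.measurable_empProc N (hφm t))
    (√N * (4 * C ^ 3 * g N ^ 2 * δΘ N)) (√N * (C * g N * (2 * C * δΘ N)) ^ 2) 0 (δΘ N)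
    (C * J N (δΘ N)) (by positivity) (by positivity) le_rfl hδ
    (fun t htS t' htS' δ hδ0 hd τ => by
      simp_rw [hdiff]
      refine (M.lintegral_exp_empProc_le N ((hφm t).sub (hφm t')) (by positivity)
        (hinc t htS t' htS' δ hδ0.le hd) τ).trans (le_of_eq ?_)
      ring_nf)
    (fun t htS τ _ => M.lintegral_exp_empProc_le N (hφm t) (by positivity) (by
      filter_upwards [hrad t htS] with x hx
      simp only [φ]
      rw [abs_of_nonneg (by positivity)]
      gcongr) τ)
    (fun _ => (2 * N) * (4 * C ^ 3 * g N ^ 2 * δΘ N))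
    (fun t htS t' htS' => by
      have hnn : 0 ≤ dΘ.dist t t' := @dist_nonneg _ dΘ.toPseudoMetricSpace _ _
      filter_upwards [M.ae_abs_empProc_le N (hinc t htS t' htS' _ hnn le_rfl)] with ω hω
      rw [hdiff, mul_assoc]
      exact hω)
    (b5 _ hδ.le)
  refine ⟨W, hWm, hWi.trans (ENNReal.ofReal_le_ofReal (le_of_eq ?_)), hW⟩
  field_simp
  ring

/-- The second moment of the centered empirical process indexed by a product of a bounded and a
square integrable function. -/
lemma lintegral_sq_empProc_le (N : ℕ) {ζ f : M.𝒳 → V} (hζ : Measurable ζ) (hf : MemLp f 2 M.lam)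
    (hfm : Measurable f) {B : ℝ} (hζB : ∀ᵐ x ∂M.lam, ‖ζ x‖ ≤ B) :
    ∫⁻ ω, ENNReal.ofReal ((M.empProc N (fun x => ⟪ζ x, f x⟫) ω) ^ 2) ∂M.P ≤
      ENNReal.ofReal (N * (B ^ 2 * ∫ x, ‖f x‖ ^ 2 ∂M.lam)) := by
  set φ : M.𝒳 → ℝ := fun x => ⟪ζ x, f x⟫ with hφ
  have hφm : Measurable φ := by fun_prop
  have hφb : ∀ᵐ x ∂M.lam, ‖φ x‖ ≤ B * ‖f x‖ := by
    filter_upwards [hζB] with x hx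
    exact (abs_real_inner_le_norm _ _).trans (by gcongr)
  have hφL : MemLp φ 2 M.lam := hf.of_le_mul hφm.aestronglyMeasurable hφb
  have hfst : MeasurePreserving (Prod.fst : M.𝒳 × V → M.𝒳) M.obsLaw M.lam := by
    refine ⟨measurable_fst, ?_⟩
    have h1 : M.P.map (fun ω => ω 0) = M.obsLaw :=
      (measurePreserving_eval_infinitePi (fun _ : ℕ => M.obsLaw) 0).map_eq
    rw [← h1, Measure.map_map measurable_fst (measurable_pi_apply 0)]
    exact (M.measurePreserving_design 0).map_eq
  have hcL : MemLp (fun x => φ x - ∫ x, φ x ∂M.lam) 2 M.lam := hφL.sub (memLp_const _)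
  have hq : MemLp (fun z : M.𝒳 × V => φ z.1 - ∫ x, φ x ∂M.lam) 2 M.obsLaw :=
    hcL.comp_measurePreserving hfst
  have hφi : Integrable φ M.lam := hφL.integrable (by norm_num)
  have h0 : ∫ z, (φ z.1 - ∫ x, φ x ∂M.lam) ∂M.obsLaw = 0 := by
    have := integral_map (μ := M.obsLaw) measurable_fst.aemeasurable
      (f := fun x => φ x - ∫ x, φ x ∂M.lam) (by fun_prop)
    rw [← this, hfst.map_eq, integral_sub hφi (integrable_const _)]
    simp
  have h1 := M.lintegral_sq_sum_P hq h0 N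
  have h2 : ∫⁻ z, ENNReal.ofReal ((φ z.1 - ∫ x, φ x ∂M.lam) ^ 2) ∂M.obsLaw ≤
      ENNReal.ofReal (B ^ 2 * ∫ x, ‖f x‖ ^ 2 ∂M.lam) := by
    rw [hfst.lintegral_comp (f := fun x => ENNReal.ofReal ((φ x - ∫ x, φ x ∂M.lam) ^ 2))
      (by fun_prop)]
    rw [← ofReal_integral_eq_lintegral_ofReal hcL.integrable_sq (ae_of_all _ fun _ => sq_nonneg _)]
    refine ENNReal.ofReal_le_ofReal ?_
    have hfi : Integrable (fun x => ‖f x‖ ^ 2) M.lam := hf.integrable_norm_pow (by norm_num)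
    have h3 : ∫ x, (φ x - ∫ x, φ x ∂M.lam) ^ 2 ∂M.lam = variance φ M.lam :=
      (variance_eq_integral hφm.aemeasurable).symm
    rw [h3, ← integral_const_mul]
    refine (variance_le_expectation_sq hφm.aestronglyMeasurable).trans ?_
    refine integral_mono_ae hφL.integrable_sq (hfi.const_mul _) ?_
    filter_upwards [hφb] with x hx
    simp only [Pi.pow_apply]
    rw [← mul_pow]
    exact sq_le_sq' (by linarith [neg_abs_le (φ x), Real.norm_eq_abs (φ x)])
      ((le_abs_self _).trans hx)
  rw [ENNReal.ofReal_mul (by positivity), ENNReal.ofReal_natCast]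
  refine le_trans (le_of_eq ?_) (mul_le_mul_right h2 _)
  rw [← h1]
  rfl

end Ambient

/-! ### Local expansion of the likelihood -/

section Expansion

variable {d k : ℕ} {H V : Type*}
  [NormedAddCommGroup H] [InnerProductSpace ℝ H] [CompleteSpace H]
  [MeasurableSpace H] [BorelSpace H]
  [NormedAddCommGroup V] [InnerProductSpace ℝ V] [FiniteDimensional ℝ V]
  [MeasurableSpace V] [BorelSpace V] {M : Model d k H V} {A : H →L[ℝ] Lp V 2 M.lam}

variable (M) in
/-- The class of `G_θ - G_{θ₀}` in `L²`. -/
def diffLp (θ : M.Θ) : Lp V 2 M.lam := ((M.memLp_G θ).sub (M.memLp_G M.θ₀)).toLp _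

lemma coeFn_diffLp (θ : M.Θ) :
    (M.diffLp θ : M.𝒳 → V) =ᵐ[M.lam] fun x => M.G θ x - M.G M.θ₀ x :=
  ((M.memLp_G θ).sub (M.memLp_G M.θ₀)).coeFn_toLp

lemma norm_diffLp_sub (θ : M.Θ) :
    ‖M.diffLp θ - A ((θ : H) - M.θ₀)‖ = (M.L2norm (M.linErr A θ)).toReal := by
  rw [Lp.norm_def, L2norm]
  congr 1
  refine eLpNorm_congr_ae ?_
  filter_upwards [Lp.coeFn_sub (M.diffLp θ) (A ((θ : H) - M.θ₀)), coeFn_diffLp (M := M) θ]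
    with x h1 h2
  rw [h1, Pi.sub_apply, h2]
  rfl

/-- The expansion of the squared `L²` distances. -/
lemma abs_quadratic_sub_le {F : Type*} [NormedAddCommGroup F] [InnerProductSpace ℝ F]
    (p p' w h : F) {s b : ℝ} (hp : ‖p - w‖ ≤ s) (hp' : ‖p' - (w + h)‖ ≤ s) (hw : ‖w‖ ≤ b)
    (hwh : ‖w + h‖ ≤ b) :
    |(‖p'‖ ^ 2 - ‖p‖ ^ 2) / 2 - ⟪h, w⟫ - ‖h‖ ^ 2 / 2| ≤ 2 * (b * s) + s ^ 2 := by
  set R := p - w with hR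
  set R' := p' - (w + h) with hR'
  have e1 : p = w + R := by simp [hR]
  have e2 : p' = (w + h) + R' := by simp [hR']
  have e3 : (‖p'‖ ^ 2 - ‖p‖ ^ 2) / 2 - ⟪h, w⟫ - ‖h‖ ^ 2 / 2 =
      ⟪w + h, R'⟫ + ‖R'‖ ^ 2 / 2 - ⟪w, R⟫ - ‖R‖ ^ 2 / 2 := by
    rw [e1, e2, norm_add_sq_real (w + h) R', norm_add_sq_real w h, norm_add_sq_real w R,
      real_inner_comm h w]
    ring
  have h1 := (abs_real_inner_le_norm (w + h) R').trans
    (mul_le_mul hwh hp' (norm_nonneg _) ((norm_nonneg _).trans hwh))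
  have h2 := (abs_real_inner_le_norm w R).trans
    (mul_le_mul hw hp (norm_nonneg _) ((norm_nonneg _).trans hw))
  have h3 : ‖R'‖ ^ 2 ≤ s ^ 2 := pow_le_pow_left₀ (norm_nonneg _) hp' 2
  have h4 : ‖R‖ ^ 2 ≤ s ^ 2 := pow_le_pow_left₀ (norm_nonneg _) hp 2
  rw [e3, abs_le]
  rw [abs_le] at h1 h2
  constructor <;> nlinarith [sq_nonneg ‖R‖, sq_nonneg ‖R'‖]

lemma inner_Psi (y : EuclideanSpace ℝ (Fin k)) (u : H) : ⟪y, M.Psi u⟫ = ∑ j, y j * ⟪M.ψ j, u⟫ := by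
  rw [PiLp.inner_apply]
  refine Finset.sum_congr rfl fun j _ => ?_
  rw [show M.Psi u j = ⟪u, M.ψ j⟫ from rfl, real_inner_comm (M.ψ j) u]
  simp [mul_comm]

lemma Psi_sub (u u' : H) : M.Psi (u - u') = M.Psi u - M.Psi u' := by
  ext j
  simp [Psi, inner_sub_left]

/-- On the approximation space, `⟨A ·, A h⟩` represents the functional, up to the projection bias
of the truth. -/
lemma abs_inner_A_dir_sub_le {D : ℕ} (hinv : (M.infoD A D).IsInvertible)
    (y : EuclideanSpace ℝ (Fin k)) (u : M.E D) :
    |⟪A (M.dir A D y : H), A ((u : H) - M.θ₀)⟫ - ⟪y, M.Psi u - M.Psi M.θ₀⟫| ≤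
      ((∑ j, ‖M.ψ j‖) * ‖y‖ + ‖A (M.dir A D y : H)‖ * ‖A‖) *
        ‖(M.θ₀ : H) - M.proj D M.θ₀‖ := by
  set q : H := (M.θ₀ : H) - M.proj D M.θ₀ with hq
  have h1 := M.inner_A_dir hinv y (u - M.proj D M.θ₀)
  rw [← inner_Psi] at h1
  have e1 : ((u - M.proj D (M.θ₀ : H) : M.E D) : H) = ((u : H) - M.θ₀) + q := by
    rw [hq]; push_cast; abel
  rw [e1, map_add, inner_add_right] at h1
  have e2 : M.Psi ((u : H) - M.θ₀ + q) = (M.Psi u - M.Psi M.θ₀) + M.Psi q := by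
    rw [← Psi_sub]; ext j; simp [Psi, inner_add_left]
  rw [e2, inner_add_right] at h1
  have h2 : |⟪y, M.Psi q⟫| ≤ (∑ j, ‖M.ψ j‖) * ‖y‖ * ‖q‖ := by
    rw [inner_Psi, Finset.sum_mul, Finset.sum_mul]
    refine (Finset.abs_sum_le_sum_abs _ _).trans (Finset.sum_le_sum fun j _ => ?_)
    rw [abs_mul]
    calc |y j| * |⟪M.ψ j, q⟫| ≤ ‖y‖ * (‖M.ψ j‖ * ‖q‖) := by
          gcongr
          · exact PiLp.norm_apply_le y j
          · exact abs_real_inner_le_norm _ _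
      _ = _ := by ring
  have h3 : |⟪A (M.dir A D y : H), A q⟫| ≤ ‖A (M.dir A D y : H)‖ * ‖A‖ * ‖q‖ := by
    refine (abs_real_inner_le_norm _ _).trans ?_
    rw [mul_assoc]
    gcongr
    exact A.le_opNorm q
  have e3 : ⟪A (M.dir A D y : H), A ((u : H) - M.θ₀)⟫ - ⟪y, M.Psi u - M.Psi M.θ₀⟫ =
      ⟪y, M.Psi q⟫ - ⟪A (M.dir A D y : H), A q⟫ := by linarith
  rw [e3, add_mul]
  exact (abs_sub _ _).trans (add_le_add h2 h3)

/-- `⟨v, Z_N⟩` is the sum of a linear functional of the parameter and the noise term in the expansion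
of the log-likelihood along `λᵀ h_N`. -/
lemma inner_Z (N : ℕ) (hN : 1 ≤ N) (v : EuclideanSpace ℝ (Fin k)) (θ : M.E (M.D N)) :
    ∀ᵐ ω ∂M.P, ⟪v, M.Z A N ω θ⟫ =
      √N * ⟪M.sqrtMap A (M.D N) v, M.Psi θ - M.Psi M.θ₀⟫ -
        ∑ i ∈ Finset.range N, ⟪M.noise ω i, A (M.shift A N v : H) (ω i).1⟫ := by
  set y := M.sqrtMap A (M.D N) v with hy
  have hsN : 0 < √(N : ℝ) := Real.sqrt_pos.2 (by exact_mod_cast hN)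
  have e1 : A (M.shift A N v : H) = ∑ j, ((√(N : ℝ))⁻¹ * y j) • A (M.psiBar A (M.D N) j : H) := by
    rw [M.shift_eq, dir]
    simp [Finset.smul_sum, smul_smul]
    rfl
  have hae : ∀ᵐ x ∂M.lam, A (M.shift A N v : H) x =
      ∑ j, ((√(N : ℝ))⁻¹ * y j) • (A (M.psiBar A (M.D N) j : H) x) := by
    rw [e1]
    have h2 : ∀ᵐ x ∂M.lam, ∀ j, (((√(N : ℝ))⁻¹ * y j) • A (M.psiBar A (M.D N) j : H) : Lp V 2 M.lam) x
        = ((√(N : ℝ))⁻¹ * y j) • (A (M.psiBar A (M.D N) j : H) x) :=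
      ae_all_iff.2 fun j => Lp.coeFn_smul _ _
    have h3 := Lp.coeFn_finsetSum Finset.univ
      (fun j => ((√(N : ℝ))⁻¹ * y j) • A (M.psiBar A (M.D N) j : H))
    filter_upwards [h2, h3] with x h2 h3
    rw [h3, Finset.sum_apply]
    exact Finset.sum_congr rfl fun j _ => h2 j
  filter_upwards [M.ae_design hae] with ω hω
  have e2 : ∑ i ∈ Finset.range N, ⟪M.noise ω i, A (M.shift A N v : H) (ω i).1⟫ =
      (√(N : ℝ))⁻¹ * ∑ j, y j * ∑ i ∈ Finset.range N,
        ⟪M.noise ω i, A (M.psiBar A (M.D N) j : H) (ω i).1⟫ := by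
    simp_rw [hω, inner_sum, real_inner_smul_right, Finset.mul_sum]
    rw [Finset.sum_comm]
    exact Finset.sum_congr rfl fun j _ => Finset.sum_congr rfl fun i _ => by ring
  have e3 : ⟪y, M.center A N ω - M.Psi M.θ₀⟫ = (N : ℝ)⁻¹ * ∑ j, y j * ∑ i ∈ Finset.range N,
        ⟪M.noise ω i, A (M.psiBar A (M.D N) j : H) (ω i).1⟫ := by
    rw [center, add_sub_cancel_left, PiLp.inner_apply, Finset.mul_sum]
    refine Finset.sum_congr rfl fun j _ => ?_
    simp only [noise, RCLike.inner_apply, conj_trivial]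
    ring
  have e4 : M.Z A N ω θ = √(N : ℝ) • M.sqrtMap A (M.D N) (M.Psi θ - M.center A N ω) := rfl
  have e5 : M.Psi θ - M.center A N ω =
      (M.Psi θ - M.Psi M.θ₀) - (M.center A N ω - M.Psi M.θ₀) := by abel
  rw [e4, real_inner_smul_right, M.inner_sqrtMap, ← hy, e5, inner_sub_right, e3, e2, mul_sub,
    ← mul_assoc]
  congr 2
  rw [← div_eq_mul_inv, div_eq_iff (by positivity), inv_mul_eq_div, eq_div_iff hsN.ne']
  exact Real.mul_self_sqrt (Nat.cast_nonneg N)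

/-- The exact expansion of the log-likelihood ratio. The squared distances to the truth are split at
a reference parameter `t₁`, since only differences within a local set are controlled uniformly. -/
lemma logLik_sub_logLik (N : ℕ) {D : ℕ} (θ h : M.E D) (t₁ : M.Θ) :
    ∀ᵐ ω ∂M.P, M.logLik N ω (M.toΘ θ) - M.logLik N ω (M.toΘ (θ + h)) =
      -∑ i ∈ Finset.range N, ⟪M.noise ω i, A (h : H) (ω i).1⟫ +
      M.empProc N (fun x => ⟪M.G t₁ x - M.G M.θ₀ x, A (h : H) x⟫) ω +
      (M.mulProc N (fun x => M.G t₁ x - M.G M.θ₀ x)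
          (fun x => M.linErr A (M.toΘ θ) x - M.linErr A t₁ x) ω -
        M.mulProc N (fun x => M.G t₁ x - M.G M.θ₀ x)
          (fun x => M.linErr A (M.toΘ (θ + h)) x - M.linErr A t₁ x) ω) -
      (M.empProc N (fun x => ‖M.G (M.toΘ θ) x - M.G t₁ x‖ ^ 2) ω -
        M.empProc N (fun x => ‖M.G (M.toΘ (θ + h)) x - M.G t₁ x‖ ^ 2) ω) / 2 +
      N * ((‖M.diffLp (M.toΘ (θ + h))‖ ^ 2 - ‖M.diffLp (M.toΘ θ)‖ ^ 2) / 2) := by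
  set t := M.toΘ θ with ht
  set t' := M.toΘ (θ + h) with ht'
  have hcoe : A ((t' : H) - M.θ₀) = A ((t : H) - M.θ₀) + A (h : H) := by
    rw [← map_add]
    congr 1
    show ((θ : H) + (h : H)) - M.θ₀ = (θ : H) - M.θ₀ + h
    abel
  have hAae : ∀ᵐ x ∂M.lam, A ((t' : H) - M.θ₀) x = A ((t : H) - M.θ₀) x + A (h : H) x := by
    rw [hcoe]; exact Lp.coeFn_add _ _
  -- the expectations, as inner products in `L²`
  have hζL : MemLp (fun x => M.G t₁ x - M.G M.θ₀ x) 2 M.lam := (M.memLp_G _).sub (M.memLp_G _)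
  have hint : ∀ s : M.Θ, ∫ x, ⟪M.linErr A s x - M.linErr A t₁ x, M.G t₁ x - M.G M.θ₀ x⟫ ∂M.lam =
      ⟪(M.diffLp s - A ((s : H) - M.θ₀)) - (M.diffLp t₁ - A ((t₁ : H) - M.θ₀)), M.diffLp t₁⟫ := by
    intro s
    rw [L2.inner_def]
    refine integral_congr_ae ?_
    filter_upwards [Lp.coeFn_sub (M.diffLp s - A ((s : H) - M.θ₀))
      (M.diffLp t₁ - A ((t₁ : H) - M.θ₀)), Lp.coeFn_sub (M.diffLp s) (A ((s : H) - M.θ₀)),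
      Lp.coeFn_sub (M.diffLp t₁) (A ((t₁ : H) - M.θ₀)), coeFn_diffLp (M := M) s,
      coeFn_diffLp (M := M) t₁] with x h1 h2 h3 h4 h5
    rw [h1, Pi.sub_apply, h2, h3, Pi.sub_apply, Pi.sub_apply, h4, h5]
    rfl
  have hsq : ∀ s : M.Θ, ∫ x, ‖M.G s x - M.G t₁ x‖ ^ 2 ∂M.lam = ‖M.diffLp s - M.diffLp t₁‖ ^ 2 := by
    intro s
    rw [← real_inner_self_eq_norm_sq, L2.inner_def]
    refine integral_congr_ae ?_
    filter_upwards [Lp.coeFn_sub (M.diffLp s) (M.diffLp t₁), coeFn_diffLp (M := M) s,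
      coeFn_diffLp (M := M) t₁] with x h1 h4 h5
    rw [h1, Pi.sub_apply, h4, h5, real_inner_self_eq_norm_sq, sub_sub_sub_cancel_right]
  have hAh : ∫ x, ⟪M.G t₁ x - M.G M.θ₀ x, A (h : H) x⟫ ∂M.lam = ⟪M.diffLp t₁, A (h : H)⟫ := by
    rw [L2.inner_def]
    refine integral_congr_ae ?_
    filter_upwards [coeFn_diffLp (M := M) t₁] with x h5
    rw [h5]
  have hdet : (N : ℝ) * (-(∫ x, ⟪M.linErr A t x - M.linErr A t₁ x, M.G t₁ x - M.G M.θ₀ x⟫ ∂M.lam) +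
      (∫ x, ⟪M.linErr A t' x - M.linErr A t₁ x, M.G t₁ x - M.G M.θ₀ x⟫ ∂M.lam) +
      (∫ x, ⟪M.G t₁ x - M.G M.θ₀ x, A (h : H) x⟫ ∂M.lam) -
      ((∫ x, ‖M.G t x - M.G t₁ x‖ ^ 2 ∂M.lam) - ∫ x, ‖M.G t' x - M.G t₁ x‖ ^ 2 ∂M.lam) / 2) =
      N * ((‖M.diffLp t'‖ ^ 2 - ‖M.diffLp t‖ ^ 2) / 2) := by
    rw [hint, hint, hsq, hsq, hAh, hcoe]
    congr 1
    simp only [inner_sub_left, inner_add_left, norm_sub_sq_real]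
    rw [real_inner_comm (M.diffLp t₁) (A (h : H))]
    ring
  rw [← hdet]
  filter_upwards [M.ae_design hAae] with ω hω
  simp only [logLik, empProc, mulProc]
  rw [← mul_sub, ← Finset.sum_sub_distrib, ← Finset.sum_sub_distrib, ← Finset.sum_sub_distrib,
    ← Finset.sum_neg_distrib, Finset.sum_div]
  have hNsum : ∀ x : ℝ, (N : ℝ) * x = ∑ _i ∈ Finset.range N, x := fun x => by simp
  rw [hNsum, Finset.mul_sum, ← Finset.sum_add_distrib, ← Finset.sum_add_distrib,
    ← Finset.sum_sub_distrib, ← Finset.sum_add_distrib]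
  refine Finset.sum_congr rfl fun i _ => ?_
  have h1 := hω i
  set x := (ω i).1
  have hn : M.noise ω i = (ω i).2 - M.G M.θ₀ x := rfl
  set ε := M.noise ω i with hε
  have hy : (ω i).2 = ε + M.G M.θ₀ x := by rw [hn]; abel
  rw [hy]
  set ζ := M.G t₁ x - M.G M.θ₀ x with hζ
  set a := M.G t x - M.G t₁ x with ha
  set a' := M.G t' x - M.G t₁ x with ha'
  have e1 : ε + M.G M.θ₀ x - M.G t x = (ε - ζ) - a := by rw [hζ, ha]; abel
  have e2 : ε + M.G M.θ₀ x - M.G t' x = (ε - ζ) - a' := by rw [hζ, ha']; abel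
  have e3 : M.linErr A t x - M.linErr A t₁ x =
      a - A ((t : H) - M.θ₀) x + A ((t₁ : H) - M.θ₀) x := by
    rw [ha, linErr, linErr]; abel
  have e4 : M.linErr A t' x - M.linErr A t₁ x =
      a' - A ((t : H) - M.θ₀) x - A (h : H) x + A ((t₁ : H) - M.θ₀) x := by
    rw [ha', linErr, linErr, h1]; abel
  rw [e1, e2, norm_sub_sq_real (ε - ζ) a, norm_sub_sq_real (ε - ζ) a']
  have e5 : ⟪M.linErr A t x - M.linErr A t₁ x, ε - ζ⟫ -
      ⟪M.linErr A t' x - M.linErr A t₁ x, ε - ζ⟫ =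
      ⟪ε - ζ, a⟫ - ⟪ε - ζ, a'⟫ + ⟪ε, A (h : H) x⟫ - ⟪ζ, A (h : H) x⟫ := by
    rw [← inner_sub_left, e3, e4, real_inner_comm]
    rw [show a - A ((t : H) - M.θ₀) x + A ((t₁ : H) - M.θ₀) x -
      (a' - A ((t : H) - M.θ₀) x - A (h : H) x + A ((t₁ : H) - M.θ₀) x) =
      a - a' + A (h : H) x by abel, inner_add_right, inner_sub_right,
      inner_sub_left ε ζ (A (h : H) x)]
    ring
  linarith

end Expansion

section Expansion

variable {d k : ℕ} {H V : Type*}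
  [NormedAddCommGroup H] [InnerProductSpace ℝ H] [CompleteSpace H]
  [MeasurableSpace H] [BorelSpace H]
  [NormedAddCommGroup V] [InnerProductSpace ℝ V] [FiniteDimensional ℝ V]
  [MeasurableSpace V] [BorelSpace V] {M : Model d k H V} {A : H →L[ℝ] Lp V 2 M.lam}
  {nR : H → ℝ≥0∞} {r₁ r₂ M₀ a b c : ℝ} {dΘ : MetricSpace M.Θ} {δΘ σ g r : ℕ → ℝ} {J : ℕ → ℝ → ℝ}

/-- The deterministic part of the expansion. -/
lemma exists_deterministic_bound (hcontr : M.PosteriorContraction nR r₁ r₂ M₀ a b c)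
    {m : ℝ} (hm : 0 < m) (hent : M.EntropyBounds nR r₁ A dΘ δΘ σ g r J)
    (hinv : ∀ D : ℕ, (M.infoD A D).IsInvertible)
    (h7 : Tendsto (fun N : ℕ => (N : ℝ) * (σ N ^ 2 + σ N * rate r₂ N)) atTop (𝓝 0))
    (h8 : Tendsto (fun N : ℕ => Real.sqrt N * ‖(M.θ₀ : H) - M.proj (M.D N) M.θ₀‖) atTop (𝓝 0))
    (v : EuclideanSpace ℝ (Fin k)) :
    ∃ ρ : ℕ → ℝ, Tendsto ρ atTop (𝓝 0) ∧ ∀ᶠ N : ℕ in atTop, ∀ θ ∈ M.localSet nR r₁ N m,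
      θ + M.shift A N v ∈ M.localSet nR r₁ N m →
      |N * ((‖M.diffLp (M.toΘ (θ + M.shift A N v))‖ ^ 2 - ‖M.diffLp (M.toΘ θ)‖ ^ 2) / 2) -
        √N * ⟪M.sqrtMap A (M.D N) v, M.Psi θ - M.Psi M.θ₀⟫ - ‖v‖ ^ 2 / 2| ≤ ρ N := by
  obtain ⟨C, hC, hb⟩ := hent.bounds m hm
  obtain ⟨m', hm', hstab⟩ := hcontr.stability m hm
  obtain ⟨c, hc, hcD⟩ := M.exists_norm_le_norm_proj_sum
  set K := (∑ j, ‖M.ψ j‖) * (‖A‖ / c * ‖v‖) + ‖v‖ * ‖A‖ with hK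
  refine ⟨fun N => (2 * ‖A‖ * m' * C + C ^ 2) * (N * (σ N ^ 2 + σ N * rate r₂ N)) +
    K * (√N * ‖(M.θ₀ : H) - M.proj (M.D N) M.θ₀‖),
    by simpa using (h7.const_mul (2 * ‖A‖ * m' * C + C ^ 2)).add (h8.const_mul K), ?_⟩
  filter_upwards [M.tendsto_D.eventually hcD, eventually_ge_atTop 1] with N hND hN θ hθ hθ'
  obtain ⟨-, b2, -, -, -⟩ := hb N hN
  obtain ⟨-, hσ, -, -⟩ := hent.pos N hN
  have hNpos : (0 : ℝ) < N := by exact_mod_cast hN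
  have hsN : 0 < √(N : ℝ) := Real.sqrt_pos.2 hNpos
  have hδ := rate_pos r₂ hN
  set y := M.sqrtMap A (M.D N) v with hy
  set h : M.E (M.D N) := M.shift A N v with hh
  have hAh : A (h : H) = (√(N : ℝ))⁻¹ • A (M.dir A (M.D N) y : H) := by
    rw [hh, M.shift_eq, ← hy]
    simp
  have hAy : ‖A (M.dir A (M.D N) y : H)‖ = ‖v‖ := M.norm_A_dir_sqrtMap (hinv _) hc hND v
  set w := A ((θ : H) - M.θ₀) with hw
  have hwh : A (((θ + h : M.E (M.D N)) : H) - M.θ₀) = w + A (h : H) := by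
    rw [hw, ← map_add]
    congr 1
    push_cast
    abel
  have hR : ∀ θ ∈ M.localSet nR r₁ N m, ‖M.diffLp (M.toΘ θ) - A ((θ : H) - M.θ₀)‖ ≤ C * σ N := by
    intro θ hθ
    have := norm_diffLp_sub (A := A) (M.toΘ θ)
    rw [show ((M.toΘ θ : M.Θ) : H) = (θ : H) from rfl] at this
    rw [this]
    exact ENNReal.toReal_le_of_le_ofReal (by positivity) (b2 θ hθ)
  have hA : ∀ θ ∈ M.localSet nR r₁ N m, ‖A ((θ : H) - M.θ₀)‖ ≤ ‖A‖ * (m' * rate r₂ N) := by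
    intro θ hθ
    exact (A.le_opNorm _).trans (by gcongr; exact hstab N hN θ hθ)
  have hquad := abs_quadratic_sub_le (M.diffLp (M.toΘ θ)) (M.diffLp (M.toΘ (θ + h))) w (A (h : H))
    (hR θ hθ) (hwh ▸ hR _ hθ') (hA θ hθ) (hwh ▸ hA _ hθ')
  have hlin := abs_inner_A_dir_sub_le (hinv (M.D N)) y θ
  rw [hAy, ← hw] at hlin
  have hylen : ‖y‖ ≤ ‖A‖ / c * ‖v‖ := M.norm_sqrtMap_le (hinv _) hc hND v
  set q := ‖(M.θ₀ : H) - M.proj (M.D N) M.θ₀‖ with hq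
  have hlin' : |⟪A (M.dir A (M.D N) y : H), w⟫ - ⟪y, M.Psi θ - M.Psi M.θ₀⟫| ≤ K * q := by
    refine hlin.trans ?_
    rw [hK]
    gcongr
  have e1 : (N : ℝ) * ⟪A (h : H), w⟫ = √N * ⟪A (M.dir A (M.D N) y : H), w⟫ := by
    rw [hAh, real_inner_smul_left, ← mul_assoc, ← div_eq_mul_inv, Real.div_sqrt]
  have e2 : (N : ℝ) * ‖A (h : H)‖ ^ 2 = ‖v‖ ^ 2 := by
    rw [hAh, norm_smul, hAy, norm_inv, Real.norm_of_nonneg hsN.le, mul_pow, inv_pow,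
      Real.sq_sqrt hNpos.le]
    field_simp
  set Q := (‖M.diffLp (M.toΘ (θ + h))‖ ^ 2 - ‖M.diffLp (M.toΘ θ)‖ ^ 2) / 2 with hQ
  have e3 : N * Q - √N * ⟪y, M.Psi θ - M.Psi M.θ₀⟫ - ‖v‖ ^ 2 / 2 =
      N * (Q - ⟪A (h : H), w⟫ - ‖A (h : H)‖ ^ 2 / 2) +
      √N * (⟪A (M.dir A (M.D N) y : H), w⟫ - ⟪y, M.Psi θ - M.Psi M.θ₀⟫) := by
    rw [← e2, mul_sub, mul_sub, mul_sub, e1]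
    ring
  rw [e3]
  refine (abs_add_le _ _).trans ?_
  rw [abs_mul, abs_mul, abs_of_pos hNpos, abs_of_pos hsN]
  calc _ ≤ N * (2 * (‖A‖ * (m' * rate r₂ N) * (C * σ N)) + (C * σ N) ^ 2) + √N * (K * q) := by
        gcongr
    _ ≤ _ := by
      have h1 : 0 ≤ 2 * ‖A‖ * m' * C * (N * σ N ^ 2) := by positivity
      have h2 : 0 ≤ C ^ 2 * (N * (σ N * rate r₂ N)) := by positivity
      nlinarith

/-- The local expansion of the log-likelihood: along the perturbations `λᵀ h_N` it is linear in
`Z_N` up to an error that is uniformly small in probability. -/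
theorem exists_expansion (hcontr : M.PosteriorContraction nR r₁ r₂ M₀ a b c)
    {m : ℝ} (hm : M₀ ≤ m) (hent : M.EntropyBounds nR r₁ A dΘ δΘ σ g r J)
    (hinv : ∀ D : ℕ, (M.infoD A D).IsInvertible)
    (h3 : Tendsto (fun N : ℕ => Real.sqrt N * r N * J N (σ N / r N)) atTop (𝓝 0))
    (h4 : Tendsto (fun N : ℕ => Real.sqrt (Real.log N) * r N ^ 3 * δΘ N *
      J N (σ N / r N) ^ 2 / σ N ^ 2) atTop (𝓝 0))
    (h5 : Tendsto (fun N : ℕ => Real.sqrt N * g N ^ 2 * δΘ N * J N (δΘ N)) atTop (𝓝 0))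
    (h7 : Tendsto (fun N : ℕ => (N : ℝ) * (σ N ^ 2 + σ N * rate r₂ N)) atTop (𝓝 0))
    (h8 : Tendsto (fun N : ℕ => Real.sqrt N * ‖(M.θ₀ : H) - M.proj (M.D N) M.θ₀‖) atTop (𝓝 0))
    (v : EuclideanSpace ℝ (Fin k)) :
    ∃ W : ℕ → (ℕ → M.𝒳 × V) → ℝ≥0∞, (∀ᶠ N in atTop, Measurable (W N)) ∧
      Tendsto (fun p : ℕ × (ℕ → M.𝒳 × V) => W p.1 p.2) (inProb M.P) (𝓝 0) ∧
      ∀ᶠ N in atTop, ∀ θ ∈ M.localSet nR r₁ N m, θ + M.shift A N v ∈ M.localSet nR r₁ N m →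
        ∀ᵐ ω ∂M.P, ENNReal.ofReal |M.logLik N ω (M.toΘ θ) -
          M.logLik N ω (M.toΘ (θ + M.shift A N v)) - ⟪v, M.Z A N ω θ⟫ - ‖v‖ ^ 2 / 2| ≤ W N ω := by
  have hm0 : 0 < m := hcontr.M₀_pos.trans_le hm
  -- the truth need not lie in the approximation spaces: a parameter of each local set takes its
  -- place in the empirical processes
  have ht₁ : ∃ t₁ : ℕ → M.Θ, ∀ᶠ N in atTop, t₁ N ∈ M.toΘ '' M.localSet nR r₁ N M₀ := by
    have : ∀ᶠ N in atTop, ∃ t, t ∈ M.toΘ '' M.localSet nR r₁ N M₀ := by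
      filter_upwards [hcontr.eventually_nonempty] with N hN using hN.image _
    exact this.choice
  obtain ⟨t₁, ht₁⟩ := ht₁
  have hlim := tendsto_LinftyNorm_sub_truth hcontr.r₁_mem hcontr.M₀_pos hent h5 ht₁
  have ht₁m : ∀ᶠ N in atTop, t₁ N ∈ M.toΘ '' M.localSet nR r₁ N m := by
    filter_upwards [ht₁] with N hN using Set.image_mono (M.localSet_mono hm) hN
  set z : ℕ → ℝ := fun N => (M.LinftyNorm (M.G (t₁ N) - M.G M.θ₀)).toReal with hz
  have hz0 : Tendsto z atTop (𝓝 0) := by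
    exact (ENNReal.tendsto_toReal ENNReal.zero_ne_top).comp hlim
  have hζz : ∀ᶠ N in atTop, ∀ᵐ x ∂M.lam, ‖M.G (t₁ N) x - M.G M.θ₀ x‖ ≤ z N := by
    filter_upwards [hlim.eventually (gt_mem_nhds zero_lt_one)] with N hN
    exact ae_norm_le_of_LinftyNorm_le ENNReal.toReal_nonneg
      (ENNReal.ofReal_toReal (hN.trans ENNReal.one_lt_top).ne).ge
  have hζ1 : ∀ᶠ N in atTop, ∀ᵐ x ∂M.lam, ‖M.G (t₁ N) x - M.G M.θ₀ x‖ ≤ 1 := by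
    filter_upwards [hζz, hz0.eventually (gt_mem_nhds zero_lt_one)] with N h1 h2
    filter_upwards [h1] with x hx using hx.trans h2.le
  obtain ⟨ρ₁, hρ₁, hW₁⟩ := exists_bound_mulProc hm0 hent h3 h4 ht₁m hζ1
  obtain ⟨ρ₂, hρ₂, hW₂⟩ := exists_bound_empProc hm0 hent h5 ht₁m
  obtain ⟨ρ₃, hρ₃, hdet⟩ := exists_deterministic_bound hcontr hm0 hent hinv h7 h8 v
  obtain ⟨W₁, hW₁⟩ := hW₁.choice
  obtain ⟨W₂, hW₂⟩ := hW₂.choice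
  have hto0 : ∀ (W : ℕ → (ℕ → M.𝒳 × V) → ℝ≥0∞) (ρ : ℕ → ℝ), Tendsto ρ atTop (𝓝 0) →
      (∀ᶠ N in atTop, Measurable (W N) ∧ ∫⁻ ω, W N ω ∂M.P ≤ ENNReal.ofReal (ρ N)) →
      Tendsto (fun p : ℕ × (ℕ → M.𝒳 × V) => W p.1 p.2) (inProb M.P) (𝓝 0) := by
    intro W ρ hρ hW
    refine tendsto_inProb_of_lintegral (hW.mono fun N h => h.1.aemeasurable) ?_
    have h2 : Tendsto (fun N => ENNReal.ofReal (ρ N)) atTop (𝓝 0) := by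
      simpa using ENNReal.tendsto_ofReal hρ
    exact tendsto_of_tendsto_of_tendsto_of_le_of_le' tendsto_const_nhds h2
      (Eventually.of_forall fun _ => zero_le) (hW.mono fun N h => h.2)
  have hl1 := hto0 W₁ ρ₁ hρ₁ (hW₁.mono fun N h => ⟨h.1, h.2.1⟩)
  have hl2 := hto0 W₂ ρ₂ hρ₂ (hW₂.mono fun N h => ⟨h.1, h.2.1⟩)
  -- the empirical process that is linear in the perturbation does not depend on the parameter: a
  -- bound on its variance suffices
  set χ : ℕ → (ℕ → M.𝒳 × V) → ℝ := fun N => M.empProc N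
    (fun x => ⟪M.G (t₁ N) x - M.G M.θ₀ x, A (M.shift A N v : H) x⟫) with hχ
  have hζm : ∀ N, Measurable fun x => M.G (t₁ N) x - M.G M.θ₀ x := fun N =>
    (M.measurable_G_apply _).sub (M.measurable_G_apply _)
  have hχm : ∀ N, Measurable (χ N) := fun N => M.measurable_empProc N
    ((hζm N).inner (measurable_coe_Lp _))
  have hχ0 : Tendsto (fun p : ℕ × (ℕ → M.𝒳 × V) => ENNReal.ofReal |χ p.1 p.2|) (inProb M.P)
      (𝓝 0) := by
    obtain ⟨c, hc, hcD⟩ := M.exists_norm_le_norm_proj_sum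
    have hsq := hto0 (fun N ω => ENNReal.ofReal (χ N ω ^ 2)) (fun N => z N ^ 2 * ‖v‖ ^ 2)
      (by simpa using (hz0.pow 2).mul_const (‖v‖ ^ 2)) (by
        filter_upwards [hζz, M.tendsto_D.eventually hcD, eventually_ge_atTop 1] with N hN hND hN1
        refine ⟨((hχm N).pow_const 2).ennreal_ofReal, ?_⟩
        have hNpos : (0 : ℝ) < N := by exact_mod_cast hN1
        refine (lintegral_sq_empProc_le N (hζm N) (Lp.memLp _) (measurable_coe_Lp _) hN).trans
          (ENNReal.ofReal_le_ofReal (le_of_eq ?_))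
        have e1 : ∫ x, ‖A (M.shift A N v : H) x‖ ^ 2 ∂M.lam = ‖A (M.shift A N v : H)‖ ^ 2 := by
          rw [← real_inner_self_eq_norm_sq (A (M.shift A N v : H)), L2.inner_def]
          simp_rw [real_inner_self_eq_norm_sq]
        have e2 : A (M.shift A N v : H) =
            (√(N : ℝ))⁻¹ • A (M.dir A (M.D N) (M.sqrtMap A (M.D N) v) : H) := by
          rw [M.shift_eq]; simp
        rw [e1, e2, norm_smul, M.norm_A_dir_sqrtMap (hinv _) hc hND v, norm_inv,
          Real.norm_of_nonneg (Real.sqrt_nonneg _), mul_pow, inv_pow, Real.sq_sqrt hNpos.le]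
        field_simp)
    have h1 := (ENNReal.tendsto_toReal ENNReal.zero_ne_top).comp hsq
    have h2 := (Real.continuous_sqrt.tendsto _).comp h1
    have h3 := ENNReal.tendsto_ofReal h2
    simp only [ENNReal.toReal_zero, Real.sqrt_zero, ENNReal.ofReal_zero] at h3
    refine h3.congr fun p => ?_
    simp only [Function.comp]
    rw [ENNReal.toReal_ofReal (sq_nonneg _), Real.sqrt_sq_eq_abs]
  have hl3 : Tendsto (fun p : ℕ × (ℕ → M.𝒳 × V) => ENNReal.ofReal (ρ₃ p.1)) (inProb M.P)
      (𝓝 0) := by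
    simpa using ENNReal.tendsto_ofReal (hρ₃.comp tendsto_fst_inProb)
  refine ⟨fun N ω => ENNReal.ofReal |χ N ω| + ((W₁ N ω + W₁ N ω) + (W₂ N ω + W₂ N ω)) +
    ENNReal.ofReal (ρ₃ N), ?_, ?_, ?_⟩
  · filter_upwards [hW₁, hW₂] with N h1 h2
    have hm1 := h1.1
    have hm2 := h2.1
    have hm3 : Measurable fun ω => |χ N ω| := (hχm N).norm
    fun_prop
  · simpa using (hχ0.add ((hl1.add hl1).add (hl2.add hl2))).add hl3
  · filter_upwards [hW₁, hW₂, hdet, eventually_ge_atTop 1] with N hN1 hN2 hN3 hN θ hθ hθ'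
    filter_upwards [hN1.2.2 _ ⟨θ, hθ, rfl⟩, hN1.2.2 _ ⟨_, hθ', rfl⟩, hN2.2.2 _ ⟨θ, hθ, rfl⟩,
      hN2.2.2 _ ⟨_, hθ', rfl⟩, inner_Z (M := M) (A := A) N hN v θ,
      logLik_sub_logLik (M := M) (A := A) N θ (M.shift A N v) (t₁ N)] with ω w1 w1' w2 w2' hZ hL
    have hd := hN3 θ hθ hθ'
    refine le_trans ?_ (add_le_add (add_le_add le_rfl
      (add_le_add (add_le_add w1 w1') (add_le_add w2 w2'))) le_rfl)
    have hρ0 : 0 ≤ ρ₃ N := (abs_nonneg _).trans hd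
    rw [← ENNReal.ofReal_add (abs_nonneg _) (abs_nonneg _),
      ← ENNReal.ofReal_add (abs_nonneg _) (abs_nonneg _),
      ← ENNReal.ofReal_add (by positivity) (by positivity),
      ← ENNReal.ofReal_add (by positivity) (by positivity),
      ← ENNReal.ofReal_add (by positivity) hρ0]
    refine ENNReal.ofReal_le_ofReal ?_
    rw [hL, hZ]
    have hχe : χ N ω = M.empProc N
      (fun x => ⟪M.G (t₁ N) x - M.G M.θ₀ x, A (M.shift A N v : H) x⟫) ω := rfl
    rw [← hχe]
    generalize M.mulProc N _ _ ω = x1 at *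
    generalize M.mulProc N _ _ ω = x2 at *
    generalize M.empProc N (fun x => ‖M.G (M.toΘ θ) x - M.G (t₁ N) x‖ ^ 2) ω = x3 at *
    generalize M.empProc N _ ω = x4 at *
    rw [abs_le] at hd ⊢
    have a1 := abs_le.1 (le_refl |x1|)
    have a2 := abs_le.1 (le_refl |x2|)
    have a3 := abs_le.1 (le_refl |x3|)
    have a4 := abs_le.1 (le_refl |x4|)
    have a5 := abs_le.1 (le_refl |χ N ω|)
    constructor <;> linarith [a1.1, a1.2, a2.1, a2.2, a3.1, a3.2, a4.1, a4.2, a5.1, a5.2, hd.1, hd.2,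
      abs_nonneg x3, abs_nonneg x4]

end Expansion

/-! ### The posterior and the truncated local sets -/

section Posterior

variable {d k : ℕ} {H V : Type*}
  [NormedAddCommGroup H] [InnerProductSpace ℝ H] [CompleteSpace H]
  [MeasurableSpace H] [BorelSpace H]
  [NormedAddCommGroup V] [InnerProductSpace ℝ V] [FiniteDimensional ℝ V]
  [MeasurableSpace V] [BorelSpace V] (M : Model d k H V)

lemma measurable_logLik_comp (N : ℕ) {D : ℕ} {α : Type*} [MeasurableSpace α]
    {f : α → ℕ → M.𝒳 × V} {g : α → M.E D} (hf : Measurable f) (hg : Measurable g) :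
    Measurable fun p => M.logLik N (f p) (M.toΘ (g p)) := by
  unfold logLik
  refine Measurable.const_mul (Finset.measurable_sum _ fun i _ => ?_) _
  have h1 : Measurable fun p => f p i := (measurable_pi_apply i).comp hf
  exact ((h1.snd).sub (M.measurable_G_comp ((M.measurable_toΘ D).comp hg)
    h1.fst)).norm.pow_const 2

lemma measurable_logLik_left (N : ℕ) (θ : M.Θ) : Measurable fun ω => M.logLik N ω θ := by
  unfold logLik
  refine Measurable.const_mul (Finset.measurable_sum _ fun i _ => ?_) _
  have h1 : Measurable fun ω : ℕ → M.𝒳 × V => ω i := measurable_pi_apply i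
  exact ((h1.snd).sub ((M.measurable_G_apply θ).comp h1.fst)).norm.pow_const 2

lemma measurable_logLik_right (N D : ℕ) (ω : ℕ → M.𝒳 × V) :
    Measurable fun θ : M.E D => M.logLik N ω (M.toΘ θ) :=
  M.measurable_logLik_comp N measurable_const measurable_id

lemma logLik_nonpos (N : ℕ) (ω : ℕ → M.𝒳 × V) (θ : M.Θ) : M.logLik N ω θ ≤ 0 := by
  have : 0 ≤ ∑ i ∈ Finset.range N, ‖(ω i).2 - M.G θ (ω i).1‖ ^ 2 := by positivity
  unfold logLik
  linarith

lemma integrable_exp_logLik (N : ℕ) (ω : ℕ → M.𝒳 × V) :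
    Integrable (fun θ => Real.exp (M.logLik N ω (M.toΘ θ))) (M.prior N) := by
  refine Integrable.mono' (integrable_const (1 : ℝ))
    (M.measurable_logLik_right N _ ω).exp.aestronglyMeasurable (ae_of_all _ fun θ => ?_)
  rw [Real.norm_of_nonneg (Real.exp_pos _).le]
  exact Real.exp_le_one_iff.2 (M.logLik_nonpos N ω _)

instance isProbabilityMeasure_posterior (N : ℕ) (ω : ℕ → M.𝒳 × V) :
    IsProbabilityMeasure (M.posterior N ω) :=
  isProbabilityMeasure_tilted (M.integrable_exp_logLik N ω)

/-- Bayes' formula, with the likelihood normalized by the likelihood of an arbitrary parameter. -/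
lemma lintegral_posterior (N : ℕ) (ω : ℕ → M.𝒳 × V) (c : ℝ) (F : M.E (M.D N) → ℝ≥0∞) :
    ∫⁻ θ, F θ ∂(M.posterior N ω) =
      (∫⁻ θ, ENNReal.ofReal (Real.exp (M.logLik N ω (M.toΘ θ) - c)) * F θ ∂(M.prior N)) /
        ∫⁻ θ, ENNReal.ofReal (Real.exp (M.logLik N ω (M.toΘ θ) - c)) ∂(M.prior N) := by
  have hsplit : ∀ θ : M.E (M.D N), ENNReal.ofReal (Real.exp (M.logLik N ω (M.toΘ θ) - c)) =
      ENNReal.ofReal (Real.exp (-c)) * ENNReal.ofReal (Real.exp (M.logLik N ω (M.toΘ θ))) := by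
    intro θ
    rw [← ENNReal.ofReal_mul (Real.exp_pos _).le, ← Real.exp_add, neg_add_eq_sub]
  have hm : Measurable fun θ => ENNReal.ofReal (Real.exp (M.logLik N ω (M.toΘ (D := M.D N) θ))) :=
    (M.measurable_logLik_right N _ ω).exp.ennreal_ofReal
  have hi := M.integrable_exp_logLik N ω
  have hpos : 0 < ∫ θ, Real.exp (M.logLik N ω (M.toΘ θ)) ∂(M.prior N) :=
    integral_exp_pos hi
  simp_rw [hsplit, mul_assoc]
  rw [lintegral_const_mul' _ _ ENNReal.ofReal_ne_top, lintegral_const_mul' _ _ ENNReal.ofReal_ne_top,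
    ENNReal.mul_div_mul_left _ _ (by simp [Real.exp_pos]) ENNReal.ofReal_ne_top,
    ← ofReal_integral_eq_lintegral_ofReal hi (ae_of_all _ fun _ => (Real.exp_pos _).le)]
  rw [posterior, lintegral_tilted, ENNReal.div_eq_inv_mul, ← lintegral_const_mul' _ _
    (by simp [hpos])]
  refine lintegral_congr fun θ => ?_
  rw [ENNReal.ofReal_div_of_pos hpos, ENNReal.div_eq_inv_mul, mul_assoc]

lemma tendsto_speed {ρ : ℝ} (hρ : ρ < 1 / 2) : Tendsto (speed ρ) atTop atTop := by
  have h1 : Tendsto (fun N : ℕ => (N : ℝ) ^ (1 - 2 * ρ)) atTop atTop :=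
    (tendsto_rpow_atTop (by linarith)).comp tendsto_natCast_atTop_atTop
  refine h1.congr' ?_
  filter_upwards [eventually_ge_atTop 1] with N hN
  have hNpos : (0 : ℝ) < N := by exact_mod_cast hN
  rw [speed, rate, ← Real.rpow_natCast, ← Real.rpow_mul hNpos.le]
  nth_rewrite 2 [← Real.rpow_one (N : ℝ)]
  rw [← Real.rpow_add hNpos]
  congr 1
  push_cast
  ring

lemma sqrt_speed (ρ : ℝ) {N : ℕ} (hN : 1 ≤ N) : √(speed ρ N) = √N * rate ρ N := by
  rw [speed, Real.sqrt_mul (Nat.cast_nonneg _), Real.sqrt_sq (rate_pos ρ hN).le]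

lemma ipNorm_nonneg (N : ℕ) (h : M.E (M.D N)) : 0 ≤ M.ipNorm N h := Real.sqrt_nonneg _

lemma abs_ipDual_sum_le (N : ℕ) {ι : Type*} (s : Finset ι) (y : ι → ℝ) (h : ι → M.E (M.D N))
    (θ : M.E (M.D N)) :
    |M.ipDual N (∑ j ∈ s, y j • h j) θ| ≤ ∑ j ∈ s, |y j| * |M.ipDual N (h j) θ| := by
  rw [ipDual_comm, map_sum]
  refine (Finset.abs_sum_le_sum_abs _ _).trans (Finset.sum_le_sum fun j _ => ?_)
  rw [map_smul, smul_eq_mul, abs_mul, ipDual_comm]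

lemma ipNorm_sum_le (N : ℕ) {ι : Type*} (s : Finset ι) (y : ι → ℝ) (h : ι → M.E (M.D N)) :
    M.ipNorm N (∑ j ∈ s, y j • h j) ≤ ∑ j ∈ s, |y j| * M.ipNorm N (h j) := by
  set u := ∑ j ∈ s, y j • h j with hu
  rcases (M.ipNorm_nonneg N u).eq_or_lt with h0 | h0
  · rw [← h0]
    exact Finset.sum_nonneg fun j _ => mul_nonneg (abs_nonneg _) (M.ipNorm_nonneg N _)
  · refine le_of_mul_le_mul_right ?_ h0
    rw [← sq, ipNorm_sq, Finset.sum_mul]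
    refine (le_abs_self _).trans ((M.abs_ipDual_sum_le N s y h u).trans
      (Finset.sum_le_sum fun j _ => ?_))
    rw [mul_assoc]
    gcongr
    exact M.abs_ipDual_le N _ _

variable (A : H →L[ℝ] Lp V 2 M.lam) (nR : H → ℝ≥0∞) (r₁ : ℝ)

/-- The part of `Θ_{N,m}` on which the functionals `⟨·, ψ̄_D^j⟩_{H_N}` do not exceed `T √s_N` of
their standard deviations under the prior. -/
def truncSet (N : ℕ) (T m : ℝ) : Set (M.E (M.D N)) :=
  {θ | ∀ j, |M.ipDual N (M.psiBar A (M.D N) j) θ| ≤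
    T * √(speed r₁ N) * M.ipNorm N (M.psiBar A (M.D N) j)} ∩ M.localSet nR r₁ N m

lemma measurableSet_ipDual_le (N : ℕ) (T : ℝ) : MeasurableSet {θ : M.E (M.D N) |
    ∀ j, |M.ipDual N (M.psiBar A (M.D N) j) θ| ≤
      T * √(speed r₁ N) * M.ipNorm N (M.psiBar A (M.D N) j)} := by
  rw [Set.ofPred_forall]
  refine MeasurableSet.iInter fun j => measurableSet_le ?_ measurable_const
  exact (M.ipDual N (M.psiBar A (M.D N) j)).continuous.abs.measurable

variable {A nR r₁}

lemma measurableSet_truncSet (hn : IsExtendedNorm nR) (N : ℕ) (T m : ℝ) :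
    MeasurableSet (M.truncSet A nR r₁ N T m) :=
  (M.measurableSet_ipDual_le A r₁ N T).inter (M.measurableSet_localSet hn r₁ N m)

lemma truncSet_mono {N : ℕ} {T T' m m' : ℝ} (hT : T ≤ T') (hm : m ≤ m') :
    M.truncSet A nR r₁ N T m ⊆ M.truncSet A nR r₁ N T' m' := fun _ hθ =>
  ⟨fun j => (hθ.1 j).trans (mul_le_mul_of_nonneg_right (by gcongr) (M.ipNorm_nonneg N _)),
    M.localSet_mono hm hθ.2⟩

/-- The truncation is negligible under the prior. -/
lemma eventually_prior_truncation_ge (hr₁ : r₁ < 1 / 2) {c : ℝ} (hc : 0 < c) :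
    ∀ᶠ N in atTop, 1 - Real.exp (-c * speed r₁ N) ≤ (M.prior N).real {θ : M.E (M.D N) |
      ∀ j, |M.ipDual N (M.psiBar A (M.D N) j) θ| ≤
        √(2 * (c + 1)) * √(speed r₁ N) * M.ipNorm N (M.psiBar A (M.D N) j)} := by
  have hlim : Tendsto (fun N => (2 * k : ℝ) * Real.exp (-speed r₁ N)) atTop (𝓝 0) := by
    have := (Real.tendsto_exp_neg_atTop_nhds_zero.comp (tendsto_speed hr₁)).const_mul (2 * k : ℝ)
    simpa using this
  filter_upwards [hlim.eventually (gt_mem_nhds zero_lt_one),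
    (tendsto_speed hr₁).eventually_ge_atTop 0] with N hN hs
  set S : Set (M.E (M.D N)) := {θ | ∀ j, |M.ipDual N (M.psiBar A (M.D N) j) θ| ≤
        √(2 * (c + 1)) * √(speed r₁ N) * M.ipNorm N (M.psiBar A (M.D N) j)} with hS
  have hSm : MeasurableSet S := M.measurableSet_ipDual_le A r₁ N _
  have hcompl : M.prior N Sᶜ ≤ ENNReal.ofReal (Real.exp (-c * speed r₁ N)) := by
    have hsub : Sᶜ ⊆ ⋃ j : Fin k, {θ | √(2 * (c + 1)) * √(speed r₁ N) *
        M.ipNorm N (M.psiBar A (M.D N) j) < |M.ipDual N (M.psiBar A (M.D N) j) θ|} := by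
      intro θ hθ
      simp only [hS, Set.mem_compl_iff, Set.mem_ofPred_eq, not_forall, not_le] at hθ
      obtain ⟨j, hj⟩ := hθ
      exact Set.mem_iUnion.2 ⟨j, hj⟩
    refine (measure_mono hsub).trans ((measure_iUnion_fintype_le _ _).trans ?_)
    refine (Finset.sum_le_sum fun j _ => M.prior_abs_ipDual_le N _ (by positivity)).trans ?_
    have e : (√(2 * (c + 1)) * √(speed r₁ N)) ^ 2 / 2 = c * speed r₁ N + speed r₁ N := by
      rw [mul_pow, Real.sq_sqrt (by linarith), Real.sq_sqrt hs]; ring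
    rw [e, Finset.sum_const, Finset.card_univ, Fintype.card_fin, nsmul_eq_mul]
    have e2 : (k : ℝ≥0∞) * (2 * ENNReal.ofReal (Real.exp (-(c * speed r₁ N + speed r₁ N)))) =
        ENNReal.ofReal (2 * k * Real.exp (-(c * speed r₁ N + speed r₁ N))) := by
      rw [ENNReal.ofReal_mul (by positivity), ENNReal.ofReal_mul (by positivity),
        ENNReal.ofReal_natCast, ENNReal.ofReal_ofNat]
      ring
    rw [e2]
    refine ENNReal.ofReal_le_ofReal ?_
    rw [neg_add, Real.exp_add, neg_mul]
    nlinarith [Real.exp_pos (-(c * speed r₁ N))]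
  have h1 : (M.prior N).real S = 1 - (M.prior N).real Sᶜ := by
    rw [probReal_compl_eq_one_sub hSm]
    ring
  rw [h1]
  have : (M.prior N).real Sᶜ ≤ Real.exp (-c * speed r₁ N) :=
    ENNReal.toReal_le_of_le_ofReal (Real.exp_pos _).le hcompl
  linarith

end Posterior

/-! ### The Laplace transform of the truncated posterior -/

section Laplace

variable {d k : ℕ} {H V : Type*}
  [NormedAddCommGroup H] [InnerProductSpace ℝ H] [CompleteSpace H]
  [MeasurableSpace H] [BorelSpace H]
  [NormedAddCommGroup V] [InnerProductSpace ℝ V] [FiniteDimensional ℝ V]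
  [MeasurableSpace V] [BorelSpace V] {M : Model d k H V} {A : H →L[ℝ] Lp V 2 M.lam}
  {nR : H → ℝ≥0∞} {r₁ r₂ M₀ a b c : ℝ}

lemma shift_neg (N : ℕ) (v : EuclideanSpace ℝ (Fin k)) :
    M.shift A N (-v) = -M.shift A N v := by
  simp [shift_eq, dir]

/-- The perturbation `λᵀ h_N` is small for the inner product of the prior, and small on the
truncated sets. -/
lemma exists_bound_ipDual_shift (hr₁ : r₁ ∈ Set.Ioo (0 : ℝ) (1 / 2))
    (hinv : ∀ D : ℕ, (M.infoD A D).IsInvertible)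
    (h10 : ∀ j, Tendsto (fun N => rate r₁ N * M.ipNorm N (M.psiBar A (M.D N) j)) atTop (𝓝 0))
    (v : EuclideanSpace ℝ (Fin k)) :
    ∃ q : ℕ → ℝ, Tendsto q atTop (𝓝 0) ∧ ∀ᶠ N in atTop,
      M.ipNorm N (M.shift A N v) ≤ q N ∧ ∀ (T m : ℝ), ∀ θ ∈ M.truncSet A nR r₁ N T m,
        |M.ipDual N (M.shift A N v) θ| ≤ T * q N := by
  obtain ⟨c, hc, hcD⟩ := M.exists_norm_le_norm_proj_sum
  refine ⟨fun N => (‖A‖ / c * ‖v‖) * ∑ j, rate r₁ N * M.ipNorm N (M.psiBar A (M.D N) j), ?_, ?_⟩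
  · have := (tendsto_finsetSum Finset.univ fun j _ => h10 j).const_mul (‖A‖ / c * ‖v‖)
    simpa using this
  filter_upwards [M.tendsto_D.eventually hcD, eventually_ge_atTop 1] with N hND hN
  have hNpos : (0 : ℝ) < N := by exact_mod_cast hN
  have hsN : 0 < √(N : ℝ) := Real.sqrt_pos.2 hNpos
  have e : M.shift A N v = ∑ j, ((√(N : ℝ))⁻¹ * M.sqrtMap A (M.D N) v j) •
      M.psiBar A (M.D N) j := by
    rw [shift_eq, dir]
    simp [Finset.smul_sum, smul_smul]
  have hcoef : ∀ j, |(√(N : ℝ))⁻¹ * M.sqrtMap A (M.D N) v j| ≤ (√(N : ℝ))⁻¹ * (‖A‖ / c * ‖v‖) := by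
    intro j
    rw [abs_mul, abs_of_pos (inv_pos.2 hsN)]
    gcongr
    exact (PiLp.norm_apply_le _ j).trans (M.norm_sqrtMap_le (hinv _) hc hND v)
  have hrate : (√(N : ℝ))⁻¹ ≤ rate r₁ N := by
    rw [Real.sqrt_eq_rpow, ← Real.rpow_neg hNpos.le]
    exact Real.rpow_le_rpow_of_exponent_le (by exact_mod_cast hN) (by linarith [hr₁.2])
  have hAc : 0 ≤ ‖A‖ / c * ‖v‖ := by positivity
  rw [e, Finset.mul_sum]
  constructor
  · refine (M.ipNorm_sum_le N _ _ _).trans (Finset.sum_le_sum fun j _ => ?_)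
    have h0 := M.ipNorm_nonneg N (M.psiBar A (M.D N) j)
    calc _ ≤ ((√(N : ℝ))⁻¹ * (‖A‖ / c * ‖v‖)) * M.ipNorm N (M.psiBar A (M.D N) j) := by
          gcongr; exact hcoef j
      _ ≤ (rate r₁ N * (‖A‖ / c * ‖v‖)) * M.ipNorm N (M.psiBar A (M.D N) j) := by gcongr
      _ = _ := by ring
  · intro T m θ hθ
    refine (M.abs_ipDual_sum_le N _ _ _ _).trans ?_
    rw [Finset.mul_sum]
    refine Finset.sum_le_sum fun j _ => ?_
    have h0 := M.ipNorm_nonneg N (M.psiBar A (M.D N) j)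
    have h1 := hθ.1 j
    calc _ ≤ ((√(N : ℝ))⁻¹ * (‖A‖ / c * ‖v‖)) *
          (T * √(speed r₁ N) * M.ipNorm N (M.psiBar A (M.D N) j)) :=
          mul_le_mul (hcoef j) h1 (abs_nonneg _) (by positivity)
      _ = _ := by
          rw [sqrt_speed _ hN]
          field_simp

/-- Perturbations of the truncated sets stay in truncated sets. -/
lemma eventually_add_shift_mem_truncSet (hn : IsExtendedNorm nR)
    (hr₁ : r₁ ∈ Set.Ioo (0 : ℝ) (1 / 2)) (hinv : ∀ D : ℕ, (M.infoD A D).IsInvertible)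
    (h1 : ∀ (v : EuclideanSpace ℝ (Fin k)) (m : ℝ), 0 < m →
      Tendsto (fun N => (⨆ θ ∈ M.localSet nR r₁ N m,
          M.L2norm (M.G (M.toΘ (θ + M.shift A N v)) - M.G (M.toΘ θ))) /
        ENNReal.ofReal (rate r₁ N)) atTop (𝓝 0))
    (h2 : ∀ j, Tendsto (fun N : ℕ => nR (M.psiBar A (M.D N) j : H) / ENNReal.ofReal (Real.sqrt N))
      atTop (𝓝 0))
    (h10 : ∀ j, Tendsto (fun N => rate r₁ N * M.ipNorm N (M.psiBar A (M.D N) j)) atTop (𝓝 0))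
    (v : EuclideanSpace ℝ (Fin k)) {T m : ℝ} (hT : 0 < T) (hm : 0 < m) :
    ∀ᶠ N in atTop, ∀ θ ∈ M.truncSet A nR r₁ N T m,
      θ + M.shift A N v ∈ M.truncSet A nR r₁ N (2 * T) (2 * m) := by
  obtain ⟨q, hq0, hq⟩ := exists_bound_ipDual_shift (nR := nR) hr₁ hinv h10 v
  have hs : Tendsto (fun N => T * √(speed r₁ N)) atTop atTop :=
    (Real.tendsto_sqrt_atTop.comp (tendsto_speed hr₁.2)).const_mul_atTop hT
  filter_upwards [hq, hq0.eventually (gt_mem_nhds zero_lt_one), hs.eventually_ge_atTop 1,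
    M.eventually_add_shift_mem hn hinv h1 h2 v hm] with N hN hN1 hN2 hN3 θ hθ
  refine ⟨fun j => ?_, hN3 θ hθ.2⟩
  rw [map_add]
  refine (abs_add_le _ _).trans ?_
  have h3 := hθ.1 j
  have h4 := M.abs_ipDual_le N (M.psiBar A (M.D N) j) (M.shift A N v)
  have h0 := M.ipNorm_nonneg N (M.psiBar A (M.D N) j)
  have h5 : M.ipNorm N (M.shift A N v) ≤ T * √(speed r₁ N) := hN.1.trans (hN1.le.trans hN2)
  have h6 := mul_le_mul_of_nonneg_left h5 h0
  linarith

lemma lintegral_add_prior (N : ℕ) (h : M.E (M.D N)) {F : M.E (M.D N) → ℝ≥0∞} (hF : Measurable F) :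
    ∫⁻ θ, F (θ + h) ∂(M.prior N) = ∫⁻ θ,
      ENNReal.ofReal (Real.exp (M.ipDual N h θ - M.ipDual N h h / 2)) * F θ ∂(M.prior N) := by
  rw [← lintegral_map (f := F) hF (by fun_prop : Measurable fun θ => θ + h), prior_map_add,
    lintegral_withDensity_eq_lintegral_mul _ (by fun_prop) hF]
  rfl

lemma continuous_Psi : Continuous (M.Psi) := by
  refine (PiLp.continuous_toLp 2 _).comp (continuous_pi fun j => ?_)
  fun_prop

lemma continuous_Z (N : ℕ) (ω : ℕ → M.𝒳 × V) : Continuous (M.Z A N ω) := by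
  have h1 : Continuous (Matrix.toEuclideanLin (M.sqrtEffInfo A (M.D N))) :=
    LinearMap.continuous_of_finiteDimensional _
  have h2 : Continuous fun θ : M.E (M.D N) => M.Psi (θ : H) - M.center A N ω :=
    ((continuous_Psi (M := M)).comp continuous_subtype_val).sub continuous_const
  exact Continuous.const_smul (h1.comp h2) (√(N : ℝ))

lemma measurable_center (N : ℕ) : Measurable (M.center A N) := by
  refine measurable_const.add ((PiLp.continuous_toLp 2 _).measurable.comp ?_)
  refine measurable_pi_lambda _ fun j => Measurable.const_mul (Finset.measurable_sum _ fun i _ => ?_) _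
  exact (M.measurable_noise i).inner ((measurable_coe_Lp _).comp (M.measurable_design i))

lemma measurable_Z_prod (N : ℕ) :
    Measurable fun p : (ℕ → M.𝒳 × V) × M.E (M.D N) => M.Z A N p.1 p.2 := by
  have h1 : Measurable (Matrix.toEuclideanLin (M.sqrtEffInfo A (M.D N))) :=
    (LinearMap.continuous_of_finiteDimensional _).measurable
  have h2 : Measurable fun p : (ℕ → M.𝒳 × V) × M.E (M.D N) =>
      M.Psi (p.2 : H) - M.center A N p.1 :=
    (((continuous_Psi (M := M)).comp continuous_subtype_val).measurable.comp measurable_snd).sub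
      ((measurable_center N).comp measurable_fst)
  exact (h1.comp h2).const_smul (√(N : ℝ))

/-- Bounds for the Laplace transform of the restricted posterior, from an expansion of the
log-likelihood and the Cameron–Martin formula. -/
lemma laplace_bounds (N : ℕ) (ω : ℕ → M.𝒳 × V) {S : Set (M.E (M.D N))} (hS : MeasurableSet S)
    (h : M.E (M.D N)) {f : M.E (M.D N) → ℝ} {w s κ : ℝ}
    (hexp : ∀ᵐ θ ∂(M.prior N), θ ∈ S →
      |M.logLik N ω (M.toΘ θ) - M.logLik N ω (M.toΘ (θ + h)) - f θ - s| ≤ w)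
    (hκ : ∀ θ ∈ S, |M.ipDual N h θ| ≤ κ) (hκ' : M.ipDual N h h ≤ κ) :
    ENNReal.ofReal (Real.exp (s - w - 2 * κ)) * M.posterior N ω {θ | θ - h ∈ S} ≤
        ∫⁻ θ in S, ENNReal.ofReal (Real.exp (-f θ)) ∂(M.posterior N ω) ∧
      ∫⁻ θ in S, ENNReal.ofReal (Real.exp (-f θ)) ∂(M.posterior N ω) ≤
        ENNReal.ofReal (Real.exp (s + w + 2 * κ)) := by
  have hmul : ∀ x y : ℝ, ENNReal.ofReal (Real.exp x) * ENNReal.ofReal (Real.exp y) =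
      ENNReal.ofReal (Real.exp (x + y)) := fun x y => by
    rw [Real.exp_add, ENNReal.ofReal_mul (Real.exp_pos _).le]
  have hS' : MeasurableSet {θ | θ - h ∈ S} :=
    (by fun_prop : Measurable fun θ : M.E (M.D N) => θ - h) hS
  set ℓ : M.E (M.D N) → ℝ := fun θ => M.logLik N ω (M.toΘ θ) - 0 with hℓ
  have hℓm : Measurable ℓ := (M.measurable_logLik_right N _ ω).sub_const 0
  have hff := M.ipDual_self_nonneg N h
  -- Cameron–Martin: translation by `h` turns the shifted likelihood on `S` into the likelihood on
  -- the translated set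
  have hshift : ∫⁻ θ, ENNReal.ofReal (Real.exp (ℓ (θ + h))) * S.indicator 1 θ ∂(M.prior N) =
      ∫⁻ θ, ENNReal.ofReal (Real.exp (M.ipDual N h θ - M.ipDual N h h / 2)) *
        (ENNReal.ofReal (Real.exp (ℓ θ)) * {θ | θ - h ∈ S}.indicator 1 θ) ∂(M.prior N) := by
    rw [← lintegral_add_prior N h (F := fun θ => ENNReal.ofReal (Real.exp (ℓ θ)) *
      {θ | θ - h ∈ S}.indicator 1 θ)
      (hℓm.exp.ennreal_ofReal.mul (measurable_one.indicator hS'))]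
    refine lintegral_congr fun θ => ?_
    congr 1
    by_cases hθ : θ ∈ S
    · rw [Set.indicator_of_mem hθ, Set.indicator_of_mem (by simpa using hθ)]; rfl
    · rw [Set.indicator_of_notMem hθ, Set.indicator_of_notMem (by simpa using hθ)]
  have hcm : ∀ θ, θ - h ∈ S → |M.ipDual N h θ - M.ipDual N h h / 2| ≤ 2 * κ := by
    intro θ hθ
    have h1 := abs_le.1 (hκ _ hθ)
    rw [map_sub] at h1
    rw [abs_le]
    constructor <;> linarith [h1.1, h1.2]
  rw [← lintegral_indicator hS, M.lintegral_posterior N ω 0 (S.indicator _)]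
  set den := ∫⁻ θ, ENNReal.ofReal (Real.exp (ℓ θ)) ∂(M.prior N) with hden
  have hpost : M.posterior N ω {θ | θ - h ∈ S} =
      (∫⁻ θ, ENNReal.ofReal (Real.exp (ℓ θ)) * {θ | θ - h ∈ S}.indicator 1 θ ∂(M.prior N)) / den := by
    rw [← lintegral_indicator_one hS', M.lintegral_posterior N ω 0]
  constructor
  · rw [hpost, ← mul_div_assoc]
    refine ENNReal.div_le_div_right ?_ _
    calc ENNReal.ofReal (Real.exp (s - w - 2 * κ)) *
          ∫⁻ θ, ENNReal.ofReal (Real.exp (ℓ θ)) * {θ | θ - h ∈ S}.indicator 1 θ ∂(M.prior N)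
        = ENNReal.ofReal (Real.exp (s - w)) * ∫⁻ θ, ENNReal.ofReal (Real.exp (-(2 * κ))) *
          (ENNReal.ofReal (Real.exp (ℓ θ)) * {θ | θ - h ∈ S}.indicator 1 θ) ∂(M.prior N) := by
          rw [lintegral_const_mul' _ _ ENNReal.ofReal_ne_top, ← mul_assoc, hmul]
          rfl
      _ ≤ ENNReal.ofReal (Real.exp (s - w)) *
          ∫⁻ θ, ENNReal.ofReal (Real.exp (ℓ (θ + h))) * S.indicator 1 θ ∂(M.prior N) := by
          rw [hshift]
          refine mul_le_mul_right (lintegral_mono fun θ => ?_) _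
          by_cases hθ : θ - h ∈ S
          · exact mul_le_mul_left (ENNReal.ofReal_le_ofReal
              (Real.exp_le_exp.2 (abs_le.1 (hcm θ hθ)).1)) _
          · simp [hθ]
      _ = ∫⁻ θ, ENNReal.ofReal (Real.exp (s - w)) *
          (ENNReal.ofReal (Real.exp (ℓ (θ + h))) * S.indicator 1 θ) ∂(M.prior N) := by
          rw [lintegral_const_mul' _ _ ENNReal.ofReal_ne_top]
      _ ≤ _ := by
          refine lintegral_mono_ae ?_
          filter_upwards [hexp] with θ hθe
          by_cases hθ : θ ∈ S
          · rw [Set.indicator_of_mem hθ, Set.indicator_of_mem hθ, Pi.one_apply, mul_one, hmul, hmul]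
            refine ENNReal.ofReal_le_ofReal (Real.exp_le_exp.2 ?_)
            have := (abs_le.1 (hθe hθ)).1
            simp only [hℓ]
            linarith
          · rw [Set.indicator_of_notMem hθ, Set.indicator_of_notMem hθ]
            simp
  · have hden0 : den ≠ 0 := by
      have hi := M.integrable_exp_logLik N ω
      have hpos := integral_exp_pos hi
      have : den = ENNReal.ofReal (∫ θ, Real.exp (M.logLik N ω (M.toΘ θ)) ∂(M.prior N)) := by
        rw [hden, ofReal_integral_eq_lintegral_ofReal hi (ae_of_all _ fun _ => (Real.exp_pos _).le)]
        simp [hℓ]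
      rw [this]
      simpa using hpos
    have hdentop : den ≠ ∞ := by
      have : den ≤ 1 := by
        calc den ≤ ∫⁻ _, 1 ∂(M.prior N) := by
              refine lintegral_mono fun θ => ?_
              rw [← ENNReal.ofReal_one]
              refine ENNReal.ofReal_le_ofReal (Real.exp_le_one_iff.2 ?_)
              simpa [hℓ] using M.logLik_nonpos N ω (M.toΘ θ)
          _ = 1 := by simp
      exact (this.trans_lt ENNReal.one_lt_top).ne
    rw [ENNReal.div_le_iff hden0 hdentop]
    calc _ ≤ ∫⁻ θ, ENNReal.ofReal (Real.exp (s + w)) *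
          (ENNReal.ofReal (Real.exp (ℓ (θ + h))) * S.indicator 1 θ) ∂(M.prior N) := by
          refine lintegral_mono_ae ?_
          filter_upwards [hexp] with θ hθe
          by_cases hθ : θ ∈ S
          · rw [Set.indicator_of_mem hθ, Set.indicator_of_mem hθ, Pi.one_apply, mul_one, hmul, hmul]
            refine ENNReal.ofReal_le_ofReal (Real.exp_le_exp.2 ?_)
            have := (abs_le.1 (hθe hθ)).2
            simp only [hℓ]
            linarith
          · rw [Set.indicator_of_notMem hθ, Set.indicator_of_notMem hθ]
            simp
      _ = ENNReal.ofReal (Real.exp (s + w)) *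
          ∫⁻ θ, ENNReal.ofReal (Real.exp (ℓ (θ + h))) * S.indicator 1 θ ∂(M.prior N) :=
          lintegral_const_mul' _ _ ENNReal.ofReal_ne_top
      _ ≤ ENNReal.ofReal (Real.exp (s + w)) * ∫⁻ θ, ENNReal.ofReal (Real.exp (2 * κ)) *
          ENNReal.ofReal (Real.exp (ℓ θ)) ∂(M.prior N) := by
          rw [hshift]
          refine mul_le_mul_right (lintegral_mono fun θ => ?_) _
          by_cases hθ : θ - h ∈ S
          · refine mul_le_mul' (ENNReal.ofReal_le_ofReal
              (Real.exp_le_exp.2 (abs_le.1 (hcm θ hθ)).2)) ?_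
            simp [hθ]
          · simp [hθ]
      _ = _ := by
          rw [lintegral_const_mul' _ _ ENNReal.ofReal_ne_top, ← mul_assoc, hmul]

end Laplace

section Laplace

variable {d k : ℕ} {H V : Type*}
  [NormedAddCommGroup H] [InnerProductSpace ℝ H] [CompleteSpace H]
  [MeasurableSpace H] [BorelSpace H]
  [NormedAddCommGroup V] [InnerProductSpace ℝ V] [FiniteDimensional ℝ V]
  [MeasurableSpace V] [BorelSpace V] {M : Model d k H V} {A : H →L[ℝ] Lp V 2 M.lam}
  {nR : H → ℝ≥0∞} {r₁ r₂ M₀ a b c : ℝ}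

/-- Posterior contraction onto the truncated local sets. -/
lemma PosteriorContraction.truncSet (hcontr : M.PosteriorContraction nR r₁ r₂ M₀ a b c) :
    IsBigOInProb M.P (fun N ω =>
        1 - (M.posterior N ω).real (M.truncSet A nR r₁ N (√(2 * (c + 1))) M₀))
      (fun N => Real.exp (-b * speed r₁ N)) ∧
    Tendsto (fun N => M.P {ω | Real.exp (-a * speed r₁ N) <
      ∫ θ in M.truncSet A nR r₁ N (√(2 * (c + 1))) M₀,
        Real.exp (M.logLik N ω (M.toΘ θ) - M.logLik N ω M.θ₀) ∂(M.prior N)}) atTop (𝓝 1) := by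
  have hc : 0 < c := hcontr.a_pos.trans (hcontr.a_lt_b.trans hcontr.b_lt_c)
  exact hcontr.contraction _ (fun N => M.measurableSet_ipDual_le A r₁ N _)
    (M.eventually_prior_truncation_ge hcontr.r₁_mem.2 hc)

lemma PosteriorContraction.tendsto_exp_speed (hcontr : M.PosteriorContraction nR r₁ r₂ M₀ a b c) :
    Tendsto (fun N => Real.exp (-b * speed r₁ N)) atTop (𝓝 0) := by
  have hb : 0 < b := hcontr.a_pos.trans hcontr.a_lt_b
  have h1 : Tendsto (fun N => b * speed r₁ N) atTop atTop :=
    (tendsto_speed hcontr.r₁_mem.2).const_mul_atTop hb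
  refine (Real.tendsto_exp_neg_atTop_nhds_zero.comp h1).congr fun N => ?_
  simp

lemma PosteriorContraction.tendsto_posterior (hcontr : M.PosteriorContraction nR r₁ r₂ M₀ a b c) :
    Tendsto (fun p : ℕ × (ℕ → M.𝒳 × V) => M.posterior p.1 p.2
      (M.truncSet A nR r₁ p.1 (√(2 * (c + 1))) M₀)) (inProb M.P) (𝓝 1) := by
  have h := (hcontr.truncSet (A := A)).1.tendsto_mul (κ := fun _ => 1) (fun _ => zero_le_one)
    (fun _ => (Real.exp_pos _).le) (by simpa using hcontr.tendsto_exp_speed)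
  have h2 := (ENNReal.tendsto_ofReal (h.const_sub 1))
  simp only [one_mul, sub_sub_cancel, sub_zero, ENNReal.ofReal_one] at h2
  refine h2.congr fun p => ?_
  rw [measureReal_def, ENNReal.ofReal_toReal (measure_ne_top _ _)]

/-- The Laplace transform of `Z_N` under the truncated posterior converges to the one of the
standard Gaussian law. -/
lemma tendsto_laplace (hcontr : M.PosteriorContraction nR r₁ r₂ M₀ a b c)
    (hshift : ∀ (v : EuclideanSpace ℝ (Fin k)) {T m : ℝ}, 0 < T → 0 < m →
      ∀ᶠ N in atTop, ∀ θ ∈ M.truncSet A nR r₁ N T m,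
        θ + M.shift A N v ∈ M.truncSet A nR r₁ N (2 * T) (2 * m))
    {q : ℕ → ℝ} (hq0 : Tendsto q atTop (𝓝 0)) (v : EuclideanSpace ℝ (Fin k))
    (hq : ∀ᶠ N in atTop, M.ipNorm N (M.shift A N v) ≤ q N ∧
      ∀ (T m : ℝ), ∀ θ ∈ M.truncSet A nR r₁ N T m, |M.ipDual N (M.shift A N v) θ| ≤ T * q N)
    {W : ℕ → (ℕ → M.𝒳 × V) → ℝ≥0∞} (hWm : ∀ᶠ N in atTop, Measurable (W N))
    (hW0 : Tendsto (fun p : ℕ × (ℕ → M.𝒳 × V) => W p.1 p.2) (inProb M.P) (𝓝 0))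
    (hW : ∀ᶠ N in atTop, ∀ θ ∈ M.localSet nR r₁ N (4 * M₀),
      θ + M.shift A N v ∈ M.localSet nR r₁ N (4 * M₀) →
        ∀ᵐ ω ∂M.P, ENNReal.ofReal |M.logLik N ω (M.toΘ θ) -
          M.logLik N ω (M.toΘ (θ + M.shift A N v)) - ⟪v, M.Z A N ω θ⟫ - ‖v‖ ^ 2 / 2| ≤ W N ω) :
    Tendsto (fun p : ℕ × (ℕ → M.𝒳 × V) =>
      ∫⁻ θ in M.truncSet A nR r₁ p.1 (2 * √(2 * (c + 1))) (2 * M₀),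
        ENNReal.ofReal (Real.exp (-⟪v, M.Z A p.1 p.2 θ⟫)) ∂(M.posterior p.1 p.2))
      (inProb M.P) (𝓝 (ENNReal.ofReal (Real.exp (‖v‖ ^ 2 / 2)))) := by
  have hc : 0 < c := hcontr.a_pos.trans (hcontr.a_lt_b.trans hcontr.b_lt_c)
  have hM₀ := hcontr.M₀_pos
  set T := √(2 * (c + 1)) with hTdef
  have hT : 0 < T := Real.sqrt_pos.2 (by linarith)
  -- `2 * κ` bounds the logarithm of the Cameron–Martin density on the truncated set
  set κ : ℕ → ℝ := fun N => 2 * T * |q N| + q N ^ 2 with hκ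
  have hκ0 : Tendsto κ atTop (𝓝 0) := by
    simpa using (hq0.abs.const_mul (2 * T)).add (hq0.pow 2)
  -- almost surely, the expansion holds for almost every parameter
  have hae : ∀ᶠ N in atTop, ∀ᵐ ω ∂M.P, ∀ᵐ θ ∂(M.prior N),
      θ ∈ M.truncSet A nR r₁ N (2 * T) (2 * M₀) → ENNReal.ofReal |M.logLik N ω (M.toΘ θ) -
        M.logLik N ω (M.toΘ (θ + M.shift A N v)) - ⟪v, M.Z A N ω θ⟫ - ‖v‖ ^ 2 / 2| ≤ W N ω := by
    filter_upwards [hW, hWm, hshift v (T := 2 * T) (m := 2 * M₀) (by linarith) (by linarith)]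
      with N hWN hWmN hsh
    have hms : MeasurableSet {p : (ℕ → M.𝒳 × V) × M.E (M.D N) |
        p.2 ∈ M.truncSet A nR r₁ N (2 * T) (2 * M₀) → ENNReal.ofReal |M.logLik N p.1 (M.toΘ p.2) -
          M.logLik N p.1 (M.toΘ (p.2 + M.shift A N v)) - ⟪v, M.Z A N p.1 p.2⟫ - ‖v‖ ^ 2 / 2| ≤
            W N p.1} := by
      have m1 : MeasurableSet {p : (ℕ → M.𝒳 × V) × M.E (M.D N) |
          p.2 ∈ M.truncSet A nR r₁ N (2 * T) (2 * M₀)} :=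
        measurable_snd (M.measurableSet_truncSet hcontr.norm N _ _)
      have m2 : Measurable fun p : (ℕ → M.𝒳 × V) × M.E (M.D N) =>
          M.logLik N p.1 (M.toΘ (p.2 + M.shift A N v)) :=
        M.measurable_logLik_comp N measurable_fst (measurable_snd.add_const _)
      have m3 : Measurable fun p : (ℕ → M.𝒳 × V) × M.E (M.D N) => ⟪v, M.Z A N p.1 p.2⟫ :=
        measurable_const.inner (measurable_Z_prod N)
      have m4 : Measurable fun p : (ℕ → M.𝒳 × V) × M.E (M.D N) =>
          M.logLik N p.1 (M.toΘ p.2) - M.logLik N p.1 (M.toΘ (p.2 + M.shift A N v)) -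
            ⟪v, M.Z A N p.1 p.2⟫ - ‖v‖ ^ 2 / 2 :=
        (((M.measurable_logLik_comp N measurable_fst measurable_snd).sub m2).sub m3).sub_const _
      exact m1.imp (measurableSet_le m4.norm.ennreal_ofReal (hWmN.comp measurable_fst))
    refine (Measure.ae_ae_comm hms).2 (ae_of_all _ fun θ => ?_)
    by_cases hθ : θ ∈ M.truncSet A nR r₁ N (2 * T) (2 * M₀)
    · have h1 := hsh θ hθ
      filter_upwards [hWN θ (M.localSet_mono (by linarith) hθ.2)
        (M.localSet_mono (by linarith) h1.2)] with ω hω _ using hω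
    · exact ae_of_all _ fun ω h => absurd h hθ
  have hae' := eventually_inProb_of_ae (P := M.P) hae
  -- the translate of the truncated set contains a smaller truncated set, of posterior probability
  -- close to one
  have hbounds : ∀ᶠ p : ℕ × (ℕ → M.𝒳 × V) in inProb M.P,
      ENNReal.ofReal (Real.exp (‖v‖ ^ 2 / 2 - (W p.1 p.2).toReal - 2 * κ p.1)) *
          M.posterior p.1 p.2 (M.truncSet A nR r₁ p.1 T M₀) ≤
        ∫⁻ θ in M.truncSet A nR r₁ p.1 (2 * T) (2 * M₀),
          ENNReal.ofReal (Real.exp (-⟪v, M.Z A p.1 p.2 θ⟫)) ∂(M.posterior p.1 p.2) ∧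
      ∫⁻ θ in M.truncSet A nR r₁ p.1 (2 * T) (2 * M₀),
          ENNReal.ofReal (Real.exp (-⟪v, M.Z A p.1 p.2 θ⟫)) ∂(M.posterior p.1 p.2) ≤
        ENNReal.ofReal (Real.exp (‖v‖ ^ 2 / 2 + (W p.1 p.2).toReal + 2 * κ p.1)) := by
    filter_upwards [hae', hW0.eventually (gt_mem_nhds zero_lt_one),
      tendsto_fst_inProb.eventually hq, tendsto_fst_inProb.eventually (hshift (-v) hT hM₀)]
      with p h1 h2 h3 h4
    obtain ⟨N, ω⟩ := p
    have hWtop : W N ω ≠ ∞ := (h2.trans ENNReal.one_lt_top).ne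
    have hb := laplace_bounds N ω (M.measurableSet_truncSet hcontr.norm N (2 * T) (2 * M₀))
      (M.shift A N v) (f := fun θ => ⟪v, M.Z A N ω θ⟫) (w := (W N ω).toReal) (s := ‖v‖ ^ 2 / 2)
      (κ := κ N) (by
        filter_upwards [h1] with θ hθ hmem
        exact (ENNReal.ofReal_le_iff_le_toReal hWtop).1 (hθ hmem))
      (fun θ hθ => (h3.2 _ _ θ hθ).trans (by
        have : 2 * T * q N ≤ 2 * T * |q N| := by gcongr; exact le_abs_self _
        simp only [hκ]
        nlinarith [sq_nonneg (q N)]))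
      (by
        rw [← M.ipNorm_sq]
        have h5 : M.ipNorm N (M.shift A N v) ^ 2 ≤ q N ^ 2 :=
          pow_le_pow_left₀ (M.ipNorm_nonneg N _) h3.1 2
        have h6 : 0 ≤ 2 * T * |q N| := by positivity
        simp only [hκ]
        linarith)
    refine ⟨le_trans ?_ hb.1, hb.2⟩
    refine mul_le_mul_right (measure_mono fun θ hθ => ?_) _
    have := h4 θ hθ
    rw [shift_neg, ← sub_eq_add_neg] at this
    exact this
  have hWr : Tendsto (fun p : ℕ × (ℕ → M.𝒳 × V) => (W p.1 p.2).toReal) (inProb M.P) (𝓝 0) :=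
    (ENNReal.tendsto_toReal ENNReal.zero_ne_top).comp hW0
  have hκp := hκ0.comp (tendsto_fst_inProb (P := M.P))
  have hlow : Tendsto (fun p : ℕ × (ℕ → M.𝒳 × V) =>
      ENNReal.ofReal (Real.exp (‖v‖ ^ 2 / 2 - (W p.1 p.2).toReal - 2 * κ p.1)) *
          M.posterior p.1 p.2 (M.truncSet A nR r₁ p.1 T M₀)) (inProb M.P)
      (𝓝 (ENNReal.ofReal (Real.exp (‖v‖ ^ 2 / 2)))) := by
    have h1 := ENNReal.tendsto_ofReal ((Real.continuous_exp.tendsto _).comp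
      ((hWr.const_sub (‖v‖ ^ 2 / 2)).sub (hκp.const_mul 2)))
    have h2 := ENNReal.Tendsto.mul h1 (Or.inr ENNReal.one_ne_top)
      (hcontr.tendsto_posterior (A := A)) (Or.inr ENNReal.ofReal_ne_top)
    simp only [sub_zero, mul_zero, mul_one] at h2
    exact h2
  have hup : Tendsto (fun p : ℕ × (ℕ → M.𝒳 × V) =>
      ENNReal.ofReal (Real.exp (‖v‖ ^ 2 / 2 + (W p.1 p.2).toReal + 2 * κ p.1))) (inProb M.P)
      (𝓝 (ENNReal.ofReal (Real.exp (‖v‖ ^ 2 / 2)))) := by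
    have h1 := ENNReal.tendsto_ofReal ((Real.continuous_exp.tendsto _).comp
      ((hWr.const_add (‖v‖ ^ 2 / 2)).add (hκp.const_mul 2)))
    simpa using h1
  exact tendsto_of_tendsto_of_tendsto_of_le_of_le' hlow hup (hbounds.mono fun _ h => h.1)
    (hbounds.mono fun _ h => h.2)

end Laplace

/-! ### Second moments off the truncated sets -/

section Moments

variable {d k : ℕ} {H V : Type*}
  [NormedAddCommGroup H] [InnerProductSpace ℝ H] [CompleteSpace H]
  [MeasurableSpace H] [BorelSpace H]
  [NormedAddCommGroup V] [InnerProductSpace ℝ V] [FiniteDimensional ℝ V]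
  [MeasurableSpace V] [BorelSpace V] {M : Model d k H V} {A : H →L[ℝ] Lp V 2 M.lam}
  {nR : H → ℝ≥0∞} {r₁ r₂ M₀ a b c : ℝ}

/-- Powers of `N` are negligible with respect to exponentials of the speed `s_N`. -/
lemma tendsto_pow_mul_exp_speed {ρ : ℝ} (hρ : ρ < 1 / 2) (n : ℕ) {γ : ℝ} (hγ : 0 < γ) :
    Tendsto (fun N : ℕ => (N : ℝ) ^ n * Real.exp (-γ * speed ρ N)) atTop (𝓝 0) := by
  have hpos : 0 < 1 - 2 * ρ := by linarith
  have h1 := (tendsto_rpow_mul_exp_neg_mul_atTop_nhds_zero (n / (1 - 2 * ρ)) γ hγ).comp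
    (tendsto_speed hρ)
  refine h1.congr' ?_
  filter_upwards [eventually_ge_atTop 1] with N hN
  have hNpos : (0 : ℝ) < N := by exact_mod_cast hN
  have hs : speed ρ N = (N : ℝ) ^ (1 - 2 * ρ) := by
    rw [speed, rate, ← Real.rpow_natCast, ← Real.rpow_mul hNpos.le]
    nth_rewrite 1 [← Real.rpow_one (N : ℝ)]
    rw [← Real.rpow_add hNpos]
    congr 1
    push_cast
    ring
  simp only [Function.comp]
  congr 1
  rw [hs, ← Real.rpow_mul hNpos.le, mul_div_cancel₀ _ hpos.ne', Real.rpow_natCast]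

variable (A) in
/-- The fluctuation of the centering statistic on the scale of `Z_N`. -/
def fluct (N : ℕ) (ω : ℕ → M.𝒳 × V) : EuclideanSpace ℝ (Fin k) :=
  √(N : ℝ) • M.sqrtMap A (M.D N) (M.center A N ω - M.Psi M.θ₀)

lemma measurable_fluct (N : ℕ) : Measurable (fluct A N) := by
  have h1 : Measurable (M.sqrtMap A (M.D N)) :=
    (LinearMap.continuous_of_finiteDimensional _).measurable
  exact Measurable.const_smul (h1.comp ((measurable_center N).sub_const _)) (√(N : ℝ))

lemma norm_Psi_le (u : H) : ‖M.Psi u‖ ≤ (∑ j, ‖M.ψ j‖) * ‖u‖ := by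
  rcases (norm_nonneg (M.Psi u)).eq_or_lt with h0 | h0
  · rw [← h0]; positivity
  refine le_of_mul_le_mul_left ?_ h0
  rw [← real_inner_self_eq_norm_mul_norm, inner_Psi, Finset.sum_mul, Finset.mul_sum]
  refine (le_abs_self _).trans ((Finset.abs_sum_le_sum_abs _ _).trans
    (Finset.sum_le_sum fun j _ => ?_))
  rw [abs_mul]
  gcongr
  · exact PiLp.norm_apply_le (M.Psi u) j
  · exact abs_real_inner_le_norm _ _

/-- `‖Z_N‖` grows at most linearly in the parameter. -/
lemma norm_Z_le {N : ℕ} {K : ℝ} (hK : ∀ y, ‖M.sqrtMap A (M.D N) y‖ ≤ K * ‖y‖)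
    (ω : ℕ → M.𝒳 × V) (θ : M.E (M.D N)) (hK0 : 0 ≤ K) :
    ‖M.Z A N ω θ‖ ≤ √N * (K * ((∑ j, ‖M.ψ j‖) * (‖(θ : H)‖ + ‖(M.θ₀ : H)‖))) +
      ‖fluct A N ω‖ := by
  have e : M.Z A N ω θ = √(N : ℝ) • M.sqrtMap A (M.D N) (M.Psi ((θ : H) - M.θ₀)) - fluct A N ω := by
    rw [fluct, ← smul_sub, ← map_sub, Psi_sub]
    have : M.Psi θ - M.Psi M.θ₀ - (M.center A N ω - M.Psi M.θ₀) = M.Psi θ - M.center A N ω := by abel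
    rw [this]
    rfl
  rw [e]
  refine (norm_sub_le _ _).trans ?_
  gcongr
  rw [norm_smul, Real.norm_of_nonneg (Real.sqrt_nonneg _)]
  gcongr
  refine (hK _).trans ?_
  gcongr
  refine (norm_Psi_le _).trans ?_
  gcongr
  exact norm_sub_le _ _

/-- As the likelihood is bounded by one, the posterior is dominated by a multiple of the prior. -/
lemma posterior_le_smul (N : ℕ) (ω : ℕ → M.𝒳 × V) :
    ∃ C : ℝ≥0∞, C ≠ ∞ ∧ M.posterior N ω ≤ C • M.prior N := by
  refine ⟨ENNReal.ofReal (1 / ∫ θ, Real.exp (M.logLik N ω (M.toΘ θ)) ∂(M.prior N)),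
    ENNReal.ofReal_ne_top, ?_⟩
  refine Measure.le_iff.2 fun s hs => ?_
  rw [posterior, tilted_apply' _ _ hs, Measure.smul_apply, smul_eq_mul, ← setLIntegral_const]
  refine lintegral_mono fun θ => ENNReal.ofReal_le_ofReal ?_
  have := integral_exp_pos (M.integrable_exp_logLik N ω)
  gcongr
  exact Real.exp_le_one_iff.2 (M.logLik_nonpos N ω _)

/-- `Z_N` has finite second posterior moments. -/
lemma memLp_Z (N : ℕ) (ω : ℕ → M.𝒳 × V) : MemLp (M.Z A N ω) 2 (M.posterior N ω) := by
  obtain ⟨C, hC, hle⟩ := posterior_le_smul (M := M) N ω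
  refine MemLp.of_measure_le_smul hC hle ?_
  set S := LinearMap.toContinuousLinearMap (M.sqrtMap A (M.D N)) with hS
  have hK : ∀ y, ‖M.sqrtMap A (M.D N) y‖ ≤ ‖S‖ * ‖y‖ := fun y => S.le_opNorm y
  have h1 : MemLp (fun θ : M.E (M.D N) => (√N * (‖S‖ * (∑ j, ‖M.ψ j‖))) * ‖θ‖ +
      (√N * (‖S‖ * ((∑ j, ‖M.ψ j‖) * ‖(M.θ₀ : H)‖)) + ‖fluct A N ω‖)) 2 (M.prior N) :=
    ((IsGaussian.memLp_id (M.prior N) 2 (by simp)).norm.const_mul _).add (memLp_const _)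
  refine h1.mono (continuous_Z N ω).aestronglyMeasurable (ae_of_all _ fun θ => ?_)
  refine (norm_Z_le hK ω θ (norm_nonneg _)).trans ((le_of_eq ?_).trans (le_abs_self _))
  rw [show ‖θ‖ = ‖(θ : H)‖ from rfl]
  ring

/-- The fluctuations of the centering statistic grow at most polynomially. -/
lemma tendsto_fluct (hinv : ∀ D : ℕ, (M.infoD A D).IsInvertible) :
    Tendsto (fun p : ℕ × (ℕ → M.𝒳 × V) => ENNReal.ofReal (‖fluct A p.1 p.2‖ ^ 2 / (p.1 : ℝ) ^ 2))
      (inProb M.P) (𝓝 0) := by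
  obtain ⟨c, hc, hcD⟩ := M.exists_norm_le_norm_proj_sum
  set Cε := ∫⁻ e, ENNReal.ofReal (‖e‖ ^ 2) ∂(stdGaussian V) with hCε
  have hCfin : Cε ≠ ∞ := by
    have h1 := (IsGaussian.memLp_id (stdGaussian V) 2 (by simp)).integrable_norm_pow (by norm_num)
    have h2 := h1.lintegral_lt_top
    exact h2.ne
  refine tendsto_inProb_of_lintegral (X := fun N ω =>
    ENNReal.ofReal (‖fluct A N ω‖ ^ 2 / (N : ℝ) ^ 2)) (Eventually.of_forall fun N =>
    (((measurable_fluct N).norm.pow_const 2).div_const _).ennreal_ofReal.aemeasurable) ?_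
  have hlim : Tendsto (fun N : ℕ => (k : ℝ≥0∞) * Cε * (N : ℝ≥0∞)⁻¹) atTop (𝓝 0) := by
    have := ENNReal.Tendsto.const_mul ENNReal.tendsto_inv_nat_nhds_zero
      (Or.inr (ENNReal.mul_ne_top (ENNReal.natCast_ne_top k) hCfin))
    simpa using this
  refine tendsto_of_tendsto_of_tendsto_of_le_of_le' tendsto_const_nhds hlim
    (Eventually.of_forall fun _ => zero_le) ?_
  filter_upwards [M.tendsto_D.eventually hcD, eventually_ge_atTop 1] with N hND hN
  have hNpos : (0 : ℝ) < N := by exact_mod_cast hN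
  -- the coordinates of the fluctuation are sums over the noise; a crude bound for their second
  -- moments suffices
  let u : Fin k → EuclideanSpace ℝ (Fin k) := fun j => EuclideanSpace.single j 1
  let f : Fin k → M.𝒳 → V := fun j x => A (M.shift A N (u j) : H) x
  have hfm : ∀ j, Measurable (f j) := fun j => measurable_coe_Lp _
  have hcoord : ∀ᵐ ω ∂M.P, ∀ j, fluct A N ω j =
      ∑ i ∈ Finset.range N, ⟪M.noise ω i, f j (ω i).1⟫ := by
    refine ae_all_iff.2 fun j => ?_
    filter_upwards [inner_Z (M := M) (A := A) N hN (u j) 0] with ω hω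
    have e1 : ∀ y : EuclideanSpace ℝ (Fin k), ⟪u j, y⟫ = y j := fun y => by
      simpa using EuclideanSpace.inner_single_left j (1 : ℝ) y
    have e2 : M.Z A N ω 0 = √(N : ℝ) • M.sqrtMap A (M.D N) (M.Psi (0 : H) - M.Psi M.θ₀) -
        fluct A N ω := by
      rw [fluct, ← smul_sub, ← map_sub]
      have : M.Psi (0 : H) - M.Psi M.θ₀ - (M.center A N ω - M.Psi M.θ₀) =
        M.Psi (0 : H) - M.center A N ω := by abel
      rw [this]
      rfl
    rw [e2, inner_sub_right, real_inner_smul_right, M.inner_sqrtMap, e1] at hω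
    simp only [ZeroMemClass.coe_zero] at hω
    linarith
  have hA : ∀ j, ∫⁻ x, ENNReal.ofReal (‖f j x‖ ^ 2) ∂M.lam = ENNReal.ofReal (1 / N) := by
    intro j
    have h1 : Integrable (fun x => ‖f j x‖ ^ 2) M.lam :=
      (Lp.memLp (A (M.shift A N (u j) : H))).integrable_norm_pow (by norm_num)
    rw [← ofReal_integral_eq_lintegral_ofReal h1 (ae_of_all _ fun x => by positivity)]
    congr 1
    have e1 : ∫ x, ‖f j x‖ ^ 2 ∂M.lam = ‖A (M.shift A N (u j) : H)‖ ^ 2 := by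
      rw [← real_inner_self_eq_norm_sq (A (M.shift A N (u j) : H)), L2.inner_def]
      simp_rw [real_inner_self_eq_norm_sq]
      rfl
    have e2 : A (M.shift A N (u j) : H) =
        (√(N : ℝ))⁻¹ • A (M.dir A (M.D N) (M.sqrtMap A (M.D N) (u j)) : H) := by
      rw [M.shift_eq]; simp
    rw [e1, e2, norm_smul, M.norm_A_dir_sqrtMap (hinv _) hc hND, norm_inv,
      Real.norm_of_nonneg (Real.sqrt_nonneg _), mul_pow, inv_pow, Real.sq_sqrt hNpos.le]
    simp [u]
  have hterm : ∀ j i, ∫⁻ ω, ENNReal.ofReal (‖M.noise ω i‖ ^ 2) *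
      ENNReal.ofReal (‖f j (ω i).1‖ ^ 2) ∂M.P = Cε * ENNReal.ofReal (1 / N) := by
    intro j i
    have hF : Measurable fun z : M.𝒳 × V =>
        ENNReal.ofReal (‖z.2‖ ^ 2) * ENNReal.ofReal (‖f j z.1‖ ^ 2) := by
      have : Measurable fun z : M.𝒳 × V => f j z.1 := (hfm j).comp measurable_fst
      exact ((measurable_snd.norm.pow_const 2).ennreal_ofReal).mul
        ((this.norm.pow_const 2).ennreal_ofReal)
    have hmp : MeasurePreserving (fun ω : ℕ → M.𝒳 × V => ω i) M.P M.obsLaw :=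
      measurePreserving_eval_infinitePi (fun _ : ℕ => M.obsLaw) i
    have hm : Measurable fun z : M.𝒳 × V => (z.1, z.2 - M.G M.θ₀ z.1) :=
      measurable_fst.prodMk (measurable_snd.sub ((M.measurable_G_apply M.θ₀).comp measurable_fst))
    have h1 := hmp.lintegral_comp (hF.comp hm)
    have h2 := M.lintegral_obsLaw hF
    have h3 : ∫⁻ x, ∫⁻ e, ENNReal.ofReal (‖e‖ ^ 2) * ENNReal.ofReal (‖f j x‖ ^ 2)
        ∂(stdGaussian V) ∂M.lam = Cε * ENNReal.ofReal (1 / N) := by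
      simp_rw [lintegral_mul_const' _ _ ENNReal.ofReal_ne_top]
      rw [lintegral_const_mul' _ _ hCfin, hA]
    rw [← h3, ← h2]
    exact h1
  have hpt : ∀ᵐ ω ∂M.P, ENNReal.ofReal (‖fluct A N ω‖ ^ 2 / (N : ℝ) ^ 2) ≤
      ENNReal.ofReal (1 / N) * ∑ j : Fin k, ∑ i ∈ Finset.range N, ENNReal.ofReal (‖M.noise ω i‖ ^ 2) *
        ENNReal.ofReal (‖f j (ω i).1‖ ^ 2) := by
    filter_upwards [hcoord] with ω hω
    have h1 : ‖fluct A N ω‖ ^ 2 ≤ N * ∑ j : Fin k, ∑ i ∈ Finset.range N,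
        ‖M.noise ω i‖ ^ 2 * ‖f j (ω i).1‖ ^ 2 := by
      rw [EuclideanSpace.norm_sq_eq, Finset.mul_sum]
      refine Finset.sum_le_sum fun j _ => ?_
      rw [hω j, Real.norm_eq_abs, sq_abs]
      refine (sq_sum_le_card_mul_sum_sq).trans ?_
      rw [Finset.card_range]
      gcongr with i
      rw [← mul_pow, ← sq_abs]
      gcongr
      exact abs_real_inner_le_norm _ _
    have e : ∑ j : Fin k, ∑ i ∈ Finset.range N, ENNReal.ofReal (‖M.noise ω i‖ ^ 2) *
        ENNReal.ofReal (‖f j (ω i).1‖ ^ 2) = ENNReal.ofReal (∑ j : Fin k, ∑ i ∈ Finset.range N,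
        ‖M.noise ω i‖ ^ 2 * ‖f j (ω i).1‖ ^ 2) := by
      rw [ENNReal.ofReal_sum_of_nonneg fun j _ => by positivity]
      refine Finset.sum_congr rfl fun j _ => ?_
      rw [ENNReal.ofReal_sum_of_nonneg fun i _ => by positivity]
      exact Finset.sum_congr rfl fun i _ => (ENNReal.ofReal_mul (by positivity)).symm
    rw [e, ← ENNReal.ofReal_mul (by positivity)]
    refine ENNReal.ofReal_le_ofReal ?_
    rw [div_le_iff₀ (by positivity)]
    refine h1.trans (le_of_eq ?_)
    field_simp
  refine (lintegral_mono_ae hpt).trans (le_of_eq ?_)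
  have hmeas : ∀ j i, Measurable fun ω : ℕ → M.𝒳 × V => ENNReal.ofReal (‖M.noise ω i‖ ^ 2) *
        ENNReal.ofReal (‖f j (ω i).1‖ ^ 2) := fun j i =>
    (((M.measurable_noise i).norm.pow_const 2).ennreal_ofReal).mul
      ((((hfm j).comp (M.measurable_design i)).norm.pow_const 2).ennreal_ofReal)
  rw [lintegral_const_mul' _ _ ENNReal.ofReal_ne_top,
    lintegral_finsetSum _ fun j _ => Finset.measurable_sum _ fun i _ => hmeas j i]
  simp_rw [fun j => lintegral_finsetSum (μ := M.P) (Finset.range N) fun i _ => hmeas j i, hterm]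
  simp only [Finset.sum_const, Finset.card_range, Finset.card_univ, Fintype.card_fin, nsmul_eq_mul]
  have e1 : ENNReal.ofReal (1 / N) = (N : ℝ≥0∞)⁻¹ := by
    rw [one_div, ENNReal.ofReal_inv_of_pos hNpos, ENNReal.ofReal_natCast]
  have e2 : (N : ℝ≥0∞)⁻¹ * N = 1 := ENNReal.inv_mul_cancel (by
    simpa using (by omega : N ≠ 0)) (ENNReal.natCast_ne_top N)
  rw [e1]
  calc _ = ((N : ℝ≥0∞)⁻¹ * N) * ((k : ℝ≥0∞) * Cε * (N : ℝ≥0∞)⁻¹) := by ring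
    _ = _ := by rw [e2, one_mul]

end Moments

section TailMoments

variable {d k : ℕ} {H V : Type*}
  [NormedAddCommGroup H] [InnerProductSpace ℝ H] [CompleteSpace H]
  [MeasurableSpace H] [BorelSpace H]
  [NormedAddCommGroup V] [InnerProductSpace ℝ V] [FiniteDimensional ℝ V]
  [MeasurableSpace V] [BorelSpace V] {M : Model d k H V} {A : H →L[ℝ] Lp V 2 M.lam}
  {nR : H → ℝ≥0∞} {r₁ r₂ M₀ a b c : ℝ}

/-- The posterior mass off the truncated sets beats every factor that is `o(e^{b s_N})`. -/
lemma PosteriorContraction.tendsto_mul_posterior_compl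
    (hcontr : M.PosteriorContraction nR r₁ r₂ M₀ a b c) {κ : ℕ → ℝ} (hκ : ∀ N, 0 ≤ κ N)
    (hlim : Tendsto (fun N => κ N * Real.exp (-b * speed r₁ N)) atTop (𝓝 0)) :
    Tendsto (fun p : ℕ × (ℕ → M.𝒳 × V) => ENNReal.ofReal (κ p.1) * M.posterior p.1 p.2
      (M.truncSet A nR r₁ p.1 (2 * √(2 * (c + 1))) (2 * M₀))ᶜ) (inProb M.P) (𝓝 0) := by
  have h := ENNReal.tendsto_ofReal ((hcontr.truncSet (A := A)).1.tendsto_mul hκ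
    (fun _ => (Real.exp_pos _).le) hlim)
  rw [ENNReal.ofReal_zero] at h
  refine tendsto_of_tendsto_of_tendsto_of_le_of_le tendsto_const_nhds h (fun _ => zero_le)
    fun p => ?_
  simp only
  rw [ENNReal.ofReal_mul (hκ _)]
  refine mul_le_mul_right ?_ _
  rw [← probReal_compl_eq_one_sub (M.measurableSet_truncSet hcontr.norm _ _ _), measureReal_def,
    ENNReal.ofReal_toReal (measure_ne_top _ _)]
  refine measure_mono (Set.compl_subset_compl.2 (M.truncSet_mono ?_ ?_))
  · linarith [Real.sqrt_nonneg (2 * (c + 1))]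
  · linarith [hcontr.M₀_pos]

/-- Likelihood ratios have mean one, so that the numerator of the sixth posterior moment has the
sixth prior moment as its mean; the denominator is the evidence. -/
lemma tendsto_posterior_norm_pow_six (hcontr : M.PosteriorContraction nR r₁ r₂ M₀ a b c)
    (h11 : Tendsto (fun N : ℕ => (N : ℝ) * Real.exp (-(b - a) * speed r₁ N) *
      ∫ θ, ‖(θ : H)‖ ^ 4 ∂(M.prior N)) atTop (𝓝 0)) :
    Tendsto (fun p : ℕ × (ℕ → M.𝒳 × V) =>
      ENNReal.ofReal ((p.1 : ℝ) ^ 5 * Real.exp (-2 * b * speed r₁ p.1)) *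
        ∫⁻ θ, ENNReal.ofReal (‖(θ : H)‖ ^ 6) ∂(M.posterior p.1 p.2)) (inProb M.P) (𝓝 0) := by
  set R : (N : ℕ) → (ℕ → M.𝒳 × V) → M.E (M.D N) → ℝ := fun N ω θ =>
    Real.exp (M.logLik N ω (M.toΘ θ) - M.logLik N ω M.θ₀) with hR
  have hRm : ∀ N, Measurable fun p : (ℕ → M.𝒳 × V) × M.E (M.D N) => R N p.1 p.2 := fun N =>
    ((M.measurable_logLik_comp N measurable_fst measurable_snd).sub
      ((M.measurable_logLik_left N M.θ₀).comp measurable_fst)).exp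
  have hnm : ∀ N, Measurable fun θ : M.E (M.D N) => ENNReal.ofReal (‖(θ : H)‖ ^ 6) := fun N =>
    (measurable_subtype_coe.norm.pow_const 6).ennreal_ofReal
  set num : ℕ → (ℕ → M.𝒳 × V) → ℝ≥0∞ := fun N ω =>
    ∫⁻ θ, ENNReal.ofReal (R N ω θ) * ENNReal.ofReal (‖(θ : H)‖ ^ 6) ∂(M.prior N) with hnum
  have hnum_m : ∀ N, Measurable (num N) := fun N => Measurable.lintegral_prod_right'
    ((hRm N).ennreal_ofReal.mul ((hnm N).comp measurable_snd))
  -- the evidence is at least `e^{-a s_N}` with probability tending to one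
  have hev := eventually_inProb_of_tendsto_one (fun N => measurableSet_lt measurable_const
    ((hRm N).stronglyMeasurable.integral_prod_right'
      (ν := (M.prior N).restrict (Set.univ ∩ M.localSet nR r₁ N M₀))).measurable)
    (hcontr.contraction (fun _ => Set.univ) (fun _ => MeasurableSet.univ)
      (Eventually.of_forall fun N => by simp [Real.exp_nonneg])).2
  have hmean : ∀ N, ∫⁻ ω, num N ω ∂M.P = ENNReal.ofReal (∫ θ, ‖(θ : H)‖ ^ 6 ∂(M.prior N)) := by
    intro N
    have h1 : ∫⁻ ω, num N ω ∂M.P = ∫⁻ θ, ∫⁻ ω, ENNReal.ofReal (R N ω θ) *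
        ENNReal.ofReal (‖(θ : H)‖ ^ 6) ∂M.P ∂(M.prior N) :=
      lintegral_lintegral_swap
        ((hRm N).ennreal_ofReal.mul ((hnm N).comp measurable_snd)).aemeasurable
    rw [h1, ofReal_integral_eq_lintegral_ofReal (M.integrable_norm_pow_prior N 6)
      (ae_of_all _ fun θ => by positivity)]
    refine lintegral_congr fun θ => ?_
    rw [lintegral_mul_const' _ _ ENNReal.ofReal_ne_top, hR]
    simp only
    rw [M.lintegral_likelihood_ratio N (M.toΘ θ), one_mul]
  have hγ : 0 < (a + b) / 2 := by linarith [hcontr.a_pos, hcontr.a_lt_b]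
  have hdet : ∀ᶠ N : ℕ in atTop, (N : ℝ) ^ 5 * Real.exp (-2 * b * speed r₁ N) *
      Real.exp (a * speed r₁ N) * ∫ θ, ‖(θ : H)‖ ^ 6 ∂(M.prior N) ≤
      1440 * Real.exp (1 / 2) * ((N : ℝ) ^ 5 * Real.exp (-((a + b) / 2) * speed r₁ N)) := by
    filter_upwards [h11.eventually (gt_mem_nhds zero_lt_one), eventually_ge_atTop 1] with N h hN
    have hN1 : (1 : ℝ) ≤ N := by exact_mod_cast hN
    set τ := ∫ θ, ‖(θ : H)‖ ^ 4 ∂(M.prior N) with hτ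
    have hτ0 : 0 ≤ τ := integral_nonneg fun θ => by positivity
    have h2 : τ ≤ Real.exp ((b - a) * speed r₁ N) := by
      have h3 : Real.exp (-(b - a) * speed r₁ N) * τ ≤ 1 := by
        refine le_trans ?_ h.le
        rw [mul_assoc]
        exact le_mul_of_one_le_left (by positivity) hN1
      calc τ = Real.exp ((b - a) * speed r₁ N) * (Real.exp (-(b - a) * speed r₁ N) * τ) := by
            rw [← mul_assoc, ← Real.exp_add, neg_mul, add_neg_cancel, Real.exp_zero, one_mul]
        _ ≤ _ := mul_le_of_le_one_right (Real.exp_pos _).le h3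
    have h3 : τ ^ (3 / 2 : ℝ) ≤ Real.exp ((b - a) * speed r₁ N * (3 / 2)) := by
      rw [Real.exp_mul]
      exact Real.rpow_le_rpow hτ0 h2 (by norm_num)
    have h4 := (M.integral_norm_pow_six_le N).trans
      (mul_le_mul_of_nonneg_left h3 (by positivity : (0 : ℝ) ≤ 1440 * Real.exp (1 / 2)))
    calc _ ≤ (N : ℝ) ^ 5 * Real.exp (-2 * b * speed r₁ N) * Real.exp (a * speed r₁ N) *
          (1440 * Real.exp (1 / 2) * Real.exp ((b - a) * speed r₁ N * (3 / 2))) := by gcongr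
      _ = 1440 * Real.exp (1 / 2) * ((N : ℝ) ^ 5 * (Real.exp (-2 * b * speed r₁ N) *
          Real.exp (a * speed r₁ N) * Real.exp ((b - a) * speed r₁ N * (3 / 2)))) := by ring
      _ = _ := by
        rw [← Real.exp_add, ← Real.exp_add]
        congr 4
        ring
  have hY : Tendsto (fun p : ℕ × (ℕ → M.𝒳 × V) => ENNReal.ofReal ((p.1 : ℝ) ^ 5 *
      Real.exp (-2 * b * speed r₁ p.1) * Real.exp (a * speed r₁ p.1)) * num p.1 p.2)
      (inProb M.P) (𝓝 0) := by
    refine tendsto_inProb_of_lintegral (X := fun N ω => ENNReal.ofReal ((N : ℝ) ^ 5 *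
      Real.exp (-2 * b * speed r₁ N) * Real.exp (a * speed r₁ N)) * num N ω)
      (Eventually.of_forall fun N => ((hnum_m N).const_mul _).aemeasurable) ?_
    have hlim := ENNReal.tendsto_ofReal
      ((tendsto_pow_mul_exp_speed hcontr.r₁_mem.2 5 hγ).const_mul (1440 * Real.exp (1 / 2)))
    rw [mul_zero, ENNReal.ofReal_zero] at hlim
    refine tendsto_of_tendsto_of_tendsto_of_le_of_le' tendsto_const_nhds hlim
      (Eventually.of_forall fun _ => zero_le) ?_
    filter_upwards [hdet] with N hN
    rw [lintegral_const_mul' _ _ ENNReal.ofReal_ne_top, hmean, ← ENNReal.ofReal_mul (by positivity)]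
    exact ENNReal.ofReal_le_ofReal hN
  refine tendsto_of_tendsto_of_tendsto_of_le_of_le' tendsto_const_nhds hY
    (Eventually.of_forall fun _ => zero_le) ?_
  filter_upwards [hev] with p hp
  obtain ⟨N, ω⟩ := p
  have hden : ENNReal.ofReal (Real.exp (-a * speed r₁ N)) ≤
      ∫⁻ θ, ENNReal.ofReal (R N ω θ) ∂(M.prior N) := by
    refine (ENNReal.ofReal_le_ofReal hp.le).trans ?_
    rw [integral_eq_lintegral_of_nonneg_ae (ae_of_all _ fun θ => (Real.exp_pos _).le)
      ((hRm N).comp measurable_prodMk_left).aestronglyMeasurable]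
    exact ENNReal.ofReal_toReal_le.trans (setLIntegral_le_lintegral _ _)
  simp only
  rw [M.lintegral_posterior N ω (M.logLik N ω M.θ₀), ENNReal.ofReal_mul (p := (N : ℝ) ^ 5 *
      Real.exp (-2 * b * speed r₁ N)) (by positivity), mul_assoc (ENNReal.ofReal _)]
  refine mul_le_mul_right ?_ _
  rw [ENNReal.div_eq_inv_mul]
  refine mul_le_mul_left ?_ _
  rw [show a * speed r₁ N = -(-a * speed r₁ N) by ring, Real.exp_neg,
    ENNReal.ofReal_inv_of_pos (Real.exp_pos _)]
  exact ENNReal.inv_le_inv.2 hden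

/-- The second posterior moments of `Z_N` off the truncated sets vanish. -/
lemma tendsto_lintegral_norm_Z_sq_compl (hcontr : M.PosteriorContraction nR r₁ r₂ M₀ a b c)
    (hinv : ∀ D : ℕ, (M.infoD A D).IsInvertible)
    (h11 : Tendsto (fun N : ℕ => (N : ℝ) * Real.exp (-(b - a) * speed r₁ N) *
      ∫ θ, ‖(θ : H)‖ ^ 4 ∂(M.prior N)) atTop (𝓝 0)) :
    Tendsto (fun p : ℕ × (ℕ → M.𝒳 × V) =>
      ∫⁻ θ in (M.truncSet A nR r₁ p.1 (2 * √(2 * (c + 1))) (2 * M₀))ᶜ,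
        ENNReal.ofReal (‖M.Z A p.1 p.2 θ‖ ^ 2) ∂(M.posterior p.1 p.2)) (inProb M.P) (𝓝 0) := by
  have hb : 0 < b := hcontr.a_pos.trans hcontr.a_lt_b
  obtain ⟨c', hc', hcD⟩ := M.exists_norm_le_norm_proj_sum
  set K := ‖A‖ / c' * ∑ j, ‖M.ψ j‖ with hK
  have hK0 : 0 ≤ K := by positivity
  set t₀ := ‖(M.θ₀ : H)‖ with ht₀
  -- the posterior mass off the truncated set is `O_P(e^{-b s_N})`, which absorbs these factors
  have l1 := hcontr.tendsto_mul_posterior_compl (A := A)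
    (κ := fun N => Real.exp (b * speed r₁ N) / N) (fun N => by positivity) (by
      refine tendsto_inv_atTop_nhds_zero_nat.congr fun N => ?_
      rw [div_mul_eq_mul_div, ← Real.exp_add]
      simp)
  have l2 := hcontr.tendsto_mul_posterior_compl (A := A)
    (κ := fun N => (N : ℝ)) (fun N => by positivity) (by
      simpa using tendsto_pow_mul_exp_speed hcontr.r₁_mem.2 1 hb)
  have l3 := hcontr.tendsto_mul_posterior_compl (A := A)
    (κ := fun N => (N : ℝ) ^ 2) (fun N => by positivity)
      (tendsto_pow_mul_exp_speed hcontr.r₁_mem.2 2 hb)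
  have l4 := tendsto_posterior_norm_pow_six hcontr h11
  have l5 := tendsto_fluct (A := A) hinv
  have hlim := ((ENNReal.Tendsto.const_mul (a := ENNReal.ofReal (4 * K ^ 2)) (l1.add l4)
    (Or.inr ENNReal.ofReal_ne_top)).add (ENNReal.Tendsto.const_mul
    (a := ENNReal.ofReal (4 * K ^ 2 * t₀ ^ 2)) l2 (Or.inr ENNReal.ofReal_ne_top))).add
    (ENNReal.Tendsto.const_mul (a := 2) (ENNReal.Tendsto.mul l5 (Or.inr ENNReal.zero_ne_top) l3
      (Or.inr ENNReal.zero_ne_top)) (Or.inr ENNReal.ofNat_ne_top))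
  simp only [add_zero, mul_zero] at hlim
  refine tendsto_of_tendsto_of_tendsto_of_le_of_le' tendsto_const_nhds hlim
    (Eventually.of_forall fun _ => zero_le) ?_
  filter_upwards [tendsto_fst_inProb.eventually (M.tendsto_D.eventually hcD),
    tendsto_fst_inProb.eventually (eventually_ge_atTop 1)] with p hp hN
  obtain ⟨N, ω⟩ := p
  simp only at hp hN ⊢
  set S := (M.truncSet A nR r₁ N (2 * √(2 * (c + 1))) (2 * M₀))ᶜ with hS
  set μ := M.posterior N ω with hμ
  set F := ‖fluct A N ω‖ with hF
  set s := speed r₁ N with hs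
  have hNpos : (0 : ℝ) < N := by exact_mod_cast hN
  have hpt : ∀ θ : M.E (M.D N), ‖M.Z A N ω θ‖ ^ 2 ≤ 4 * K ^ 2 * (Real.exp (b * s) / N) +
      4 * K ^ 2 * ((N : ℝ) ^ 5 * Real.exp (-2 * b * s) * ‖(θ : H)‖ ^ 6) +
      4 * K ^ 2 * t₀ ^ 2 * N + 2 * (F ^ 2 / (N : ℝ) ^ 2 * (N : ℝ) ^ 2) := by
    intro θ
    have h1 := norm_Z_le (fun y => M.norm_sqrtMap_le (hinv _) hc' hp y) ω θ (by positivity)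
    have h2 : ‖M.Z A N ω θ‖ ≤ √N * (K * (‖(θ : H)‖ + t₀)) + F := by
      refine h1.trans (le_of_eq ?_)
      rw [hK]; ring
    have h3 : ‖M.Z A N ω θ‖ ^ 2 ≤ 4 * K ^ 2 * (N * ‖(θ : H)‖ ^ 2) + 4 * K ^ 2 * t₀ ^ 2 * N +
        2 * F ^ 2 := by
      refine (pow_le_pow_left₀ (norm_nonneg _) h2 2).trans ?_
      have e : √(N : ℝ) ^ 2 = N := Real.sq_sqrt hNpos.le
      have h4 : (√N * (K * (‖(θ : H)‖ + t₀)) + F) ^ 2 ≤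
          2 * (√N * (K * (‖(θ : H)‖ + t₀))) ^ 2 + 2 * F ^ 2 := by
        nlinarith [sq_nonneg (√N * (K * (‖(θ : H)‖ + t₀)) - F)]
      have h5 : (‖(θ : H)‖ + t₀) ^ 2 ≤ 2 * ‖(θ : H)‖ ^ 2 + 2 * t₀ ^ 2 := by
        nlinarith [sq_nonneg (‖(θ : H)‖ - t₀)]
      have h6 : 2 * (√N * (K * (‖(θ : H)‖ + t₀))) ^ 2 =
          2 * N * K ^ 2 * (‖(θ : H)‖ + t₀) ^ 2 := by
        rw [mul_pow, e]; ring
      have h7 : 2 * N * K ^ 2 * (‖(θ : H)‖ + t₀) ^ 2 ≤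
          2 * N * K ^ 2 * (2 * ‖(θ : H)‖ ^ 2 + 2 * t₀ ^ 2) := by gcongr
      linarith
    -- the threshold `L` balances the tail probability against the sixth moment
    have h4 : (N : ℝ) * ‖(θ : H)‖ ^ 2 ≤ Real.exp (b * s) / N +
        (N : ℝ) ^ 5 * Real.exp (-2 * b * s) * ‖(θ : H)‖ ^ 6 := by
      set x := ‖(θ : H)‖ ^ 2 with hx
      have hx0 : 0 ≤ x := by positivity
      set L := Real.exp (b * s) / (N : ℝ) ^ 2 with hL
      have hL0 : 0 < L := by positivity
      have e1 : Real.exp (b * s) / N = N * L := by rw [hL]; field_simp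
      have e2 : (N : ℝ) ^ 5 * Real.exp (-2 * b * s) * ‖(θ : H)‖ ^ 6 = N * (x ^ 3 / L ^ 2) := by
        rw [hL, hx, show -2 * b * s = -(b * s) + -(b * s) by ring, Real.exp_add, Real.exp_neg]
        field_simp
      rw [e1, e2, ← mul_add]
      gcongr
      rcases le_total x L with h | h
      · have : 0 ≤ x ^ 3 / L ^ 2 := by positivity
        linarith
      · have : x ≤ x ^ 3 / L ^ 2 := by
          rw [le_div_iff₀ (by positivity)]
          nlinarith [pow_le_pow_left₀ hL0.le h 2]
        linarith
    have e3 : F ^ 2 / (N : ℝ) ^ 2 * (N : ℝ) ^ 2 = F ^ 2 := by field_simp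
    rw [e3]
    have h5 := mul_le_mul_of_nonneg_left h4 (by positivity : 0 ≤ 4 * K ^ 2)
    linarith
  have hpt' : ∀ θ : M.E (M.D N), ENNReal.ofReal (‖M.Z A N ω θ‖ ^ 2) ≤
      ENNReal.ofReal (4 * K ^ 2) * ENNReal.ofReal (Real.exp (b * s) / N) +
      ENNReal.ofReal (4 * K ^ 2) * ENNReal.ofReal ((N : ℝ) ^ 5 * Real.exp (-2 * b * s)) *
        ENNReal.ofReal (‖(θ : H)‖ ^ 6) +
      ENNReal.ofReal (4 * K ^ 2 * t₀ ^ 2) * ENNReal.ofReal N +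
      2 * (ENNReal.ofReal (F ^ 2 / (N : ℝ) ^ 2) * ENNReal.ofReal ((N : ℝ) ^ 2)) := by
    intro θ
    refine (ENNReal.ofReal_le_ofReal (hpt θ)).trans (le_of_eq ?_)
    rw [ENNReal.ofReal_add (by positivity) (by positivity),
      ENNReal.ofReal_add (by positivity) (by positivity),
      ENNReal.ofReal_add (by positivity) (by positivity),
      ENNReal.ofReal_mul (p := 4 * K ^ 2) (by positivity),
      ENNReal.ofReal_mul (p := 4 * K ^ 2) (by positivity),
      ENNReal.ofReal_mul (p := 4 * K ^ 2 * t₀ ^ 2) (by positivity),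
      ENNReal.ofReal_mul (p := (2 : ℝ)) (by positivity),
      ENNReal.ofReal_mul (p := F ^ 2 / (N : ℝ) ^ 2) (by positivity),
      ENNReal.ofReal_mul (p := (N : ℝ) ^ 5 * Real.exp (-2 * b * s)) (by positivity),
      ENNReal.ofReal_ofNat, mul_assoc (ENNReal.ofReal (4 * K ^ 2))]
  have hnm : Measurable fun θ : M.E (M.D N) => ENNReal.ofReal (‖(θ : H)‖ ^ 6) :=
    (measurable_subtype_coe.norm.pow_const 6).ennreal_ofReal
  refine (lintegral_mono hpt').trans ?_
  rw [lintegral_add_right _ measurable_const, lintegral_add_right _ measurable_const,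
    lintegral_add_left measurable_const, lintegral_const_mul _ hnm]
  simp only [lintegral_const, Measure.restrict_apply_univ]
  have h6 : ∫⁻ θ in S, ENNReal.ofReal (‖(θ : H)‖ ^ 6) ∂μ ≤ ∫⁻ θ, ENNReal.ofReal (‖(θ : H)‖ ^ 6) ∂μ :=
    setLIntegral_le_lintegral _ _
  calc _ ≤ ENNReal.ofReal (4 * K ^ 2) * ENNReal.ofReal (Real.exp (b * s) / N) * μ S +
      ENNReal.ofReal (4 * K ^ 2) * ENNReal.ofReal ((N : ℝ) ^ 5 * Real.exp (-2 * b * s)) *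
        (∫⁻ θ, ENNReal.ofReal (‖(θ : H)‖ ^ 6) ∂μ) +
      ENNReal.ofReal (4 * K ^ 2 * t₀ ^ 2) * ENNReal.ofReal N * μ S +
      2 * (ENNReal.ofReal (F ^ 2 / (N : ℝ) ^ 2) * ENNReal.ofReal ((N : ℝ) ^ 2)) * μ S := by
        gcongr
    _ = _ := by ring

end TailMoments

end Model

/-! ### Gaussian limits of truncated random vectors -/

section Truncation

variable {k : ℕ} {ι : Type*} {l : Filter ι} {Ω : ι → Type*} [∀ i, MeasurableSpace (Ω i)]
  {ρ : ∀ i, Measure (Ω i)} [∀ i, IsProbabilityMeasure (ρ i)]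
  {Z : ∀ i, Ω i → EuclideanSpace ℝ (Fin k)} {S : ∀ i, Set (Ω i)}

/-- The square of a function of quadratic growth is dominated by finitely many exponentials, so that
convergence of the Laplace transforms gives uniform integrability. -/
lemma exists_sq_le_sum_exp (k : ℕ) :
    ∃ (s : Finset (EuclideanSpace ℝ (Fin k))) (c : ℝ), ∀ x : EuclideanSpace ℝ (Fin k),
      (1 + ‖x‖ ^ 2) ^ 2 ≤ c * ∑ u ∈ s, Real.exp ⟪u, x⟫ := by
  classical
  let e : Fin k → EuclideanSpace ℝ (Fin k) := fun j => EuclideanSpace.single j 1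
  refine ⟨insert 0 (Finset.univ.image e ∪ Finset.univ.image fun j => -e j), 2 + 48 * k ^ 2,
    fun x => ?_⟩
  set s := insert 0 (Finset.univ.image e ∪ Finset.univ.image fun j => -e j) with hs
  set B := ∑ u ∈ s, Real.exp ⟪u, x⟫ with hB
  have hmem : ∀ u ∈ s, Real.exp ⟪u, x⟫ ≤ B := fun u hu =>
    Finset.single_le_sum (f := fun u => Real.exp ⟪u, x⟫) (fun _ _ => (Real.exp_pos _).le) hu
  have h1 : 1 ≤ B := by simpa using hmem 0 (by simp [hs])
  have he : ∀ j, ⟪e j, x⟫ = x j := fun j => by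
    simpa using EuclideanSpace.inner_single_left j (1 : ℝ) x
  have hj : ∀ j, (x j) ^ 4 ≤ 24 * B := by
    intro j
    have h2 : Real.exp |x j| ≤ B := by
      rcases abs_cases (x j) with h | h
      · rw [h.1, ← he]; exact hmem _ (by simp [hs])
      · rw [h.1, ← he, ← inner_neg_left]; exact hmem _ (by simp [hs])
    have h3 := Real.pow_div_factorial_le_exp (x := |x j|) (abs_nonneg _) 4
    have h4 : |x j| ^ 4 = x j ^ 4 := by
      rw [show 4 = 2 * 2 from rfl, pow_mul, sq_abs, ← pow_mul]
    rw [h4, div_le_iff₀ (by positivity)] at h3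
    have h5 : ((Nat.factorial 4 : ℕ) : ℝ) = 24 := by norm_num [Nat.factorial]
    rw [h5] at h3
    linarith
  have h4 : (‖x‖ ^ 2) ^ 2 ≤ 24 * k ^ 2 * B := by
    have e1 : ‖x‖ ^ 2 = ∑ j, x j ^ 2 := by
      rw [EuclideanSpace.norm_sq_eq]
      exact Finset.sum_congr rfl fun j _ => by rw [Real.norm_eq_abs, sq_abs]
    rw [e1]
    refine (sq_sum_le_card_mul_sum_sq).trans ?_
    rw [Finset.card_univ, Fintype.card_fin]
    have h6 : ∑ j, (x j ^ 2) ^ 2 ≤ ∑ _j : Fin k, 24 * B :=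
      Finset.sum_le_sum fun j _ => by rw [← pow_mul]; exact hj j
    rw [Finset.sum_const, Finset.card_univ, Fintype.card_fin, nsmul_eq_mul] at h6
    have := mul_le_mul_of_nonneg_left h6 (Nat.cast_nonneg (α := ℝ) k)
    nlinarith
  nlinarith [sq_nonneg (‖x‖ ^ 2 - 1)]

/-- The law of a random vector truncated to zero off a set. -/
def truncLaw {Ω : Type*} [MeasurableSpace Ω] (ρ : Measure Ω) [IsProbabilityMeasure ρ]
    {Z : Ω → EuclideanSpace ℝ (Fin k)} (hZ : Measurable Z) {S : Set Ω} (hS : MeasurableSet S) :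
    ProbabilityMeasure (EuclideanSpace ℝ (Fin k)) :=
  ⟨ρ.map (S.indicator Z), Measure.isProbabilityMeasure_map (hZ.indicator hS).aemeasurable⟩

lemma tendsto_lintegral_exp_truncLaw (hZ : ∀ i, Measurable (Z i)) (hS : ∀ i, MeasurableSet (S i))
    (hL : ∀ u : EuclideanSpace ℝ (Fin k), Tendsto (fun i => ∫⁻ θ in S i,
      ENNReal.ofReal (Real.exp ⟪u, Z i θ⟫) ∂(ρ i)) l (𝓝 (ENNReal.ofReal (Real.exp (‖u‖ ^ 2 / 2)))))
    (h0 : Tendsto (fun i => ρ i (S i)ᶜ) l (𝓝 0)) (u : EuclideanSpace ℝ (Fin k)) :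
    Tendsto (fun i => ∫⁻ x, ENNReal.ofReal (Real.exp ⟪u, x⟫)
      ∂(truncLaw (ρ i) (hZ i) (hS i) : Measure (EuclideanSpace ℝ (Fin k)))) l
      (𝓝 (ENNReal.ofReal (Real.exp (‖u‖ ^ 2 / 2)))) := by
  have h := (hL u).add h0
  rw [add_zero] at h
  refine h.congr fun i => ?_
  have hm : Measurable fun x : EuclideanSpace ℝ (Fin k) => ENNReal.ofReal (Real.exp ⟪u, x⟫) := by
    fun_prop
  rw [truncLaw, ProbabilityMeasure.coe_mk, lintegral_map hm ((hZ i).indicator (hS i)),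
    ← lintegral_add_compl (fun θ => ENNReal.ofReal (Real.exp ⟪u, (S i).indicator (Z i) θ⟫)) (hS i)]
  congr 1
  · refine setLIntegral_congr_fun (hS i) fun θ hθ => ?_
    simp only [Set.indicator_of_mem hθ]
  · rw [← setLIntegral_one]
    refine setLIntegral_congr_fun (hS i).compl fun θ hθ => ?_
    simp only [Set.indicator_of_notMem hθ]
    simp

/-- Convergence of the Laplace transforms on the sets `S i` implies weak convergence to the
standard Gaussian law if the sets `S i` carry the mass in the limit. -/
theorem tendsto_blDist_map (hZ : ∀ i, Measurable (Z i)) (hS : ∀ i, MeasurableSet (S i))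
    (hL : ∀ u : EuclideanSpace ℝ (Fin k), Tendsto (fun i => ∫⁻ θ in S i,
      ENNReal.ofReal (Real.exp ⟪u, Z i θ⟫) ∂(ρ i)) l (𝓝 (ENNReal.ofReal (Real.exp (‖u‖ ^ 2 / 2)))))
    (h0 : Tendsto (fun i => ρ i (S i)ᶜ) l (𝓝 0)) :
    Tendsto (fun i => blDist ((ρ i).map (Z i)) (stdGaussian (EuclideanSpace ℝ (Fin k)))) l
      (𝓝 0) := by
  have h1 := tendsto_blDist (tendsto_stdGaussian_of_lintegral_exp
    (tendsto_lintegral_exp_truncLaw hZ hS hL h0))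
  have h2 : Tendsto (fun i => (ρ i).real (S i)ᶜ) l (𝓝 0) :=
    (ENNReal.tendsto_toReal ENNReal.zero_ne_top).comp h0
  have h3 := h1.add (h2.const_mul 2)
  rw [mul_zero, add_zero] at h3
  refine tendsto_of_tendsto_of_tendsto_of_le_of_le tendsto_const_nhds h3
    (fun i => blDist_nonneg _ _) fun i => ?_
  simp only [ProbabilityMeasure.coe_mk]
  refine blDist_le (add_nonneg (blDist_nonneg _ _) (by positivity)) fun f hf hf1 => ?_
  have hfm : Measurable f := hf.continuous.measurable
  set W := (S i).indicator (Z i) with hW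
  have hWm : Measurable W := (hZ i).indicator (hS i)
  have hint : ∀ {Y : Ω i → EuclideanSpace ℝ (Fin k)}, Measurable Y →
      Integrable (fun θ => f (Y θ)) (ρ i) := fun hY =>
    Integrable.mono' (integrable_const (1 : ℝ)) (hfm.comp hY).aestronglyMeasurable
      (ae_of_all _ fun θ => hf1 _)
  have e1 : |∫ x, f x ∂(ρ i).map (Z i) - ∫ x, f x ∂(ρ i).map W| ≤ 2 * (ρ i).real (S i)ᶜ := by
    rw [integral_map (hZ i).aemeasurable hfm.aestronglyMeasurable,
      integral_map hWm.aemeasurable hfm.aestronglyMeasurable,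
      ← integral_sub (hint (hZ i)) (hint hWm)]
    have e2 : ∀ θ, |f (Z i θ) - f (W θ)| ≤ (S i)ᶜ.indicator (fun _ => (2 : ℝ)) θ := by
      intro θ
      by_cases hθ : θ ∈ S i
      · simp [hW, hθ]
      · rw [Set.indicator_of_mem (show θ ∈ (S i)ᶜ from hθ)]
        have a1 := abs_le.1 (hf1 (Z i θ))
        have a2 := abs_le.1 (hf1 (W θ))
        exact abs_le.2 ⟨by linarith, by linarith⟩
    refine (abs_integral_le_integral_abs).trans ?_
    refine (integral_mono ((hint (hZ i)).sub (hint hWm)).abs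
      ((integrable_const (2 : ℝ)).indicator (hS i).compl) e2).trans (le_of_eq ?_)
    rw [integral_indicator_const _ (hS i).compl, smul_eq_mul, mul_comm]
  have e2 : |∫ x, f x ∂(ρ i).map W - ∫ x, f x ∂(stdGaussian (EuclideanSpace ℝ (Fin k)))| ≤
      blDist ((ρ i).map W) (stdGaussian (EuclideanSpace ℝ (Fin k))) := by
    have : IsProbabilityMeasure ((ρ i).map W) := Measure.isProbabilityMeasure_map hWm.aemeasurable
    have habs : ∀ (g : EuclideanSpace ℝ (Fin k) → ℝ) (μ : Measure (EuclideanSpace ℝ (Fin k)))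
        [IsProbabilityMeasure μ], (∀ x, |g x| ≤ 1) → |∫ x, g x ∂μ| ≤ 1 := fun g μ _ hg => by
      simpa using norm_integral_le_of_norm_le_const (μ := μ) (f := g) (C := 1)
        (ae_of_all _ hg)
    refine le_csSup ⟨2, ?_⟩ ⟨f, hf, hf1, rfl⟩
    rintro _ ⟨g, -, hg, rfl⟩
    have a1 := abs_le.1 (habs g ((ρ i).map W) hg)
    have a2 := abs_le.1 (habs g (stdGaussian _) hg)
    exact abs_le.2 ⟨by linarith, by linarith⟩
  refine (abs_sub_le _ _ _).trans ((add_le_add e1 e2).trans (le_of_eq ?_))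
  rw [add_comm]
  rfl

/-- If moreover the second moments off the sets `S i` vanish, then the integrals of functions of
quadratic growth converge. -/
theorem tendsto_integral_comp (hZ : ∀ i, Measurable (Z i)) (hS : ∀ i, MeasurableSet (S i))
    (hL : ∀ u : EuclideanSpace ℝ (Fin k), Tendsto (fun i => ∫⁻ θ in S i,
      ENNReal.ofReal (Real.exp ⟪u, Z i θ⟫) ∂(ρ i)) l (𝓝 (ENNReal.ofReal (Real.exp (‖u‖ ^ 2 / 2)))))
    (h0 : Tendsto (fun i => ρ i (S i)ᶜ) l (𝓝 0)) (hZ2 : ∀ i, MemLp (Z i) 2 (ρ i))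
    (h2 : Tendsto (fun i => ∫⁻ θ in (S i)ᶜ, ENNReal.ofReal (‖Z i θ‖ ^ 2) ∂(ρ i)) l (𝓝 0))
    {f : EuclideanSpace ℝ (Fin k) → ℝ} (hf : Continuous f) (hf0 : f 0 = 0)
    (hfb : ∀ x, |f x| ≤ 1 + ‖x‖ ^ 2) :
    Tendsto (fun i => ∫ θ, f (Z i θ) ∂(ρ i)) l
      (𝓝 (∫ x, f x ∂(stdGaussian (EuclideanSpace ℝ (Fin k))))) := by
  obtain ⟨s, C, hs⟩ := exists_sq_le_sum_exp k
  have h1 := tendsto_integral_stdGaussian_of_lintegral_exp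
    (tendsto_lintegral_exp_truncLaw hZ hS hL h0) hf s C fun x => by
      refine le_trans ?_ (hs x)
      rw [← sq_abs]
      exact pow_le_pow_left₀ (abs_nonneg _) (hfb x) 2
  have h3 := h0.add h2
  rw [add_zero] at h3
  have hdiff : Tendsto (fun i => ∫ θ in (S i)ᶜ, f (Z i θ) ∂(ρ i)) l (𝓝 0) := by
    rw [tendsto_zero_iff_enorm_tendsto_zero]
    refine tendsto_of_tendsto_of_tendsto_of_le_of_le tendsto_const_nhds h3 (fun _ => zero_le)
      fun i => (enorm_integral_le_lintegral_enorm _).trans ?_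
    rw [← setLIntegral_one, ← lintegral_add_left measurable_const]
    refine lintegral_mono fun θ => ?_
    rw [← ofReal_norm, Real.norm_eq_abs, ← ENNReal.ofReal_one,
      ← ENNReal.ofReal_add zero_le_one (by positivity)]
    exact ENNReal.ofReal_le_ofReal (hfb _)
  have h4 := h1.add hdiff
  rw [add_zero] at h4
  refine h4.congr fun i => ?_
  have hint : Integrable (fun θ => f (Z i θ)) (ρ i) :=
    Integrable.mono' ((integrable_const (1 : ℝ)).add ((hZ2 i).integrable_norm_pow (by norm_num)))
      (hf.measurable.comp (hZ i)).aestronglyMeasurable (ae_of_all _ fun θ => hfb _)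
  rw [truncLaw, ProbabilityMeasure.coe_mk,
    integral_map ((hZ i).indicator (hS i)).aemeasurable hf.aestronglyMeasurable,
    ← integral_add_compl (hS i) hint]
  congr 1
  rw [← integral_indicator (hS i)]
  refine integral_congr_ae (ae_of_all _ fun θ => ?_)
  by_cases hθ : θ ∈ S i
  · simp [hθ]
  · simp [hθ, hf0]

lemma integral_apply_stdGaussian (j : Fin k) :
    ∫ x, x j ∂(stdGaussian (EuclideanSpace ℝ (Fin k))) = 0 :=
  integral_strongDual_stdGaussian (EuclideanSpace.proj j : StrongDual ℝ (EuclideanSpace ℝ (Fin k)))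

lemma integral_apply_mul_apply_stdGaussian (i j : Fin k) :
    ∫ x, x i * x j ∂(stdGaussian (EuclideanSpace ℝ (Fin k))) =
      (1 : Matrix (Fin k) (Fin k) ℝ) i j := by
  have he : ∀ (j : Fin k) (x : EuclideanSpace ℝ (Fin k)), ⟪EuclideanSpace.single j (1 : ℝ), x⟫ = x j :=
    fun j x => by simpa using EuclideanSpace.inner_single_left j (1 : ℝ) x
  have h := covarianceBilin_apply
    (IsGaussian.memLp_id (stdGaussian (EuclideanSpace ℝ (Fin k))) 2 (by simp))
    (EuclideanSpace.single i (1 : ℝ)) (EuclideanSpace.single j (1 : ℝ))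
  simp only [id, integral_id_stdGaussian, sub_zero, he] at h
  rw [← h, covarianceBilin_stdGaussian, innerSL_apply_apply, he, Matrix.one_apply]
  simp

lemma abs_apply_le_one_add_norm_sq (x : EuclideanSpace ℝ (Fin k)) (j : Fin k) :
    |x j| ≤ 1 + ‖x‖ ^ 2 := by
  have := PiLp.norm_apply_le x j
  rw [Real.norm_eq_abs] at this
  nlinarith [sq_nonneg (‖x‖ - 1)]

lemma abs_apply_mul_apply_le_one_add_norm_sq (x : EuclideanSpace ℝ (Fin k)) (i j : Fin k) :
    |x i * x j| ≤ 1 + ‖x‖ ^ 2 := by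
  have h1 := PiLp.norm_apply_le x i
  have h2 := PiLp.norm_apply_le x j
  rw [Real.norm_eq_abs] at h1 h2
  rw [abs_mul]
  have := mul_le_mul h1 h2 (abs_nonneg _) (norm_nonneg _)
  nlinarith

/-- Under the same assumptions the means converge to zero. -/
theorem tendsto_integral_zero (hZ : ∀ i, Measurable (Z i)) (hS : ∀ i, MeasurableSet (S i))
    (hL : ∀ u : EuclideanSpace ℝ (Fin k), Tendsto (fun i => ∫⁻ θ in S i,
      ENNReal.ofReal (Real.exp ⟪u, Z i θ⟫) ∂(ρ i)) l (𝓝 (ENNReal.ofReal (Real.exp (‖u‖ ^ 2 / 2)))))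
    (h0 : Tendsto (fun i => ρ i (S i)ᶜ) l (𝓝 0)) (hZ2 : ∀ i, MemLp (Z i) 2 (ρ i))
    (h2 : Tendsto (fun i => ∫⁻ θ in (S i)ᶜ, ENNReal.ofReal (‖Z i θ‖ ^ 2) ∂(ρ i)) l (𝓝 0)) :
    Tendsto (fun i => ∫ θ, Z i θ ∂(ρ i)) l (𝓝 0) := by
  have h : ∀ j, Tendsto (fun i => (∫ θ, Z i θ ∂(ρ i)) j) l (𝓝 0) := by
    intro j
    have h1 := tendsto_integral_comp hZ hS hL h0 hZ2 h2 (f := fun x => x j) (by fun_prop) (by simp)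
      fun x => abs_apply_le_one_add_norm_sq x j
    rw [integral_apply_stdGaussian] at h1
    refine h1.congr fun i => ?_
    exact (EuclideanSpace.proj j : StrongDual ℝ (EuclideanSpace ℝ (Fin k))).integral_comp_comm
      ((hZ2 i).integrable one_le_two)
  have h3 := ((PiLp.continuous_toLp 2 fun _ : Fin k => ℝ).tendsto 0).comp (tendsto_pi_nhds.2 h)
  exact h3

/-- Under the same assumptions the covariance matrices converge to the identity. -/
theorem tendsto_covariance_one (hZ : ∀ i, Measurable (Z i)) (hS : ∀ i, MeasurableSet (S i))
    (hL : ∀ u : EuclideanSpace ℝ (Fin k), Tendsto (fun i => ∫⁻ θ in S i,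
      ENNReal.ofReal (Real.exp ⟪u, Z i θ⟫) ∂(ρ i)) l (𝓝 (ENNReal.ofReal (Real.exp (‖u‖ ^ 2 / 2)))))
    (h0 : Tendsto (fun i => ρ i (S i)ᶜ) l (𝓝 0)) (hZ2 : ∀ i, MemLp (Z i) 2 (ρ i))
    (h2 : Tendsto (fun i => ∫⁻ θ in (S i)ᶜ, ENNReal.ofReal (‖Z i θ‖ ^ 2) ∂(ρ i)) l (𝓝 0))
    (m n : Fin k) :
    Tendsto (fun i => covariance (fun θ => Z i θ m) (fun θ => Z i θ n) (ρ i)) l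
      (𝓝 ((1 : Matrix (Fin k) (Fin k) ℝ) m n)) := by
  have h1 : ∀ j, Tendsto (fun i => ∫ θ, Z i θ j ∂(ρ i)) l (𝓝 0) := fun j => by
    have h := tendsto_integral_comp hZ hS hL h0 hZ2 h2 (f := fun x => x j) (by fun_prop) (by simp)
      fun x => abs_apply_le_one_add_norm_sq x j
    rwa [integral_apply_stdGaussian] at h
  have h3 := tendsto_integral_comp hZ hS hL h0 hZ2 h2 (f := fun x => x m * x n) (by fun_prop)
    (by simp) fun x => abs_apply_mul_apply_le_one_add_norm_sq x m n
  rw [integral_apply_mul_apply_stdGaussian] at h3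
  have h4 := h3.sub ((h1 m).mul (h1 n))
  rw [mul_zero, sub_zero] at h4
  refine h4.congr fun i => ?_
  have hc : ∀ j, MemLp (fun θ => Z i θ j) 2 (ρ i) := fun j =>
    (EuclideanSpace.proj j : StrongDual ℝ (EuclideanSpace ℝ (Fin k))).comp_memLp' (hZ2 i)
  rw [covariance_eq_sub (hc m) (hc n)]
  rfl

end Truncation

end RenormBvM

end

theorem lemma2p4 {d k : ℕ} {H V : Type*}
    [NormedAddCommGroup H] [InnerProductSpace ℝ H] [CompleteSpace H]
    [MeasurableSpace H] [BorelSpace H]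
    [NormedAddCommGroup V] [InnerProductSpace ℝ V] [FiniteDimensional ℝ V]
    [MeasurableSpace V] [BorelSpace V]
    (M : RenormBvM.Model d k H V)
    -- the hypotheses: contraction, linearization, entropy, invertible information
    (nR : H → ℝ≥0∞) (r₁ r₂ M₀ a b c : ℝ)
    (hcontr : M.PosteriorContraction nR r₁ r₂ M₀ a b c)
    (A : H →L[ℝ] Lp V 2 M.lam) (hlin : M.IsLinearization A)
    (dΘ : MetricSpace M.Θ) (δΘ σ g r : ℕ → ℝ) (J : ℕ → ℝ → ℝ)
    (hent : M.EntropyBounds nR r₁ A dΘ δΘ σ g r J)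
    (hinv : ∀ D : ℕ, (M.infoD A D).IsInvertible)
    -- the conditions for the control of the empirical processes
    (h1 : ∀ (v : EuclideanSpace ℝ (Fin k)) (m : ℝ), 0 < m →
      Tendsto (fun N => (⨆ θ ∈ M.localSet nR r₁ N m,
          M.L2norm (M.G (M.toΘ (θ + M.shift A N v)) - M.G (M.toΘ θ))) /
        ENNReal.ofReal (RenormBvM.Model.rate r₁ N)) atTop (𝓝 0))
    (h2 : ∀ j, Tendsto (fun N : ℕ => nR (M.psiBar A (M.D N) j : H) / ENNReal.ofReal (Real.sqrt N))
      atTop (𝓝 0))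
    (h3 : Tendsto (fun N : ℕ => Real.sqrt N * r N * J N (σ N / r N)) atTop (𝓝 0))
    (h4 : Tendsto (fun N : ℕ => Real.sqrt (Real.log N) * r N ^ 3 * δΘ N *
      J N (σ N / r N) ^ 2 / σ N ^ 2) atTop (𝓝 0))
    (h5 : Tendsto (fun N : ℕ => Real.sqrt N * g N ^ 2 * δΘ N * J N (δΘ N)) atTop (𝓝 0))
    (h6 : Tendsto (fun N : ℕ => g N * J N (δΘ N)) atTop (𝓝 0))
    -- the conditions for the local expansion of the likelihood
    (h7 : Tendsto (fun N : ℕ => (N : ℝ) * (σ N ^ 2 + σ N * RenormBvM.Model.rate r₂ N))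
      atTop (𝓝 0))
    (h8 : Tendsto (fun N : ℕ => Real.sqrt N * ‖(M.θ₀ : H) - M.proj (M.D N) M.θ₀‖) atTop (𝓝 0))
    (h9 : ∀ j, Tendsto (fun N : ℕ => Real.sqrt N * RenormBvM.Model.rate r₂ N *
      ‖M.ψ j - M.proj (M.D N) (M.ψ j)‖) atTop (𝓝 0))
    -- the conditions on the prior
    (h10 : ∀ j, Tendsto (fun N => RenormBvM.Model.rate r₁ N *
      M.ipNorm N (M.psiBar A (M.D N) j)) atTop (𝓝 0))
    (h11 : Tendsto (fun N : ℕ => (N : ℝ) * Real.exp (-(b - a) * RenormBvM.Model.speed r₁ N) *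
      ∫ θ, ‖(θ : H)‖ ^ 4 ∂(M.prior N)) atTop (𝓝 0)) :
    -- the posterior law of `Z_N` converges weakly to `N(0, I_k)` in probability
    TendstoInMeasure M.P (fun N ω => RenormBvM.blDist ((M.posterior N ω).map (M.Z A N ω))
        (stdGaussian (EuclideanSpace ℝ (Fin k)))) atTop (fun _ => 0) ∧
    -- the posterior moments of `Z_N` up to order two exist and converge in probability
    (∀ N ω, MemLp (M.Z A N ω) 2 (M.posterior N ω)) ∧
    TendstoInMeasure M.P (fun N ω => ∫ θ, M.Z A N ω θ ∂(M.posterior N ω)) atTop (fun _ => 0) ∧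
    (∀ i j, TendstoInMeasure M.P (fun N ω => M.covZ A N ω i j) atTop
      (fun _ => (1 : Matrix (Fin k) (Fin k) ℝ) i j)) := by
  have hT : 0 < √(2 * (c + 1)) := Real.sqrt_pos.2 (by
    linarith [hcontr.a_pos, hcontr.a_lt_b, hcontr.b_lt_c])
  have hshift : ∀ (v : EuclideanSpace ℝ (Fin k)) {T m : ℝ}, 0 < T → 0 < m →
      ∀ᶠ N in atTop, ∀ θ ∈ M.truncSet A nR r₁ N T m,
        θ + M.shift A N v ∈ M.truncSet A nR r₁ N (2 * T) (2 * m) := fun v {T m} hT hm =>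
    RenormBvM.Model.eventually_add_shift_mem_truncSet hcontr.norm hcontr.r₁_mem hinv h1 h2 h10 v
      hT hm
  have hZ : ∀ p : ℕ × (ℕ → M.𝒳 × V), Measurable (M.Z A p.1 p.2) := fun p =>
    (RenormBvM.Model.continuous_Z p.1 p.2).measurable
  have hS : ∀ p : ℕ × (ℕ → M.𝒳 × V), MeasurableSet
      (M.truncSet A nR r₁ p.1 (2 * √(2 * (c + 1))) (2 * M₀)) := fun p =>
    M.measurableSet_truncSet hcontr.norm p.1 _ _
  have hL : ∀ u : EuclideanSpace ℝ (Fin k), Tendsto (fun p : ℕ × (ℕ → M.𝒳 × V) =>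
      ∫⁻ θ in M.truncSet A nR r₁ p.1 (2 * √(2 * (c + 1))) (2 * M₀),
        ENNReal.ofReal (Real.exp ⟪u, M.Z A p.1 p.2 θ⟫) ∂(M.posterior p.1 p.2))
      (RenormBvM.inProb M.P) (𝓝 (ENNReal.ofReal (Real.exp (‖u‖ ^ 2 / 2)))) := by
    intro u
    obtain ⟨W, hWm, hW0, hW⟩ := RenormBvM.Model.exists_expansion hcontr (m := 4 * M₀)
      (by linarith [hcontr.M₀_pos]) hent hinv h3 h4 h5 h7 h8 (-u)
    obtain ⟨q, hq0, hq⟩ := RenormBvM.Model.exists_bound_ipDual_shift (nR := nR) hcontr.r₁_mem hinv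
      h10 (-u)
    have h := RenormBvM.Model.tendsto_laplace hcontr hshift hq0 (-u) hq hWm hW0 hW
    simpa only [inner_neg_left, neg_neg, norm_neg] using h
  have hP : Tendsto (fun p : ℕ × (ℕ → M.𝒳 × V) => M.posterior p.1 p.2
      (M.truncSet A nR r₁ p.1 (2 * √(2 * (c + 1))) (2 * M₀))ᶜ) (RenormBvM.inProb M.P) (𝓝 0) := by
    have h := hcontr.tendsto_mul_posterior_compl (A := A) (κ := fun _ => 1) (fun _ => zero_le_one)
      (by simpa only [one_mul] using hcontr.tendsto_exp_speed)
    simpa only [ENNReal.ofReal_one, one_mul] using h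
  have hZ2 : ∀ p : ℕ × (ℕ → M.𝒳 × V), MemLp (M.Z A p.1 p.2) 2 (M.posterior p.1 p.2) := fun p =>
    RenormBvM.Model.memLp_Z p.1 p.2
  have hM2 := RenormBvM.Model.tendsto_lintegral_norm_Z_sq_compl (A := A) hcontr hinv h11
  refine ⟨?_, fun N ω => hZ2 (N, ω), ?_, fun i j => ?_⟩
  · exact RenormBvM.tendstoInMeasure_of_tendsto_inProb
      (RenormBvM.tendsto_blDist_map hZ hS hL hP)
  · exact RenormBvM.tendstoInMeasure_of_tendsto_inProb
      (RenormBvM.tendsto_integral_zero hZ hS hL hP hZ2 hM2)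
  · exact RenormBvM.tendstoInMeasure_of_tendsto_inProb
      (RenormBvM.tendsto_covariance_one hZ hS hL hP hZ2 hM2 i j)
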